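/- Let $1<\alpha\le 2$, $0<\beta<\alpha-1$, $\phi_1>0$ and $\gamma>0$, and assume that it is not the case that both $\gamma<1/2$ and $\beta=(\alpha-1)/2$. Let $\mathcal M$ be a symmetric $\alpha$-stable random measure on $\mathbb R^2\times(0,\infty)$ (independently scattered and a.s. $\sigma$-additive on sets of finite control measure) with control measure $\mathrm d\mu(u,v,z)=\phi_1 z^{\beta}\,\mathrm du\,\mathrm dv\,\mathrm dz$, that is, $\mathrm E\,\mathrm e^{\mathrm i\theta\mathcal M(B)}=\mathrm e^{-|\theta|^\alpha\mu(B)}$ for all $\theta\in\mathbb R$ and all measurable $B$ with $\mu(B)<\infty$. Put $$h_3(t,s,z)=\frac{3}{2\sqrt{\pi t}}\,\mathrm e^{-3zt-\frac{s^2}{4t}}\mathbf 1(t>0,z>0),$$ $$F_{3\gamma}(x,y;u,v,z)=\begin{cases}\int_0^x\!\int_0^y h_3(t-u,s-v,z)\,\mathrm ds\,\mathrm dt,&\gamma=1/2,\\ \mathbf 1(0<v<y)\int_0^x\mathrm dt\int_{\mathbb R}h_3(t-u,w,z)\,\mathrm dw,&\gamma>1/2,\\ \mathbf 1(0<u<x)\int_0^y\mathrm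 ds\int_{\mathbb R}h_3(w,v-s,z)\,\mathrm dw,&\gamma<1/2,\ \beta>(\alpha-1)/2,\\ y\int_0^x h_3(t-u,v,z)\,\mathrm dt,&\gamma<1/2,\ \beta<(\alpha-1)/2,\end{cases}$$ and let $V_{3\gamma}(x,y)=\int F_{3\gamma}(x,y;\cdot)\,\mathrm d\mathcal M$, $x,y\ge 0$, where $\int f\,\mathrm d\mathcal M$, for $f\in L^\alpha(\mu)$, is the limit in probability of $\int f_n\,\mathrm d\mathcal M$ for simple functions $f_n\to f$ in $L^\alpha(\mu)$. A *rectangle* is a set $K=(u,x]\times(v,y]$ with $0\le u<x$, $0\le v<y$, and $V(K)=V(x,y)-V(u,y)-V(x,v)+V(u,v)$; the same formula is used if $u=x$ or $v=y$. Let $\ell$ be a line through the origin. A random field $V$ on $[0,\infty)^2$ has *independent rectangular increments in direction $\ell$* if $V(K)$ and $V(K')$ are independent whenever the rectangles $K,K'$ lie on different sides of some line orthogonal to $\ell$; it has *invariant rectangular increments in direction $\ell$* if $V(K)=V(K')$ a.s. whenever $K'=p+K$ with $p\in\ell$; it has *dependent rectangular increments in direction $\ell$* if neither holds. It has *dependent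 rectangular increments* if this is so in every direction, and *semi-dependent rectangular increments* if there are lines $\ell_1,\ell_2$ through the origin such that $V$ has dependent rectangular increments in direction $\ell_1$ and independent or invariant ones in direction $\ell_2$. Then: (i) $V_{3\gamma}$ is well-defined: $F_{3\gamma}(x,y;\cdot)\in L^\alpha(\mu)$ for all $x,y\ge0$, and the integrals exist and are a.s. unique. It has $\alpha$-stable finite-dimensional distributions, $V_{3\gamma}(x,0)=V_{3\gamma}(0,y)=0$ a.s., and stationary rectangular increments: for all $u,v\ge0$ the fields $V_{3\gamma}((u,x]\times(v,y])$ and $V_{3\gamma}((0,x-u]\times(0,y-v])$, $x\ge u$, $y\ge v$, have the same finite-dimensional distributions. (ii) $V_{3\gamma}$ is operator scaling: for every $\lambda>0$ the fields $V_{3\gamma}(\lambda x,\lambda^\gamma y)$ and $\lambda^{H(\gamma)}V_{3\gamma}(x,y)$, $x,y\ge0$, have the same finite-dimensional distributions, where $$H(\gamma)=\begin{cases}\frac{\gamma+\alpha-\beta}{\alpha},&\gamma\ge1/2,\\ \frac{1-\gamma+2\gamma(\alpha-\beta)}{\alpha},&\gamma<1/2,\ \beta>(\alpha-1)/2,\\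 \frac{\alpha\gamma+(\alpha+1)/2-\beta}{\alpha},&\gamma<1/2,\ \beta<(\alpha-1)/2,\end{cases}$$ and $H(\gamma)>0$. (iii) $V_{3\gamma}$ has dependent rectangular increments if $\gamma=1/2$, and semi-dependent rectangular increments if $\gamma\ne1/2$. -/

import Mathlib

open MeasureTheory ProbabilityTheory Filter Topology

noncomputable section

namespace RF

/-! ### Lines and rectangles in the plane -/

/-- A line `{(x, y) : a x + b y = c}` in the plane. -/
structure PlaneLine where
  a : ℝ
  b : ℝ
  c : ℝ
  nondeg : a ≠ 0 ∨ b ≠ 0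

/-- The points of a line. -/
def PlaneLine.carrier (l : PlaneLine) : Set (ℝ × ℝ) := {p | l.a * p.1 + l.b * p.2 = l.c}

/-- Two lines are perpendicular. -/
def PlaneLine.Perp (l l' : PlaneLine) : Prop := l.a * l'.a + l.b * l'.b = 0

/-- A nonempty rectangle `(u, x] × (v, y]` contained in the open quadrant `(0, ∞)²`. -/
structure Rect where
  u : ℝ
  v : ℝ
  x : ℝ
  y : ℝ
  u_nonneg : 0 ≤ u
  v_nonneg : 0 ≤ v
  u_lt_x : u < x
  v_lt_y : v < y

/-- The points of a rectangle. -/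
def Rect.toSet (K : Rect) : Set (ℝ × ℝ) := Set.Ioc K.u K.x ×ˢ Set.Ioc K.v K.y

/-- `K' = p + K`. -/
def Rect.IsShift (K K' : Rect) (p : ℝ × ℝ) : Prop :=
  K'.u = K.u + p.1 ∧ K'.v = K.v + p.2 ∧ K'.x = K.x + p.1 ∧ K'.y = K.y + p.2

/-- Two rectangles lie on different sides of a line. (The sides are closed half-planes; the
rectangles are half-open, so they are then automatically disjoint.) -/
def PlaneLine.Separates (l : PlaneLine) (K K' : Rect) : Prop :=
  ((∀ p ∈ K.toSet, l.a * p.1 + l.b * p.2 ≤ l.c) ∧ (∀ p ∈ K'.toSet, l.c ≤ l.a * p.1 + l.b * p.2)) ∨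
  ((∀ p ∈ K'.toSet, l.a * p.1 + l.b * p.2 ≤ l.c) ∧ (∀ p ∈ K.toSet, l.c ≤ l.a * p.1 + l.b * p.2))

/-! ### Random fields on the closed quadrant and their rectangular increments

A random field is `V : ℝ → ℝ → Ω → ℝ`; only the values `V x y` with `0 ≤ x`, `0 ≤ y` are used. -/

section Fields

variable {Ω : Type*} [MeasurableSpace Ω]

/-- The increment `V(x,y) - V(u,y) - V(x,v) + V(u,v)` of `V` on the rectangle `(u,x] × (v,y]`. -/
def incr (V : ℝ → ℝ → Ω → ℝ) (u v x y : ℝ) (ω : Ω) : ℝ :=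
  V x y ω - V u y ω - V x v ω + V u v ω

/-- The increment of `V` on a rectangle. -/
def rectIncr (V : ℝ → ℝ → Ω → ℝ) (K : Rect) : Ω → ℝ := incr V K.u K.v K.x K.y

/-- The fields `X`, `Y`, indexed by the points of `T`, have the same finite-dimensional
distributions. -/
def FddEqOn (P : Measure Ω) (T : Set (ℝ × ℝ)) (X Y : ℝ → ℝ → Ω → ℝ) : Prop :=
  ∀ (n : ℕ) (t : Fin n → ℝ × ℝ), (∀ i, t i ∈ T) →
    IdentDistrib (fun ω i => X (t i).1 (t i).2 ω) (fun ω i => Y (t i).1 (t i).2 ω) P P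

/-- A probability law on `ℝⁿ` is `α`-stable: if `X₁, X₂` are independent copies of `X` and
`A, B > 0`, then `A X₁ + B X₂` has the law of `(A^α + B^α)^(1/α) X + D` for some vector `D`. -/
def IsStableLaw (α : ℝ) {n : ℕ} (Q : Measure (Fin n → ℝ)) : Prop :=
  ∀ A B : ℝ, 0 < A → 0 < B → ∃ D : Fin n → ℝ,
    (Q.map (fun w => A • w)).conv (Q.map (fun w => B • w)) =
      Q.map (fun w => ((A ^ α + B ^ α) ^ (1 / α)) • w + D)

/-- The finite-dimensional distributions of `V` on the closed quadrant are `α`-stable. -/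
def HasStableFdd (P : Measure Ω) (α : ℝ) (V : ℝ → ℝ → Ω → ℝ) : Prop :=
  ∀ (n : ℕ) (t : Fin n → ℝ × ℝ), (∀ i, 0 ≤ (t i).1 ∧ 0 ≤ (t i).2) →
    IsStableLaw α (P.map (fun ω i => V (t i).1 (t i).2 ω))

/-- `V` has stationary rectangular increments. -/
def HasStationaryRectIncrements (P : Measure Ω) (V : ℝ → ℝ → Ω → ℝ) : Prop :=
  ∀ u v : ℝ, 0 ≤ u → 0 ≤ v →
    FddEqOn P {p | u ≤ p.1 ∧ v ≤ p.2}
      (fun x y => incr V u v x y) (fun x y => incr V 0 0 (x - u) (y - v))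

/-- `V` is an operator scaling random field with exponent `H > 0` and matrix `diag(1, γ)`. -/
def IsOperatorScaling (P : Measure Ω) (γ H : ℝ) (V : ℝ → ℝ → Ω → ℝ) : Prop :=
  0 < γ ∧ 0 < H ∧ ∀ r : ℝ, 0 < r →
    FddEqOn P {p | 0 ≤ p.1 ∧ 0 ≤ p.2}
      (fun x y => V (r * x) (r ^ γ * y)) (fun x y ω => r ^ H * V x y ω)

/-- Independent rectangular increments in direction `l`. -/
def IndepRectIncrements (P : Measure Ω) (V : ℝ → ℝ → Ω → ℝ) (l : PlaneLine) : Prop :=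
  ∀ l' : PlaneLine, l.Perp l' → ∀ K K' : Rect, l'.Separates K K' →
    IndepFun (rectIncr V K) (rectIncr V K') P

/-- Invariant rectangular increments in direction `l`. -/
def InvariantRectIncrements (P : Measure Ω) (V : ℝ → ℝ → Ω → ℝ) (l : PlaneLine) : Prop :=
  ∀ K K' : Rect, ∀ p ∈ l.carrier, K.IsShift K' p → rectIncr V K =ᵐ[P] rectIncr V K'

/-- Dependent rectangular increments in direction `l`. -/
def DependentRectIncrementsIn (P : Measure Ω) (V : ℝ → ℝ → Ω → ℝ) (l : PlaneLine) : Prop :=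
  ¬ IndepRectIncrements P V l ∧ ¬ InvariantRectIncrements P V l

/-- Dependent rectangular increments: dependent in the direction of every line through `0`. -/
def HasDependentRectIncrements (P : Measure Ω) (V : ℝ → ℝ → Ω → ℝ) : Prop :=
  ∀ l : PlaneLine, (0, 0) ∈ l.carrier → DependentRectIncrementsIn P V l

/-- Semi-dependent rectangular increments. -/
def HasSemiDependentRectIncrements (P : Measure Ω) (V : ℝ → ℝ → Ω → ℝ) : Prop :=
  ∃ l₁ l₂ : PlaneLine, (0, 0) ∈ l₁.carrier ∧ (0, 0) ∈ l₂.carrier ∧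
    DependentRectIncrementsIn P V l₁ ∧
    (IndepRectIncrements P V l₂ ∨ InvariantRectIncrements P V l₂)

end Fields

/-! ### Symmetric stable random measures and their integrals -/

section StableIntegral

variable {Ω : Type*} [MeasurableSpace Ω] {S : Type*} [MeasurableSpace S]

/-- `M` is a symmetric `α`-stable random measure on `S` with control measure `μ`: an independently
scattered, almost surely `σ`-additive random set function on the measurable sets of finite
`μ`-measure, with `E exp(i θ M(B)) = exp(-|θ|^α μ(B))`. (Values of `M` on other sets are
irrelevant. The series `∑ M(B i)` converges almost surely, in general not absolutely.) -/
structure IsStableRandomMeasure (P : Measure Ω) (μ : Measure S) (α : ℝ) (M : Set S → Ω → ℝ) :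
    Prop where
  measurable : ∀ B, MeasurableSet B → μ B < ⊤ → Measurable (M B)
  charFun_eq : ∀ B, MeasurableSet B → μ B < ⊤ → ∀ θ : ℝ,
    ∫ ω, Complex.exp (Complex.I * ((θ * M B ω : ℝ) : ℂ)) ∂P =
      ((Real.exp (-(|θ| ^ α * (μ B).toReal)) : ℝ) : ℂ)
  indep : ∀ (n : ℕ) (B : Fin n → Set S), (∀ i, MeasurableSet (B i)) → (∀ i, μ (B i) < ⊤) →
    Pairwise (Function.onFun Disjoint B) → iIndepFun (fun i => M (B i)) P
  sigma_additive : ∀ B : ℕ → Set S, (∀ i, MeasurableSet (B i)) → μ (⋃ i, B i) < ⊤ →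
    Pairwise (Function.onFun Disjoint B) →
    ∀ᵐ ω ∂P, Tendsto (fun n => ∑ i ∈ Finset.range n, M (B i) ω) atTop (𝓝 (M (⋃ i, B i) ω))

/-- The integral `∑ c M(f = c)` of a simple function. -/
def simpleIntegral (M : Set S → Ω → ℝ) (f : SimpleFunc S ℝ) (ω : Ω) : ℝ :=
  ∑ c ∈ f.range, c * M (f ⁻¹' {c}) ω

/-- The random variable `X` is (a version of) the stochastic integral `∫ f dM`: `f ∈ L^α(μ)`, and
for every sequence of simple functions of `L^α(μ)` converging to `f` in `L^α(μ)`, the integrals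
converge to `X` in probability. -/
def IsStableIntegral (P : Measure Ω) (μ : Measure S) (α : ℝ) (M : Set S → Ω → ℝ)
    (f : S → ℝ) (X : Ω → ℝ) : Prop :=
  Measurable X ∧ MemLp f (ENNReal.ofReal α) μ ∧
    ∀ g : ℕ → SimpleFunc S ℝ, (∀ n, MemLp (g n) (ENNReal.ofReal α) μ) →
      Tendsto (fun n => eLpNorm (fun s => g n s - f s) (ENNReal.ofReal α) μ) atTop (𝓝 0) →
      TendstoInMeasure P (fun n => simpleIntegral M (g n)) atTop X

end StableIntegral

/-! ### The field `V_{3γ}` -/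

/-- The kernel `h₃(t,s,z) = 3 / (2 √(π t)) exp(-3 z t - s² / (4 t)) 1(t > 0, z > 0)`. -/
def h3 (t s z : ℝ) : ℝ :=
  if 0 < t ∧ 0 < z then
    3 / (2 * Real.sqrt (Real.pi * t)) * Real.exp (-3 * z * t - s ^ 2 / (4 * t))
  else 0

/-- The integrand `F_{3γ}(x, y; u, v, z)`. In the last branch `γ < 1/2` and `β < (α - 1)/2`
(the value `β = (α - 1)/2` is excluded there in all uses). -/
def F3 (α β γ x y : ℝ) (p : ℝ × ℝ × ℝ) : ℝ :=
  let u := p.1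
  let v := p.2.1
  let z := p.2.2
  if γ = 1 / 2 then ∫ t in (0 : ℝ)..x, ∫ s in (0 : ℝ)..y, h3 (t - u) (s - v) z
  else if 1 / 2 < γ then
    (if 0 < v ∧ v < y then 1 else 0) * ∫ t in (0 : ℝ)..x, ∫ w : ℝ, h3 (t - u) w z
  else if (α - 1) / 2 < β then
    (if 0 < u ∧ u < x then 1 else 0) * ∫ s in (0 : ℝ)..y, ∫ w : ℝ, h3 w (v - s) z
  else y * ∫ t in (0 : ℝ)..x, h3 (t - u) v z

/-- The control measure `φ₁ z^β du dv dz` on `ℝ² × (0, ∞)`, seen as a measure on `ℝ³` that is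
carried by `{z > 0}`. -/
def control3 (φ₁ β : ℝ) : Measure (ℝ × ℝ × ℝ) :=
  (volume : Measure (ℝ × ℝ × ℝ)).withDensity
    (fun p => if 0 < p.2.2 then ENNReal.ofReal (φ₁ * p.2.2 ^ β) else 0)

/-- `V` is (a version of) the field `V_{3γ}(x,y) = ∫ F_{3γ}(x,y; ·) dM`, `x, y ≥ 0`. -/
def IsField3 {Ω : Type*} [MeasurableSpace Ω] (P : Measure Ω) (φ₁ α β γ : ℝ)
    (M : Set (ℝ × ℝ × ℝ) → Ω → ℝ) (V : ℝ → ℝ → Ω → ℝ) : Prop :=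
  ∀ x y : ℝ, 0 ≤ x → 0 ≤ y →
    IsStableIntegral P (control3 φ₁ β) α M (F3 α β γ x y) (V x y)

/-- The scaling exponent `H(γ)`. -/
def H3 (α β γ : ℝ) : ℝ :=
  if 1 / 2 ≤ γ then (γ + α - β) / α
  else if (α - 1) / 2 < β then (1 - γ + 2 * γ * (α - β)) / α
  else (α * γ + (α + 1) / 2 - β) / α

end RF

end

/-! For a stable random measure the integral `X` of `f` has characteristic function `θ ↦ exp(-(|θ|
‖f‖)^α)`, where `‖f‖` is the `L^α(μ)` norm. This holds for simple functions by independent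
scattering, and it survives limits in probability. A tail estimate derived from it makes simple
integrals Cauchy in probability along `L^α` approximations, so integrals exist, are a.s. unique and
are linear. Every linear combination of integrals is again such an integral, hence joint laws are
read off from the norms of linear combinations of kernels (`IsStableIntegral.charFunDual_map`), and
each probabilistic claim becomes a statement about `F3`.

Membership in `L^α`: write `|F|^α ≤ (sup |F|)^(α-1) |F|`. The plane integral of `|F|` at height `z`
is at most a constant times `1/z`, because `h3` has total mass `1/z` over time and space. If the
supremum is at most a constant times `z^(-a)` for small `z` and `z^(-b)` for large `z`, what remains
is the integrability of `z^(β-1-a(α-1))` at zero and of `z^(β-1-b(α-1))` at infinity, that is,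
`a(α-1) < β < b(α-1)`. The regimes of `F3` correspond to the choices of `a` and `b`.

Stationarity and scaling: a rectangular increment of the field is the integral of an explicit kernel
`incKer`. Translating the rectangle translates this kernel in the plane, which leaves the control
measure invariant. The parabolic scaling of `h3` makes `F3` homogeneous under diagonal maps, which
multiply the control measure by a power; collecting exponents gives `H3`.

Dependence: two integrals are independent if their kernels have a.e. disjoint supports. The converse
holds for nonnegative kernels, since `(a+b)^α > a^α + b^α` for `a, b > 0` and `α > 1`. Two integrals
agree a.s. exactly when the kernels agree a.e. For `γ = 1/2` the kernel is positive at all points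
earlier than the right edge of the rectangle, so no direction gives independence, and its profile
changes under every shift. For `γ ≠ 1/2` one coordinate enters only through an indicator
(independence along that axis) or only through the side length `y - v` (invariance), while the other
axis keeps genuine dependence. -/

namespace RF

/-! ### Symmetric stable variables on the line -/

section Scale

variable {Ω : Type*} [MeasurableSpace Ω] {P : Measure Ω}

/-- `X` is a symmetric `α`-stable variable with scale parameter `σ`. -/
structure HasStableScale (P : Measure Ω) (α σ : ℝ) (X : Ω → ℝ) : Prop where
  measurable : Measurable X
  charFun_eq : ∀ θ : ℝ, charFun (P.map X) θ = ((Real.exp (-(|θ| * σ) ^ α) : ℝ) : ℂ)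

theorem HasStableScale.congr {α σ : ℝ} {X Y : Ω → ℝ} (h : HasStableScale P α σ X)
    (hY : Measurable Y) (hXY : X =ᵐ[P] Y) : HasStableScale P α σ Y :=
  ⟨hY, by rw [← Measure.map_congr hXY]; exact h.charFun_eq⟩

theorem HasStableScale.ae_eq_zero [IsProbabilityMeasure P] {α : ℝ} (hα : 0 < α) {X : Ω → ℝ}
    (h : HasStableScale P α 0 X) : X =ᵐ[P] 0 := by
  have : IsProbabilityMeasure (P.map X) := Measure.isProbabilityMeasure_map h.measurable.aemeasurable
  have h1 : P.map X = Measure.dirac 0 := by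
    apply Measure.ext_of_charFun
    ext θ
    rw [h.charFun_eq, charFun_dirac]
    simp [Real.zero_rpow hα.ne']
  have h2 : ∀ᵐ x ∂(P.map X), x = 0 := by rw [h1, ae_dirac_eq]; simp
  exact ae_of_ae_map h.measurable.aemeasurable h2

theorem HasStableScale.unique {α σ τ : ℝ} (hα : 0 < α) (hσ : 0 ≤ σ) (hτ : 0 ≤ τ) {X : Ω → ℝ}
    (h : HasStableScale P α σ X) (h' : HasStableScale P α τ X) : σ = τ := by
  have := (h.charFun_eq 1).symm.trans (h'.charFun_eq 1)
  rw [Complex.ofReal_inj, Real.exp_eq_exp] at this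
  simp only [abs_one, one_mul, neg_inj] at this
  exact (Real.rpow_left_inj hσ hτ hα.ne').1 this

/-- The tail beyond `r` is controlled by the integral of `1 - charFun` over `[-2/r, 2/r]`. The
integrand is at most `(2σ/r)^α` there by `1 - exp(-x) ≤ x`, the interval has length `4/r`, and the
prefactor is `r/2`. -/
theorem HasStableScale.tail_le [IsProbabilityMeasure P] {α σ : ℝ} (hα : 0 < α) (hσ : 0 ≤ σ)
    {X : Ω → ℝ} (h : HasStableScale P α σ X) {r : ℝ} (hr : 0 < r) :
    P.real {ω | r < |X ω|} ≤ 2 * (2 * r⁻¹ * σ) ^ α := by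
  have : IsProbabilityMeasure (P.map X) := Measure.isProbabilityMeasure_map h.measurable.aemeasurable
  have h1 := measureReal_abs_gt_le_integral_charFun (μ := P.map X) hr
  rw [map_measureReal_apply h.measurable (measurableSet_lt measurable_const (by fun_prop))] at h1
  have h2 : ‖∫ t in (-2 * r⁻¹)..(2 * r⁻¹), 1 - charFun (P.map X) t‖ ≤
      (2 * r⁻¹ * σ) ^ α * |2 * r⁻¹ - (-2 * r⁻¹)| := by
    apply intervalIntegral.norm_integral_le_of_norm_le_const
    intro t ht
    rw [h.charFun_eq]
    have ht' : |t| ≤ 2 * r⁻¹ := by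
      have hr' : 0 < r⁻¹ := by positivity
      rw [Set.uIoc_of_le (by linarith)] at ht
      rw [abs_le]; exact ⟨by linarith [ht.1], ht.2⟩
    have h0 : (|t| * σ) ^ α ≤ (2 * r⁻¹ * σ) ^ α := by gcongr
    have h3 := Real.add_one_le_exp (-(|t| * σ) ^ α)
    have h4 : Real.exp (-(|t| * σ) ^ α) ≤ 1 := by
      rw [Real.exp_le_one_iff]
      have : 0 ≤ (|t| * σ) ^ α := by positivity
      linarith
    rw [← Complex.ofReal_one, ← Complex.ofReal_sub, Complex.norm_real, Real.norm_eq_abs, abs_le]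
    constructor <;> linarith
  refine h1.trans ?_
  have h5 : |2 * r⁻¹ - (-2 * r⁻¹)| = 4 * r⁻¹ := by
    rw [abs_of_nonneg]
    · ring
    · have : 0 < r⁻¹ := by positivity
      linarith
  rw [h5] at h2
  calc 2⁻¹ * r * _ ≤ 2⁻¹ * r * ((2 * r⁻¹ * σ) ^ α * (4 * r⁻¹)) := by gcongr
    _ = 2 * (2 * r⁻¹ * σ) ^ α := by field_simp; ring

/-- A subsequence converges a.s., so its characteristic functions converge by dominated convergence,
while the explicit formula is continuous in the scale. -/
theorem HasStableScale.tendsto [IsProbabilityMeasure P] {α σ : ℝ} (hα : 0 < α)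
    {X : ℕ → Ω → ℝ} {Y : Ω → ℝ} {s : ℕ → ℝ}
    (h : ∀ n, HasStableScale P α (s n) (X n)) (hs : Tendsto s atTop (𝓝 σ)) (hY : Measurable Y)
    (hXY : TendstoInMeasure P X atTop Y) : HasStableScale P α σ Y := by
  refine ⟨hY, fun θ => ?_⟩
  obtain ⟨ns, hns, hae⟩ := hXY.exists_seq_tendsto_ae
  have h1 : Tendsto (fun n => charFun (P.map (X (ns n))) θ) atTop (𝓝 (charFun (P.map Y) θ)) := by
    have he : ∀ Z : Ω → ℝ, Measurable Z → charFun (P.map Z) θ =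
        ∫ ω, Complex.exp (θ * Z ω * Complex.I) ∂P := by
      intro Z hZ
      rw [charFun_apply_real, integral_map hZ.aemeasurable]
      exact Measurable.aestronglyMeasurable (by fun_prop)
    rw [he Y hY]
    simp_rw [he _ (h _).measurable]
    refine tendsto_integral_of_dominated_convergence (fun _ => 1) ?_ (integrable_const _) ?_ ?_
    · intro n
      have := (h (ns n)).measurable
      exact Measurable.aestronglyMeasurable (by fun_prop)
    · intro n
      refine ae_of_all _ fun ω => ?_
      rw [← Complex.ofReal_mul, Complex.norm_exp_ofReal_mul_I]
    · filter_upwards [hae] with ω hω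
      have hc : Continuous fun x : ℝ => Complex.exp (θ * x * Complex.I) := by fun_prop
      exact (hc.tendsto _).comp hω
  have h2 : Tendsto (fun n => ((Real.exp (-(|θ| * s (ns n)) ^ α) : ℝ) : ℂ)) atTop
      (𝓝 ((Real.exp (-(|θ| * σ) ^ α) : ℝ) : ℂ)) := by
    have hc : Continuous fun x : ℝ => ((Real.exp (-(|θ| * x) ^ α) : ℝ) : ℂ) := by
      have : Continuous fun x : ℝ => x ^ α := Real.continuous_rpow_const hα.le
      fun_prop
    exact (hc.tendsto _).comp (hs.comp hns.tendsto_atTop)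
  refine tendsto_nhds_unique h1 ?_
  simpa only [(h _).charFun_eq] using h2

theorem HasStableScale.tendstoInMeasure_zero [IsProbabilityMeasure P] {α : ℝ} (hα : 0 < α)
    {X : ℕ → Ω → ℝ} {s : ℕ → ℝ} (h : ∀ n, HasStableScale P α (s n) (X n)) (hs0 : ∀ n, 0 ≤ s n)
    (hs : Tendsto s atTop (𝓝 0)) : TendstoInMeasure P X atTop 0 := by
  rw [tendstoInMeasure_iff_measureReal_norm]
  intro ε hε
  have hc : Continuous fun x : ℝ => 2 * (2 * (ε / 2)⁻¹ * x) ^ α := by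
    have : Continuous fun x : ℝ => x ^ α := Real.continuous_rpow_const hα.le
    fun_prop
  have hlim : Tendsto (fun n => 2 * (2 * (ε / 2)⁻¹ * s n) ^ α) atTop (𝓝 0) := by
    have := (hc.tendsto 0).comp hs
    simpa [Real.zero_rpow hα.ne', Function.comp_def] using this
  refine squeeze_zero (fun n => measureReal_nonneg) (fun n => ?_) hlim
  -- Convergence in measure concerns `ε ≤ |X|` but the tail bound concerns a strict inequality,
  -- hence the use of `ε / 2`.
  refine le_trans (measureReal_mono ?_) ((h n).tail_le hα (hs0 n) (half_pos hε))
  intro ω hω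
  simp only [Set.mem_ofPred_eq, Pi.zero_apply, sub_zero, Real.norm_eq_abs] at hω ⊢
  linarith

end Scale

/-! ### Simple integrals -/

section SimpleIntegral

variable {Ω : Type*} [MeasurableSpace Ω] {S : Type*} [MeasurableSpace S]
  {P : Measure Ω} {μ : Measure S} {α : ℝ} {M : Set S → Ω → ℝ}

theorem IsStableRandomMeasure.charFun_map (hM : IsStableRandomMeasure P μ α M) {B : Set S}
    (hB : MeasurableSet B) (hμB : μ B < ⊤) (θ : ℝ) :
    charFun (P.map (M B)) θ = ((Real.exp (-(|θ| ^ α * (μ B).toReal)) : ℝ) : ℂ) := by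
  rw [← hM.charFun_eq B hB hμB θ, charFun_apply_real,
    integral_map (hM.measurable B hB hμB).aemeasurable
      (Measurable.aestronglyMeasurable (by fun_prop))]
  refine integral_congr_ae (ae_of_all _ fun ω => ?_)
  simp only [Complex.ofReal_mul]
  congr 1; ring

theorem IsStableRandomMeasure.empty [IsProbabilityMeasure P] (hα : 0 < α)
    (hM : IsStableRandomMeasure P μ α M) : M ∅ =ᵐ[P] 0 := by
  apply HasStableScale.ae_eq_zero (α := α) hα
  refine ⟨hM.measurable ∅ .empty (by simp), fun θ => ?_⟩
  rw [hM.charFun_map .empty (by simp)]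
  simp [Real.zero_rpow hα.ne']

/-- Apply `σ`-additivity to the sequence `A, B, ∅, ∅, …`: the partial sums are constant from the
second on, because `M ∅` vanishes a.s. -/
theorem IsStableRandomMeasure.union [IsProbabilityMeasure P] (hα : 0 < α)
    (hM : IsStableRandomMeasure P μ α M) {A B : Set S} (hA : MeasurableSet A)
    (hB : MeasurableSet B) (hμA : μ A < ⊤) (hμB : μ B < ⊤) (hAB : Disjoint A B) :
    M (A ∪ B) =ᵐ[P] fun ω => M A ω + M B ω := by
  let C : ℕ → Set S := fun n => if n = 0 then A else if n = 1 then B else ∅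
  have hU : ⋃ n, C n = A ∪ B := by
    ext s
    simp only [Set.mem_iUnion, Set.mem_union, C]
    constructor
    · rintro ⟨n, hn⟩
      split_ifs at hn
      · exact Or.inl hn
      · exact Or.inr hn
      · exact hn.elim
    · rintro (h | h)
      · exact ⟨0, by simpa using h⟩
      · exact ⟨1, by simpa using h⟩
  have h1 := hM.sigma_additive C
    (by intro i; simp only [C]; split_ifs <;> first | assumption | exact .empty)
    (by rw [hU]; exact (measure_union_le _ _).trans_lt (ENNReal.add_lt_top.2 ⟨hμA, hμB⟩))
    (by
      intro i j hij
      simp only [Function.onFun, C]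
      split_ifs <;> first | (exfalso; omega) | exact hAB | exact hAB.symm | simp)
  rw [hU] at h1
  filter_upwards [h1, hM.empty hα] with ω hω h0
  refine tendsto_nhds_unique hω ?_
  refine tendsto_const_nhds.congr' ?_
  filter_upwards [eventually_ge_atTop 2] with n hn
  rw [← Finset.sum_subset (Finset.range_mono hn)]
  · simp [C, Finset.sum_range_succ]
  · intro i _ hi
    have hi : 2 ≤ i := not_lt.1 fun h => hi (Finset.mem_range.2 h)
    have : C i = ∅ := by simp [C, show i ≠ 0 by omega, show i ≠ 1 by omega]
    rw [this, h0, Pi.zero_apply]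

theorem IsStableRandomMeasure.preimage_finset [IsProbabilityMeasure P] (hα : 0 < α)
    (hM : IsStableRandomMeasure P μ α M) {E : Type*} (h : SimpleFunc S E) (s : Finset E)
    (hs : ∀ e ∈ s, μ (h ⁻¹' {e}) < ⊤) :
    μ (h ⁻¹' (s : Set E)) < ⊤ ∧
      M (h ⁻¹' (s : Set E)) =ᵐ[P] fun ω => ∑ e ∈ s, M (h ⁻¹' {e}) ω := by
  classical
  induction s using Finset.induction_on with
  | empty =>
    refine ⟨by simp, ?_⟩
    filter_upwards [hM.empty hα] with ω hω
    simpa using hω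
  | insert a s ha ih =>
    obtain ⟨h1, h2⟩ := ih fun e he => hs e (Finset.mem_insert_of_mem he)
    have h3 := hs a (Finset.mem_insert_self a s)
    have h4 : h ⁻¹' ((insert a s : Finset E) : Set E) = h ⁻¹' {a} ∪ h ⁻¹' (s : Set E) := by
      rw [Finset.coe_insert, Set.insert_eq, Set.preimage_union]
    rw [h4]
    refine ⟨(measure_union_le _ _).trans_lt (ENNReal.add_lt_top.2 ⟨h3, h1⟩), ?_⟩
    have h5 := hM.union hα (h.measurableSet_preimage {a}) (h.measurableSet_preimage s) h3 h1
      (Disjoint.preimage _ (by simpa using ha))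
    filter_upwards [h2, h5] with ω e1 e2
    rw [e2, e1, Finset.sum_insert ha]

/-- The integral may be computed on any finer partition into level sets; this is what allows two
simple functions to be compared on a common refinement. -/
theorem IsStableRandomMeasure.simpleIntegral_map [IsProbabilityMeasure P] (hα : 0 < α)
    (hM : IsStableRandomMeasure P μ α M) {E : Type*} (h : SimpleFunc S E) (φ : E → ℝ)
    (hφ : ∀ e ∈ h.range, φ e ≠ 0 → μ (h ⁻¹' {e}) < ⊤) :
    simpleIntegral M (h.map φ) =ᵐ[P] fun ω => ∑ e ∈ h.range, φ e * M (h ⁻¹' {e}) ω := by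
  classical
  have key : ∀ c ∈ (h.map φ).range, ∀ᵐ ω ∂P, c * M ((h.map φ) ⁻¹' {c}) ω =
      ∑ e ∈ h.range with φ e = c, φ e * M (h ⁻¹' {e}) ω := by
    intro c _
    by_cases hc : c = 0
    -- The zero level set may have infinite measure, where `M` is unconstrained; the coefficient
    -- zero removes it from both sides.
    · refine ae_of_all _ fun ω => ?_
      rw [hc, zero_mul, Finset.sum_eq_zero]
      intro e he
      rw [(Finset.mem_filter.1 he).2, zero_mul]
    · rw [SimpleFunc.map_preimage_singleton]
      have := (hM.preimage_finset hα h {e ∈ h.range | φ e = c} fun e he =>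
        hφ e (Finset.mem_filter.1 he).1 (by rw [(Finset.mem_filter.1 he).2]; exact hc)).2
      filter_upwards [this] with ω hω
      rw [hω, Finset.mul_sum]
      exact Finset.sum_congr rfl fun e he => by rw [(Finset.mem_filter.1 he).2]
  filter_upwards [(Filter.eventually_all_finset _).2 key] with ω hω
  rw [simpleIntegral, Finset.sum_congr rfl hω, SimpleFunc.range_map]
  exact Finset.sum_fiberwise_of_maps_to (fun e he => Finset.mem_image_of_mem _ he) _

/-- On the level sets of the pair `(f, g)` all three integrals are finite sums over the same cells.
A cell with nonzero value lies in a nonzero level set of `f` or of `g`, hence has finite measure. -/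
theorem IsStableRandomMeasure.simpleIntegral_linear [IsProbabilityMeasure P] (hα : 0 < α)
    (hM : IsStableRandomMeasure P μ α M) {f g : SimpleFunc S ℝ}
    (hf : MemLp f (ENNReal.ofReal α) μ) (hg : MemLp g (ENNReal.ofReal α) μ) (a b : ℝ) :
    simpleIntegral M (a • f + b • g) =ᵐ[P]
      fun ω => a * simpleIntegral M f ω + b * simpleIntegral M g ω := by
  have hp : ENNReal.ofReal α ≠ 0 := by simpa using hα
  have hfin : ∀ e : ℝ × ℝ, e ≠ 0 → μ ((f.pair g) ⁻¹' {e}) < ⊤ := by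
    intro e he
    by_cases h1 : e.1 = 0
    · have h2 : e.2 ≠ 0 := fun h2 => he (Prod.ext h1 h2)
      refine (measure_mono ?_).trans_lt
        (SimpleFunc.measure_preimage_lt_top_of_memLp hp ENNReal.ofReal_ne_top g hg e.2 h2)
      intro s hs
      have hs : (f s, g s) = e := hs
      exact congrArg Prod.snd hs
    · refine (measure_mono ?_).trans_lt
        (SimpleFunc.measure_preimage_lt_top_of_memLp hp ENNReal.ofReal_ne_top f hf e.1 h1)
      intro s hs
      have hs : (f s, g s) = e := hs
      exact congrArg Prod.fst hs
  have h1 := hM.simpleIntegral_map hα (f.pair g) (fun e => a * e.1 + b * e.2) fun e _ he =>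
    hfin e (by rintro rfl; simp at he)
  have h2 := hM.simpleIntegral_map hα (f.pair g) Prod.fst fun e _ he =>
    hfin e (by rintro rfl; simp at he)
  have h3 := hM.simpleIntegral_map hα (f.pair g) Prod.snd fun e _ he =>
    hfin e (by rintro rfl; simp at he)
  have e1 : (f.pair g).map (fun e => a * e.1 + b * e.2) = a • f + b • g := by ext s; simp
  have e2 : (f.pair g).map Prod.fst = f := by ext s; simp
  have e3 : (f.pair g).map Prod.snd = g := by ext s; simp
  rw [e1] at h1; rw [e2] at h2; rw [e3] at h3
  filter_upwards [h1, h2, h3] with ω w1 w2 w3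
  rw [w1, w2, w3, Finset.mul_sum, Finset.mul_sum, ← Finset.sum_add_distrib]
  exact Finset.sum_congr rfl fun e _ => by ring

theorem measurable_simpleIntegral (hα : 0 < α) (hM : IsStableRandomMeasure P μ α M)
    {f : SimpleFunc S ℝ} (hf : MemLp f (ENNReal.ofReal α) μ) :
    Measurable (simpleIntegral M f) := by
  have hp : ENNReal.ofReal α ≠ 0 := by simpa using hα
  refine Finset.measurable_sum _ fun c _ => ?_
  by_cases hc : c = 0
  · simp [hc]
  · exact (hM.measurable _ (f.measurableSet_preimage _)
      (SimpleFunc.measure_preimage_lt_top_of_memLp hp ENNReal.ofReal_ne_top f hf c hc)).const_mul c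

/-- The `L^α` norm, as a real number. -/
noncomputable def lpn (μ : Measure S) (α : ℝ) (f : S → ℝ) : ℝ :=
  (eLpNorm f (ENNReal.ofReal α) μ).toReal

theorem lpn_nonneg (f : S → ℝ) : 0 ≤ lpn μ α f := ENNReal.toReal_nonneg

theorem lpn_rpow (hα : 0 < α) (f : S → ℝ) :
    lpn μ α f ^ α = (∫⁻ s, ‖f s‖ₑ ^ α ∂μ).toReal := by
  rw [lpn, eLpNorm_eq_lintegral_rpow_enorm_toReal (by simpa using hα) ENNReal.ofReal_ne_top,
    ENNReal.toReal_ofReal hα.le, ← ENNReal.toReal_rpow, ← Real.rpow_mul ENNReal.toReal_nonneg,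
    one_div, inv_mul_cancel₀ hα.ne', Real.rpow_one]

theorem lpn_rpow_simpleFunc (hα : 0 < α) {f : SimpleFunc S ℝ}
    (hf : MemLp f (ENNReal.ofReal α) μ) :
    lpn μ α f ^ α = ∑ c ∈ f.range with c ≠ 0, |c| ^ α * (μ (f ⁻¹' {c})).toReal := by
  have hp : ENNReal.ofReal α ≠ 0 := by simpa using hα
  have h1 : ∫⁻ s, ‖f s‖ₑ ^ α ∂μ = ∑ c ∈ f.range with c ≠ 0, ‖c‖ₑ ^ α * μ (f ⁻¹' {c}) := by
    have : ∫⁻ s, ‖f s‖ₑ ^ α ∂μ = ∫⁻ s, f.map (fun c => ‖c‖ₑ ^ α) s ∂μ := rfl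
    rw [this, SimpleFunc.lintegral_eq_lintegral, SimpleFunc.map_lintegral, Finset.sum_filter]
    refine Finset.sum_congr rfl fun c _ => ?_
    split_ifs with hc
    · rfl
    · simp [not_not.1 hc, ENNReal.zero_rpow_of_pos hα]
  rw [lpn_rpow hα, h1, ENNReal.toReal_sum]
  · refine Finset.sum_congr rfl fun c _ => ?_
    rw [ENNReal.toReal_mul, ← ENNReal.toReal_rpow, toReal_enorm, Real.norm_eq_abs]
  · intro c hc
    refine ENNReal.mul_ne_top (ENNReal.rpow_ne_top_of_nonneg hα.le enorm_ne_top) ?_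
    exact (SimpleFunc.measure_preimage_lt_top_of_memLp hp ENNReal.ofReal_ne_top f hf c
      (Finset.mem_filter.1 hc).2).ne

/-- The nonzero level sets are disjoint, so the summands are independent and the characteristic
functions multiply; the exponents add up to `∑ |c|^α μ(f = c)`, the `α`-th power of the norm. -/
theorem IsStableRandomMeasure.hasStableScale_simpleIntegral [IsProbabilityMeasure P] (hα : 0 < α)
    (hM : IsStableRandomMeasure P μ α M) {f : SimpleFunc S ℝ}
    (hf : MemLp f (ENNReal.ofReal α) μ) :
    HasStableScale P α (lpn μ α f) (simpleIntegral M f) := by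
  have hp : ENNReal.ofReal α ≠ 0 := by simpa using hα
  refine ⟨measurable_simpleIntegral hα hM hf, fun θ => ?_⟩
  set s : Finset ℝ := {c ∈ f.range | c ≠ 0} with hs
  have hfin : ∀ c ∈ s, μ (f ⁻¹' {c}) < ⊤ := fun c hc =>
    SimpleFunc.measure_preimage_lt_top_of_memLp hp ENNReal.ofReal_ne_top f hf c
      (Finset.mem_filter.1 hc).2
  have h1 : simpleIntegral M f = fun ω => ∑ c : s, (c : ℝ) * M (f ⁻¹' {(c : ℝ)}) ω := by
    ext ω
    rw [Finset.sum_coe_sort s (fun c => c * M (f ⁻¹' {c}) ω), hs, Finset.sum_filter]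
    refine Finset.sum_congr rfl fun c _ => ?_
    split_ifs with hc
    · rfl
    · simp [not_not.1 hc]
  have hind : iIndepFun (fun c : s => M (f ⁻¹' {(c : ℝ)})) P := by
    -- Independent scattering is stated for families indexed by `Fin n`, so the level sets are
    -- enumerated by `equivFin` and reindexed afterwards.
    have := hM.indep s.card (fun i => f ⁻¹' {((s.equivFin.symm i : s) : ℝ)})
      (fun i => f.measurableSet_preimage _) (fun i => hfin _ (s.equivFin.symm i).2) (by
        intro i j hij
        refine Disjoint.preimage _ ?_
        rw [Set.disjoint_singleton]
        intro h
        exact hij (s.equivFin.symm.injective (Subtype.ext h)))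
    have h2 := this.precomp s.equivFin.injective
    simpa [Function.comp_def] using h2
  have hmeas : ∀ c : s, Measurable (M (f ⁻¹' {(c : ℝ)})) := fun c =>
    hM.measurable _ (f.measurableSet_preimage _) (hfin c c.2)
  have hind' : iIndepFun (fun c : s => fun ω => (c : ℝ) * M (f ⁻¹' {(c : ℝ)}) ω) P :=
    hind.comp (fun c : s => fun x : ℝ => (c : ℝ) * x) (fun c => measurable_const_mul _)
  rw [h1, hind'.charFun_map_fun_sum_eq_prod
    (fun c => ((hmeas c).const_mul _).aemeasurable), Finset.prod_apply]
  have h3 : ∀ c : s, charFun (P.map (fun ω => (c : ℝ) * M (f ⁻¹' {(c : ℝ)}) ω)) θ =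
      ((Real.exp (-(|θ| ^ α * (|(c : ℝ)| ^ α * (μ (f ⁻¹' {(c : ℝ)})).toReal))) : ℝ) : ℂ) := by
    intro c
    have h4 : P.map (fun ω => (c : ℝ) * M (f ⁻¹' {(c : ℝ)}) ω) =
        (P.map (M (f ⁻¹' {(c : ℝ)}))).map (fun x => (c : ℝ) * x) := by
      rw [Measure.map_map (measurable_const_mul _) (hmeas c)]; rfl
    rw [h4, charFun_map_mul, hM.charFun_map (f.measurableSet_preimage _) (hfin c c.2), abs_mul,
      Real.mul_rpow (abs_nonneg _) (abs_nonneg _)]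
    congr 3; ring
  rw [Finset.prod_congr rfl fun c _ => h3 c,
    Finset.prod_coe_sort s (fun c : ℝ => ((Real.exp (-(|θ| ^ α * (|c| ^ α *
      (μ (f ⁻¹' {c})).toReal))) : ℝ) : ℂ)), ← Complex.ofReal_prod, ← Real.exp_sum,
    Finset.sum_neg_distrib, ← Finset.mul_sum, ← lpn_rpow_simpleFunc hα hf,
    Real.mul_rpow (abs_nonneg _) (lpn_nonneg _)]

end SimpleIntegral

/-! ### The stochastic integral: existence, uniqueness and linearity -/

section StableIntegrals

variable {Ω : Type*} [MeasurableSpace Ω] {S : Type*} [MeasurableSpace S]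
  {P : Measure Ω} {μ : Measure S} {α : ℝ} {M : Set S → Ω → ℝ}

/-- Convergence in measure is equivalent to a.s. convergence along a further subsequence of every
subsequence, and a.s. limits are linear. -/
theorem tendstoInMeasure_linear [IsFiniteMeasure P] {X Y : ℕ → Ω → ℝ} {X' Y' : Ω → ℝ}
    (hX : TendstoInMeasure P X atTop X') (hY : TendstoInMeasure P Y atTop Y')
    (hmX : ∀ n, AEMeasurable (X n) P) (hmY : ∀ n, AEMeasurable (Y n) P) (a b : ℝ) :
    TendstoInMeasure P (fun n ω => a * X n ω + b * Y n ω) atTop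
      (fun ω => a * X' ω + b * Y' ω) := by
  refine (exists_seq_tendstoInMeasure_atTop_iff (f := fun n ω => a * X n ω + b * Y n ω)
    (fun n => (((hmX n).const_mul a).add ((hmY n).const_mul b)).aestronglyMeasurable)).2 ?_
  intro ns hns
  obtain ⟨ns', hns', h1⟩ := (hX.comp hns.tendsto_atTop).exists_seq_tendsto_ae
  obtain ⟨ns'', hns'', h2⟩ :=
    (hY.comp (hns.comp hns').tendsto_atTop).exists_seq_tendsto_ae
  refine ⟨ns' ∘ ns'', hns'.comp hns'', ?_⟩
  filter_upwards [h1, h2] with ω w1 w2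
  exact ((w1.comp hns''.tendsto_atTop).const_mul a).add (w2.const_mul b)

theorem lpn_sub_le (hα : 1 ≤ α) {f g : S → ℝ} (hf : MemLp f (ENNReal.ofReal α) μ)
    (hg : MemLp g (ENNReal.ofReal α) μ) : |lpn μ α f - lpn μ α g| ≤ lpn μ α (fun s => f s - g s) := by
  have h1 : (1 : ENNReal) ≤ ENNReal.ofReal α := by simpa using hα
  have key : ∀ f g : S → ℝ, MemLp f (ENNReal.ofReal α) μ → MemLp g (ENNReal.ofReal α) μ →
      lpn μ α f ≤ lpn μ α (fun s => f s - g s) + lpn μ α g := by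
    intro f g hf hg
    unfold lpn
    change _ ≤ (eLpNorm (f - g) (ENNReal.ofReal α) μ).toReal + _
    rw [← ENNReal.toReal_add (hf.sub hg).2.ne hg.2.ne]
    refine ENNReal.toReal_mono (ENNReal.add_ne_top.2 ⟨(hf.sub hg).2.ne, hg.2.ne⟩) ?_
    have := eLpNorm_add_le (hf.sub hg).1 hg.1 h1
    simpa using this
  have h2 := key f g hf hg
  have h3 := key g f hg hf
  have h4 : lpn μ α (fun s => g s - f s) = lpn μ α (fun s => f s - g s) := by
    unfold lpn
    rw [← eLpNorm_neg]
    congr 2; ext s; simp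
  rw [abs_le]
  constructor <;> linarith

theorem exists_simpleFunc_seq {f : S → ℝ} (hf : MemLp f (ENNReal.ofReal α) μ)
    {ε : ℕ → ℝ} (hε : ∀ n, 0 < ε n) :
    ∃ g : ℕ → SimpleFunc S ℝ, (∀ n, MemLp (g n) (ENNReal.ofReal α) μ) ∧
      ∀ n, eLpNorm (fun s => g n s - f s) (ENNReal.ofReal α) μ < ENNReal.ofReal (ε n) := by
  choose g h1 h2 using fun n => hf.exists_simpleFunc_eLpNorm_sub_lt ENNReal.ofReal_ne_top
    (ε := ENNReal.ofReal (ε n)) (by simpa using hε n)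
  refine ⟨g, h2, fun n => ?_⟩
  rw [← eLpNorm_neg]
  convert h1 n using 2
  ext s; simp

theorem exists_simpleFunc_tendsto {f : S → ℝ} (hf : MemLp f (ENNReal.ofReal α) μ) :
    ∃ g : ℕ → SimpleFunc S ℝ, (∀ n, MemLp (g n) (ENNReal.ofReal α) μ) ∧
      Tendsto (fun n => eLpNorm (fun s => g n s - f s) (ENNReal.ofReal α) μ) atTop (𝓝 0) := by
  obtain ⟨g, h1, h2⟩ := exists_simpleFunc_seq hf (ε := fun n => 1 / ((n : ℝ) + 1))
    (fun n => by positivity)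
  refine ⟨g, h1, tendsto_of_tendsto_of_tendsto_of_le_of_le tendsto_const_nhds ?_
    (fun _ => zero_le) fun n => (h2 n).le⟩
  have := ENNReal.tendsto_ofReal (tendsto_one_div_add_atTop_nhds_zero_nat (𝕜 := ℝ))
  simpa using this

theorem tendsto_lpn_sub (hα : 1 ≤ α) {f : S → ℝ} {g h : ℕ → SimpleFunc S ℝ}
    (hf : MemLp f (ENNReal.ofReal α) μ)
    (hg : ∀ n, MemLp (g n) (ENNReal.ofReal α) μ) (hh : ∀ n, MemLp (h n) (ENNReal.ofReal α) μ)
    (hgf : Tendsto (fun n => eLpNorm (fun s => g n s - f s) (ENNReal.ofReal α) μ) atTop (𝓝 0))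
    (hhf : Tendsto (fun n => eLpNorm (fun s => h n s - f s) (ENNReal.ofReal α) μ) atTop (𝓝 0)) :
    Tendsto (fun n => lpn μ α (fun s => g n s - h n s)) atTop (𝓝 0) := by
  have h1 : (1 : ENNReal) ≤ ENNReal.ofReal α := by simpa using hα
  have hle : ∀ n, eLpNorm (fun s => g n s - h n s) (ENNReal.ofReal α) μ ≤
      eLpNorm (fun s => g n s - f s) (ENNReal.ofReal α) μ +
      eLpNorm (fun s => h n s - f s) (ENNReal.ofReal α) μ := by
    intro n
    have := eLpNorm_sub_le ((hg n).sub hf).1 ((hh n).sub hf).1 h1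
    refine le_trans (le_of_eq ?_) this
    congr 1; ext s; simp
  have h2 : Tendsto (fun n => eLpNorm (fun s => g n s - h n s) (ENNReal.ofReal α) μ) atTop (𝓝 0) :=
    tendsto_of_tendsto_of_tendsto_of_le_of_le tendsto_const_nhds
      (by simpa using hgf.add hhf) (fun _ => zero_le) hle
  have := (ENNReal.tendsto_toReal (ENNReal.zero_ne_top)).comp h2
  simpa [Function.comp_def, lpn] using this

/-- One approximating sequence suffices: for another one, the difference of the simple integrals has
scale tending to zero, hence tends to zero in probability. -/
theorem IsStableIntegral.of_seq [IsProbabilityMeasure P] (hα : 1 ≤ α)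
    (hM : IsStableRandomMeasure P μ α M) {f : S → ℝ} {X : Ω → ℝ} (hX : Measurable X)
    (hf : MemLp f (ENNReal.ofReal α) μ) {g : ℕ → SimpleFunc S ℝ}
    (hg : ∀ n, MemLp (g n) (ENNReal.ofReal α) μ)
    (hgf : Tendsto (fun n => eLpNorm (fun s => g n s - f s) (ENNReal.ofReal α) μ) atTop (𝓝 0))
    (hgX : TendstoInMeasure P (fun n => simpleIntegral M (g n)) atTop X) :
    IsStableIntegral P μ α M f X := by
  have hα0 : 0 < α := by linarith
  refine ⟨hX, hf, fun h hh hhf => ?_⟩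
  have h1 : ∀ n, MemLp ((1 : ℝ) • h n + (-1 : ℝ) • g n : SimpleFunc S ℝ) (ENNReal.ofReal α) μ := by
    intro n
    convert (hh n).sub (hg n) using 1
    ext s; simp [sub_eq_add_neg]
  have h2 : TendstoInMeasure P
      (fun n => simpleIntegral M ((1 : ℝ) • h n + (-1 : ℝ) • g n)) atTop 0 := by
    refine HasStableScale.tendstoInMeasure_zero hα0
      (fun n => hM.hasStableScale_simpleIntegral hα0 (h1 n)) (fun n => lpn_nonneg _) ?_
    convert tendsto_lpn_sub hα hf hh hg hhf hgf using 3 with n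
    ext s; simp [sub_eq_add_neg]
  have h3 := tendstoInMeasure_linear h2 hgX
    (fun n => (measurable_simpleIntegral hα0 hM (h1 n)).aemeasurable)
    (fun n => (measurable_simpleIntegral hα0 hM (hg n)).aemeasurable) 1 1
  refine h3.congr (fun n => ?_) (ae_of_all _ fun ω => by simp)
  filter_upwards [hM.simpleIntegral_linear hα0 (hh n) (hg n) 1 (-1)] with ω hω
  rw [hω]; ring

/-- Approximate `f` at rate `4^(-n)`. Successive differences of the integrals then exceed `2^(-n)`
with summable probabilities, so by Borel–Cantelli the integrals converge a.s. -/
theorem IsStableIntegral.exists [IsProbabilityMeasure P] (hα : 1 ≤ α)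
    (hM : IsStableRandomMeasure P μ α M) {f : S → ℝ} (hf : MemLp f (ENNReal.ofReal α) μ) :
    ∃ X, IsStableIntegral P μ α M f X := by
  have hα0 : 0 < α := by linarith
  have h1 : (1 : ENNReal) ≤ ENNReal.ofReal α := by simpa using hα
  obtain ⟨g, hg, hgf⟩ := exists_simpleFunc_seq hf (ε := fun n => (1 / 4 : ℝ) ^ n)
    (fun n => by positivity)
  have hgf0 : Tendsto (fun n => eLpNorm (fun s => g n s - f s) (ENNReal.ofReal α) μ)
      atTop (𝓝 0) := by
    refine tendsto_of_tendsto_of_tendsto_of_le_of_le tendsto_const_nhds ?_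
      (fun _ => zero_le) fun n => (hgf n).le
    have := ENNReal.tendsto_ofReal (tendsto_pow_atTop_nhds_zero_of_lt_one
      (r := (1 / 4 : ℝ)) (by norm_num) (by norm_num))
    simpa using this
  have hm := fun n => measurable_simpleIntegral hα0 hM (hg n)
  have h2 : ∀ n, MemLp ((1 : ℝ) • g (n + 1) + (-1 : ℝ) • g n : SimpleFunc S ℝ)
      (ENNReal.ofReal α) μ := by
    intro n
    convert (hg (n + 1)).sub (hg n) using 1
    ext s; simp [sub_eq_add_neg]
  have h3 : ∀ n, lpn μ α ((1 : ℝ) • g (n + 1) + (-1 : ℝ) • g n : SimpleFunc S ℝ) ≤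
      2 * (1 / 4 : ℝ) ^ n := by
    intro n
    have := eLpNorm_sub_le ((hg (n + 1)).sub hf).1 ((hg n).sub hf).1 h1
    have e : ((g (n + 1) - f) - (g n - f) : S → ℝ) =
        ((1 : ℝ) • g (n + 1) + (-1 : ℝ) • g n : SimpleFunc S ℝ) := by
      ext s; simp [sub_eq_add_neg]
    rw [e] at this
    refine ENNReal.toReal_le_of_le_ofReal (by positivity) (this.trans ?_)
    rw [two_mul, ENNReal.ofReal_add (by positivity) (by positivity)]
    refine add_le_add ((hgf (n + 1)).le.trans (ENNReal.ofReal_le_ofReal ?_)) (hgf n).le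
    exact pow_le_pow_of_le_one (by norm_num) (by norm_num) (by omega)
  -- The tail bound with `r = 2^(-n)` and scale at most `2 · 4^(-n)` gives `2 (2 · 2^n · 2 ·
  -- 4^(-n))^α = 2 · 4^α · (2^(-α))^n`.
  have h4 : ∀ n, P {ω | (1 / 2 : ℝ) ^ n <
      |simpleIntegral M (g (n + 1)) ω - simpleIntegral M (g n) ω|} ≤
      ENNReal.ofReal (2 * 4 ^ α * ((1 / 2 : ℝ) ^ α) ^ n) := by
    intro n
    have e1 := (hM.hasStableScale_simpleIntegral hα0 (h2 n)).tail_le hα0 (lpn_nonneg _)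
      (r := (1 / 2 : ℝ) ^ n) (by positivity)
    have e2 : P {ω | (1 / 2 : ℝ) ^ n <
        |simpleIntegral M (g (n + 1)) ω - simpleIntegral M (g n) ω|} =
        P {ω | (1 / 2 : ℝ) ^ n < |simpleIntegral M ((1 : ℝ) • g (n + 1) + (-1 : ℝ) • g n) ω|} := by
      refine measure_congr ?_
      filter_upwards [hM.simpleIntegral_linear hα0 (hg (n + 1)) (hg n) 1 (-1)] with ω hω
      refine propext ?_
      change (_ < |_|) ↔ (_ < |_|)
      rw [hω]
      ring_nf
    rw [e2, ← ENNReal.ofReal_toReal (measure_ne_top P _)]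
    refine ENNReal.ofReal_le_ofReal (e1.trans ?_)
    rw [mul_assoc 2 ((4 : ℝ) ^ α)]
    refine mul_le_mul_of_nonneg_left ?_ zero_le_two
    rw [Real.rpow_pow_comm (by norm_num : (0 : ℝ) ≤ 1 / 2) α n,
      ← Real.mul_rpow (by norm_num : (0 : ℝ) ≤ 4) (by positivity)]
    refine Real.rpow_le_rpow (mul_nonneg (by positivity) (lpn_nonneg _)) ?_ hα0.le
    calc _ ≤ 2 * ((1 / 2 : ℝ) ^ n)⁻¹ * (2 * (1 / 4 : ℝ) ^ n) := by
          refine mul_le_mul_of_nonneg_left (h3 n) (by positivity)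
      _ = 4 * (1 / 2 : ℝ) ^ n := by
          rw [show (1 / 4 : ℝ) = 1 / 2 * (1 / 2) by norm_num, mul_pow]
          field_simp; norm_num
  have h5 : ∀ᵐ ω ∂P, ∀ᶠ n in atTop,
      |simpleIntegral M (g (n + 1)) ω - simpleIntegral M (g n) ω| ≤ (1 / 2 : ℝ) ^ n := by
    have hr : (1 / 2 : ℝ) ^ α < 1 := Real.rpow_lt_one (by norm_num) (by norm_num) hα0
    have hs : Summable fun n : ℕ => 2 * 4 ^ α * ((1 / 2 : ℝ) ^ α) ^ n :=
      (summable_geometric_of_lt_one (by positivity) hr).mul_left _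
    have := ae_eventually_notMem (μ := P) (s := fun n => {ω | (1 / 2 : ℝ) ^ n <
      |simpleIntegral M (g (n + 1)) ω - simpleIntegral M (g n) ω|})
      (ne_top_of_le_ne_top hs.tsum_ofReal_ne_top (ENNReal.tsum_le_tsum h4))
    filter_upwards [this] with ω hω
    filter_upwards [hω] with n hn
    exact not_lt.1 hn
  have h6 : ∀ᵐ ω ∂P, ∃ l, Tendsto (fun n => simpleIntegral M (g n) ω) atTop (𝓝 l) := by
    filter_upwards [h5] with ω hω
    obtain ⟨N, hN⟩ := eventually_atTop.1 hω
    have : CauchySeq fun n => simpleIntegral M (g (n + N)) ω := by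
      refine cauchySeq_of_le_geometric (1 / 2) 1 (by norm_num) fun n => ?_
      rw [Real.dist_eq, abs_sub_comm, one_mul]
      refine (le_of_eq ?_).trans ((hN (n + N) (by omega)).trans
        (pow_le_pow_of_le_one (by norm_num) (by norm_num) (by omega)))
      congr 3; ring_nf
    obtain ⟨l, hl⟩ := cauchySeq_tendsto_of_complete this
    exact ⟨l, (tendsto_add_atTop_iff_nat (f := fun n => simpleIntegral M (g n) ω) N).1 hl⟩
  obtain ⟨X, hX, hlim⟩ := measurable_limit_of_tendsto_metrizable_ae (fun n => (hm n).aemeasurable) h6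
  exact ⟨X, .of_seq hα hM hX hf hg hgf0
    (tendstoInMeasure_of_tendsto_ae (fun n => (hm n).aestronglyMeasurable) hlim)⟩

theorem IsStableIntegral.ae_unique [IsProbabilityMeasure P] {f : S → ℝ} {X Y : Ω → ℝ}
    (hX : IsStableIntegral P μ α M f X) (hY : IsStableIntegral P μ α M f Y) : X =ᵐ[P] Y := by
  obtain ⟨g, hg, hgf⟩ := exists_simpleFunc_tendsto hX.2.1
  exact tendstoInMeasure_ae_unique (hX.2.2 g hg hgf) (hY.2.2 g hg hgf)

theorem IsStableIntegral.hasStableScale [IsProbabilityMeasure P] (hα : 1 ≤ α)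
    (hM : IsStableRandomMeasure P μ α M) {f : S → ℝ} {X : Ω → ℝ}
    (hX : IsStableIntegral P μ α M f X) : HasStableScale P α (lpn μ α f) X := by
  have hα0 : 0 < α := by linarith
  obtain ⟨g, hg, hgf⟩ := exists_simpleFunc_tendsto hX.2.1
  refine HasStableScale.tendsto hα0 (fun n => hM.hasStableScale_simpleIntegral hα0 (hg n)) ?_ hX.1
    (hX.2.2 g hg hgf)
  rw [tendsto_iff_dist_tendsto_zero]
  have h0 : Tendsto (fun n => lpn μ α (fun s => g n s - f s)) atTop (𝓝 0) := by
    have := (ENNReal.tendsto_toReal (ENNReal.zero_ne_top)).comp hgf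
    simpa [Function.comp_def, lpn] using this
  exact squeeze_zero (fun _ => dist_nonneg) (fun n => lpn_sub_le hα (hg n) hX.2.1) h0

theorem IsStableIntegral.congr {f g : S → ℝ} {X Y : Ω → ℝ} (hX : IsStableIntegral P μ α M f X)
    (hfg : f =ᵐ[μ] g) (hY : Measurable Y) (hXY : X =ᵐ[P] Y) : IsStableIntegral P μ α M g Y := by
  refine ⟨hY, hX.2.1.ae_eq hfg, fun h hh hhf => ?_⟩
  refine (hX.2.2 h hh ?_).congr_right hXY
  refine hhf.congr fun n => eLpNorm_congr_ae ?_
  filter_upwards [hfg] with s hs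
  rw [hs]

theorem IsStableIntegral.linear [IsProbabilityMeasure P] (hα : 1 ≤ α)
    (hM : IsStableRandomMeasure P μ α M) {f g : S → ℝ} {X Y : Ω → ℝ}
    (hX : IsStableIntegral P μ α M f X) (hY : IsStableIntegral P μ α M g Y) (a b : ℝ) :
    IsStableIntegral P μ α M (fun s => a * f s + b * g s) (fun ω => a * X ω + b * Y ω) := by
  have hα0 : 0 < α := by linarith
  have h1 : (1 : ENNReal) ≤ ENNReal.ofReal α := by simpa using hα
  obtain ⟨f', hf', hff⟩ := exists_simpleFunc_tendsto hX.2.1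
  obtain ⟨g', hg', hgg⟩ := exists_simpleFunc_tendsto hY.2.1
  have hmem : ∀ n, MemLp (a • f' n + b • g' n : SimpleFunc S ℝ) (ENNReal.ofReal α) μ := fun n =>
    ((hf' n).const_smul a).add ((hg' n).const_smul b)
  refine .of_seq hα hM ((hX.1.const_mul a).add (hY.1.const_mul b))
    ((hX.2.1.const_mul a).add (hY.2.1.const_mul b)) hmem ?_ ?_
  · have hle : ∀ n, eLpNorm (fun s => (a • f' n + b • g' n : SimpleFunc S ℝ) s -
        (a * f s + b * g s)) (ENNReal.ofReal α) μ ≤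
        ‖a‖ₑ * eLpNorm (fun s => f' n s - f s) (ENNReal.ofReal α) μ +
        ‖b‖ₑ * eLpNorm (fun s => g' n s - g s) (ENNReal.ofReal α) μ := by
      intro n
      have e1 := ((hf' n).sub hX.2.1).const_smul a
      have e2 := ((hg' n).sub hY.2.1).const_smul b
      have := eLpNorm_add_le e1.1 e2.1 h1
      rw [eLpNorm_const_smul, eLpNorm_const_smul] at this
      refine le_trans (le_of_eq ?_) this
      congr 1; ext s
      simp
      ring
    refine tendsto_of_tendsto_of_tendsto_of_le_of_le tendsto_const_nhds ?_ (fun _ => zero_le) hle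
    have e1 := ENNReal.Tendsto.const_mul hff (a := ‖a‖ₑ) (Or.inr enorm_ne_top)
    have e2 := ENNReal.Tendsto.const_mul hgg (a := ‖b‖ₑ) (Or.inr enorm_ne_top)
    simpa using e1.add e2
  · refine (tendstoInMeasure_linear (hX.2.2 f' hf' hff) (hY.2.2 g' hg' hgg)
      (fun n => (measurable_simpleIntegral hα0 hM (hf' n)).aemeasurable)
      (fun n => (measurable_simpleIntegral hα0 hM (hg' n)).aemeasurable) a b).congr_left fun n => ?_
    exact (hM.simpleIntegral_linear hα0 (hf' n) (hg' n) a b).symm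

theorem IsStableIntegral.sum [IsProbabilityMeasure P] (hα : 1 ≤ α)
    (hM : IsStableRandomMeasure P μ α M) {ι : Type*} (s : Finset ι) {f : ι → S → ℝ}
    {X : ι → Ω → ℝ} (hX : ∀ i, IsStableIntegral P μ α M (f i) (X i)) (a : ι → ℝ) :
    IsStableIntegral P μ α M (fun p => ∑ i ∈ s, a i * f i p) (fun ω => ∑ i ∈ s, a i * X i ω) := by
  classical
  induction s using Finset.induction_on with
  | empty =>
    simp only [Finset.sum_empty]
    have hz : simpleIntegral M (0 : SimpleFunc S ℝ) = fun _ : Ω => (0 : ℝ) := by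
      ext ω
      refine Finset.sum_eq_zero fun c hc => ?_
      obtain ⟨s, rfl⟩ := SimpleFunc.mem_range.1 hc
      simp
    refine .of_seq (g := fun _ => 0) hα hM measurable_const MemLp.zero' (fun _ => MemLp.zero) ?_ ?_
    · simp
    · simp only [hz]
      intro ε hε
      simp [hε.ne']
  | insert i s hi ih =>
    simp only [Finset.sum_insert hi]
    simpa using IsStableIntegral.linear hα hM (hX i) ih (a i) 1

end StableIntegrals

/-! ### Joint laws, independence and equality of stable integrals -/

section Laws

variable {Ω : Type*} [MeasurableSpace Ω] {S : Type*} [MeasurableSpace S]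
  {P : Measure Ω} {μ : Measure S} {α : ℝ} {M : Set S → Ω → ℝ}

theorem lpn_const_mul (c : ℝ) (f : S → ℝ) : lpn μ α (fun s => c * f s) = |c| * lpn μ α f := by
  have : (fun s => c * f s) = c • f := rfl
  rw [lpn, lpn, this, eLpNorm_const_smul, ENNReal.toReal_mul, toReal_enorm, Real.norm_eq_abs]

theorem lintegral_rpow_ne_top (hα : 0 < α) {f : S → ℝ} (hf : MemLp f (ENNReal.ofReal α) μ) :
    ∫⁻ s, ‖f s‖ₑ ^ α ∂μ ≠ ⊤ := by
  have := lintegral_rpow_enorm_lt_top_of_eLpNorm_lt_top (by simpa using hα)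
    ENNReal.ofReal_ne_top hf.2
  rw [ENNReal.toReal_ofReal hα.le] at this
  exact this.ne

/-- A linear functional of the vector is the integral of the same combination of the kernels, by
linearity; its scale is the norm of that combination. -/
theorem IsStableIntegral.charFunDual_map [IsProbabilityMeasure P] (hα : 1 ≤ α)
    (hM : IsStableRandomMeasure P μ α M) {n : ℕ} {f : Fin n → S → ℝ} {X : Fin n → Ω → ℝ}
    (hX : ∀ i, IsStableIntegral P μ α M (f i) (X i)) (L : StrongDual ℝ (Fin n → ℝ)) :
    charFunDual (P.map (fun ω i => X i ω)) L =
      ((Real.exp (-(lpn μ α fun s => ∑ i, L (Pi.single i 1) * f i s) ^ α) : ℝ) : ℂ) := by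
  have hm : Measurable fun ω i => X i ω := measurable_pi_lambda _ fun i => (hX i).1
  rw [charFunDual_eq_charFun_map_one, Measure.map_map (by fun_prop) hm]
  have h1 : (L ∘ fun ω i => X i ω) = fun ω => ∑ i, L (Pi.single i 1) * X i ω := by
    ext ω
    have : (fun i => X i ω) = ∑ i, X i ω • (Pi.single i (1 : ℝ) : Fin n → ℝ) := by
      ext j
      simp [Finset.sum_apply, Pi.single_apply]
    rw [Function.comp_apply, this, map_sum]
    exact Finset.sum_congr rfl fun i _ => by rw [map_smul, smul_eq_mul, mul_comm]
  rw [h1, ((IsStableIntegral.sum hα hM Finset.univ hX _).hasStableScale hα hM).charFun_eq]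
  simp

theorem IsStableIntegral.identDistrib [IsProbabilityMeasure P] (hα : 1 ≤ α)
    (hM : IsStableRandomMeasure P μ α M) {n : ℕ} {f g : Fin n → S → ℝ} {X Y : Fin n → Ω → ℝ}
    (hX : ∀ i, IsStableIntegral P μ α M (f i) (X i))
    (hY : ∀ i, IsStableIntegral P μ α M (g i) (Y i))
    (h : ∀ a : Fin n → ℝ, lpn μ α (fun s => ∑ i, a i * f i s) =
      lpn μ α (fun s => ∑ i, a i * g i s)) :
    IdentDistrib (fun ω i => X i ω) (fun ω i => Y i ω) P P := by
  have hm : Measurable fun ω i => X i ω := measurable_pi_lambda _ fun i => (hX i).1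
  have hm' : Measurable fun ω i => Y i ω := measurable_pi_lambda _ fun i => (hY i).1
  refine ⟨hm.aemeasurable, hm'.aemeasurable, ?_⟩
  have := Measure.isProbabilityMeasure_map (μ := P) hm.aemeasurable
  have := Measure.isProbabilityMeasure_map (μ := P) hm'.aemeasurable
  apply Measure.ext_of_charFunDual
  ext L
  rw [IsStableIntegral.charFunDual_map hα hM hX, IsStableIntegral.charFunDual_map hα hM hY, h]

theorem IsStableIntegral.isStableLaw [IsProbabilityMeasure P] (hα : 1 ≤ α)
    (hM : IsStableRandomMeasure P μ α M) {n : ℕ} {f : Fin n → S → ℝ} {X : Fin n → Ω → ℝ}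
    (hX : ∀ i, IsStableIntegral P μ α M (f i) (X i)) :
    IsStableLaw α (P.map (fun ω i => X i ω)) := by
  have hα0 : 0 < α := by linarith
  have hm : Measurable fun ω i => X i ω := measurable_pi_lambda _ fun i => (hX i).1
  have := Measure.isProbabilityMeasure_map (μ := P) hm.aemeasurable
  intro A B hA hB
  -- By symmetry no shift is needed. Dilation by `c` multiplies the exponent by `c^α`, and
  -- convolution adds `A^α` and `B^α`.
  refine ⟨0, ?_⟩
  simp only [add_zero]
  have key : ∀ c : ℝ, 0 ≤ c → ∀ L : StrongDual ℝ (Fin n → ℝ),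
      charFunDual ((P.map (fun ω i => X i ω)).map (fun w => c • w)) L =
      ((Real.exp (-(c ^ α * (lpn μ α fun s => ∑ i, L (Pi.single i 1) * f i s) ^ α)) : ℝ) : ℂ) := by
    intro c hc L
    have h1 : (P.map (fun ω i => X i ω)).map (fun w => c • w) =
        (P.map (fun ω i => X i ω)).map (c • ContinuousLinearMap.id ℝ (Fin n → ℝ)) := rfl
    rw [h1, MeasureTheory.charFunDual_map, IsStableIntegral.charFunDual_map hα hM hX]
    have h2 : (fun s => ∑ i, (L.comp (c • ContinuousLinearMap.id ℝ (Fin n → ℝ)))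
        (Pi.single i 1) * f i s) = fun s => c * ∑ i, L (Pi.single i 1) * f i s := by
      ext s
      rw [Finset.mul_sum]
      exact Finset.sum_congr rfl fun i _ => by simp [mul_assoc]
    rw [h2, lpn_const_mul, Real.mul_rpow (abs_nonneg _) (lpn_nonneg _), abs_of_nonneg hc]
  have hp : ∀ c : ℝ, IsProbabilityMeasure ((P.map (fun ω i => X i ω)).map (fun w => c • w)) :=
    fun c => Measure.isProbabilityMeasure_map (by fun_prop)
  have := hp A
  have := hp B
  have := hp ((A ^ α + B ^ α) ^ (1 / α))
  apply Measure.ext_of_charFunDual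
  ext L
  rw [charFunDual_conv, key A hA.le, key B hB.le, key _ (by positivity), ← Complex.ofReal_mul,
    ← Real.exp_add, ← Real.rpow_mul (by positivity), one_div, inv_mul_cancel₀ hα0.ne',
    Real.rpow_one]
  congr 2; ring

theorem IsStableIntegral.charFun_map_linear [IsProbabilityMeasure P] (hα : 1 ≤ α)
    (hM : IsStableRandomMeasure P μ α M) {f g : S → ℝ} {X Y : Ω → ℝ}
    (hX : IsStableIntegral P μ α M f X) (hY : IsStableIntegral P μ α M g Y) (a b : ℝ) :
    charFun (P.map (fun ω => a * X ω + b * Y ω)) 1 =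
      ((Real.exp (-(lpn μ α fun s => a * f s + b * g s) ^ α) : ℝ) : ℂ) := by
  rw [((hX.linear hα hM hY a b).hasStableScale hα hM).charFun_eq]
  simp

/-- With disjoint supports `|a f + b g|^α = |a f|^α + |b g|^α` pointwise a.e., so the joint
characteristic function factorises. -/
theorem IsStableIntegral.indepFun [IsProbabilityMeasure P] (hα : 1 ≤ α)
    (hM : IsStableRandomMeasure P μ α M) {f g : S → ℝ} {X Y : Ω → ℝ}
    (hX : IsStableIntegral P μ α M f X) (hY : IsStableIntegral P μ α M g Y)
    (h : ∀ᵐ s ∂μ, f s = 0 ∨ g s = 0) : IndepFun X Y P := by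
  have hα0 : 0 < α := by linarith
  rw [indepFun_iff_charFunDual_prod hX.1.aemeasurable hY.1.aemeasurable]
  intro L
  have e0 : ∀ x y : ℝ, L (x, y) = L (1, 0) * x + L (0, 1) * y := by
    intro x y
    have : ((x, y) : ℝ × ℝ) = x • ((1, 0) : ℝ × ℝ) + y • ((0, 1) : ℝ × ℝ) := by simp
    rw [this, map_add, map_smul, map_smul, smul_eq_mul, smul_eq_mul]; ring
  have hmX := hX.1
  have hmY := hY.1
  have e1 : charFunDual (P.map (fun ω => (X ω, Y ω))) L =
      charFun (P.map (fun ω => L (1, 0) * X ω + L (0, 1) * Y ω)) 1 := by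
    rw [charFunDual_eq_charFun_map_one, Measure.map_map (by fun_prop) (by fun_prop)]
    congr 2; ext ω; exact e0 _ _
  -- The marginals are written with a zero coefficient so that one formula covers the joint law and
  -- both marginals.
  have e2 : charFunDual (P.map X) (L.comp (.inl ℝ ℝ ℝ)) =
      charFun (P.map (fun ω => L (1, 0) * X ω + 0 * Y ω)) 1 := by
    rw [charFunDual_eq_charFun_map_one, Measure.map_map (by fun_prop) (by fun_prop)]
    congr 2; ext ω; simp [e0 (X ω) 0]
  have e3 : charFunDual (P.map Y) (L.comp (.inr ℝ ℝ ℝ)) =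
      charFun (P.map (fun ω => 0 * X ω + L (0, 1) * Y ω)) 1 := by
    rw [charFunDual_eq_charFun_map_one, Measure.map_map (by fun_prop) (by fun_prop)]
    congr 2; ext ω; simp [e0 0 (Y ω)]
  rw [e1, e2, e3, hX.charFun_map_linear hα hM hY, hX.charFun_map_linear hα hM hY,
    hX.charFun_map_linear hα hM hY, ← Complex.ofReal_mul, ← Real.exp_add]
  set a := L (1, 0)
  set b := L (0, 1)
  have m : ∀ a b : ℝ, MemLp (fun s => a * f s + b * g s) (ENNReal.ofReal α) μ := fun a b =>
    (hX.linear hα hM hY a b).2.1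
  rw [← neg_add, lpn_rpow hα0, lpn_rpow hα0, lpn_rpow hα0, ← ENNReal.toReal_add
    (lintegral_rpow_ne_top hα0 (m a 0)) (lintegral_rpow_ne_top hα0 (m 0 b)), ← lintegral_add_left']
  · congr 4
    refine lintegral_congr_ae ?_
    filter_upwards [h] with s hs
    rcases hs with hs | hs <;> simp [hs, ENNReal.zero_rpow_of_pos hα0]
  · exact (m a 0).1.enorm.pow_const _

/-- Write `x^p = x · x^(p-1)` and use that `x^(p-1)` is strictly increasing. The strictness is what
detects overlapping supports. -/
theorem add_rpow_lt_rpow_add {p a b : ℝ} (hp : 1 < p) (ha : 0 < a) (hb : 0 < b) :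
    a ^ p + b ^ p < (a + b) ^ p := by
  have h1 : ∀ x : ℝ, 0 < x → x ^ p = x * x ^ (p - 1) := fun x hx => by
    rw [Real.rpow_sub_one hx.ne']; field_simp
  rw [h1 a ha, h1 b hb, h1 (a + b) (by positivity), add_mul]
  have h2 : a ^ (p - 1) < (a + b) ^ (p - 1) := Real.rpow_lt_rpow ha.le (by linarith) (by linarith)
  have h3 : b ^ (p - 1) < (a + b) ^ (p - 1) := Real.rpow_lt_rpow hb.le (by linarith) (by linarith)
  gcongr

/-- Independent integrals of nonnegative functions have disjoint supports. -/
theorem IsStableIntegral.disjoint_of_indepFun [IsProbabilityMeasure P] (hα : 1 < α)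
    (hM : IsStableRandomMeasure P μ α M) {f g : S → ℝ} {X Y : Ω → ℝ}
    (hX : IsStableIntegral P μ α M f X) (hY : IsStableIntegral P μ α M g Y)
    (hf : ∀ s, 0 ≤ f s) (hg : ∀ s, 0 ≤ g s) (hXY : IndepFun X Y P) :
    ∀ᵐ s ∂μ, f s = 0 ∨ g s = 0 := by
  have hα0 : 0 < α := by linarith
  have hfg := hX.linear hα.le hM hY 1 1
  simp only [one_mul] at hfg
  -- Independence at frequency one says that `‖f + g‖^α = ‖f‖^α + ‖g‖^α`.
  have h2 := congrFun (hXY.charFun_map_fun_add_eq_mul hX.1.aemeasurable hY.1.aemeasurable) 1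
  rw [Pi.mul_apply, (hfg.hasStableScale hα.le hM).charFun_eq, (hX.hasStableScale hα.le hM).charFun_eq,
    (hY.hasStableScale hα.le hM).charFun_eq, ← Complex.ofReal_mul, Complex.ofReal_inj,
    ← Real.exp_add, Real.exp_eq_exp] at h2
  simp only [abs_one, one_mul] at h2
  have nf := lintegral_rpow_ne_top hα0 hX.2.1
  have ng := lintegral_rpow_ne_top hα0 hY.2.1
  rw [← neg_add, neg_inj, lpn_rpow hα0, lpn_rpow hα0, lpn_rpow hα0, ← ENNReal.toReal_add nf ng,
    ENNReal.toReal_eq_toReal_iff' (lintegral_rpow_ne_top hα0 hfg.2.1) (by simp [nf, ng]),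
    ← lintegral_add_left' (hX.2.1.1.enorm.pow_const _)] at h2
  have hreal : ∀ x : ℝ, 0 ≤ x → ‖x‖ₑ ^ α = ENNReal.ofReal (x ^ α) := fun x hx => by
    rw [Real.enorm_eq_ofReal hx, ENNReal.ofReal_rpow_of_nonneg hx hα0.le]
  -- Superadditivity of the power gives a pointwise inequality between functions with the same
  -- finite integral, so it is an equality a.e.; strictness then forbids both values being positive.
  have h3 := ae_eq_of_ae_le_of_lintegral_le (μ := μ) (f := fun s => ‖f s‖ₑ ^ α + ‖g s‖ₑ ^ α)
    (g := fun s => ‖f s + g s‖ₑ ^ α) (ae_of_all _ fun s => by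
      dsimp only
      rw [Real.enorm_eq_ofReal (hf s), Real.enorm_eq_ofReal (hg s),
        Real.enorm_eq_ofReal (add_nonneg (hf s) (hg s)), ENNReal.ofReal_add (hf s) (hg s)]
      exact ENNReal.add_rpow_le_rpow_add _ _ hα.le)
    (h2 ▸ lintegral_rpow_ne_top hα0 hfg.2.1) (hfg.2.1.1.enorm.pow_const _) h2.le
  filter_upwards [h3] with s hs
  by_contra! hc
  have h4 := add_rpow_lt_rpow_add hα ((hf s).lt_of_ne' hc.1) ((hg s).lt_of_ne' hc.2)
  rw [hreal _ (hf s), hreal _ (hg s), hreal _ (add_nonneg (hf s) (hg s)),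
    ← ENNReal.ofReal_add (Real.rpow_nonneg (hf s) _) (Real.rpow_nonneg (hg s) _),
    ENNReal.ofReal_eq_ofReal_iff (add_nonneg (Real.rpow_nonneg (hf s) _) (Real.rpow_nonneg (hg s) _))
      (Real.rpow_nonneg (add_nonneg (hf s) (hg s)) _)] at hs
  exact h4.ne hs

/-- `X - Y` is the integral of `f - g`. If it vanishes a.s. its scale is zero, and the scale is the
norm of `f - g`. -/
theorem IsStableIntegral.ae_eq_iff [IsProbabilityMeasure P] (hα : 1 ≤ α)
    (hM : IsStableRandomMeasure P μ α M) {f g : S → ℝ} {X Y : Ω → ℝ}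
    (hX : IsStableIntegral P μ α M f X) (hY : IsStableIntegral P μ α M g Y) :
    X =ᵐ[P] Y ↔ f =ᵐ[μ] g := by
  have hα0 : 0 < α := by linarith
  constructor
  · intro h
    have h1 := hX.linear hα hM hY 1 (-1)
    have h2 : HasStableScale P α 0 (fun ω => 1 * X ω + -1 * Y ω) := by
      refine ⟨h1.1, fun θ => ?_⟩
      have : P.map (fun ω => 1 * X ω + -1 * Y ω) = P.map (fun _ => (0 : ℝ)) := by
        refine Measure.map_congr ?_
        filter_upwards [h] with ω hω
        rw [hω]; ring
      rw [this, Measure.map_const]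
      simp [Real.zero_rpow hα0.ne']
    have h3 := (h1.hasStableScale hα hM).unique hα0 (lpn_nonneg _) le_rfl h2
    rw [lpn, ENNReal.toReal_eq_zero_iff, or_iff_left h1.2.1.2.ne,
      eLpNorm_eq_zero_iff h1.2.1.1 (by simpa using hα0)] at h3
    filter_upwards [h3] with s hs
    simp only [Pi.zero_apply] at hs
    linarith
  · intro h
    exact hX.ae_unique (hY.congr h.symm hY.1 ae_eq_rfl)

end Laws

/-! ### The kernel `h₃` -/

section Kernel

theorem h3_nonneg (t s z : ℝ) : 0 ≤ h3 t s z := by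
  unfold h3
  split_ifs <;> positivity

theorem h3_pos {t z : ℝ} (ht : 0 < t) (hz : 0 < z) (s : ℝ) : 0 < h3 t s z := by
  unfold h3
  rw [if_pos ⟨ht, hz⟩]
  have : 0 < Real.sqrt (Real.pi * t) := Real.sqrt_pos.2 (by positivity)
  positivity

theorem h3_of_nonpos {t : ℝ} (ht : t ≤ 0) (s z : ℝ) : h3 t s z = 0 :=
  if_neg fun h => ht.not_gt h.1

theorem h3_of_height_nonpos {z : ℝ} (hz : z ≤ 0) (t s : ℝ) : h3 t s z = 0 :=
  if_neg fun h => hz.not_gt h.2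

theorem h3_lt_h3 {t z : ℝ} (ht : 0 < t) (hz : 0 < z) {s s' : ℝ} (h : |s'| < |s|) :
    h3 t s z < h3 t s' z := by
  unfold h3
  rw [if_pos ⟨ht, hz⟩, if_pos ⟨ht, hz⟩]
  have : 0 < Real.sqrt (Real.pi * t) := Real.sqrt_pos.2 (by positivity)
  have h2 : s' ^ 2 < s ^ 2 := sq_lt_sq.2 h
  gcongr

theorem measurable_h3 : Measurable fun q : ℝ × ℝ × ℝ => h3 q.1 q.2.1 q.2.2 := by
  unfold h3
  refine Measurable.ite ?_ (by fun_prop) measurable_const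
  exact (measurableSet_lt measurable_const measurable_fst).inter
    (measurableSet_lt measurable_const measurable_snd.snd)

@[fun_prop]
theorem Measurable.h3_comp {X : Type*} [MeasurableSpace X] {f g k : X → ℝ} (hf : Measurable f)
    (hg : Measurable g) (hk : Measurable k) : Measurable fun a => h3 (f a) (g a) (k a) :=
  measurable_h3.comp (hf.prodMk (hg.prodMk hk))

theorem continuous_h3 (t z : ℝ) : Continuous fun s => h3 t s z := by
  unfold h3
  split_ifs
  · fun_prop
  · exact continuous_const

theorem h3_eq_gaussian {t z : ℝ} (ht : 0 < t) (hz : 0 < z) (s : ℝ) :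
    h3 t s z = 3 / (2 * Real.sqrt (Real.pi * t)) * Real.exp (-3 * z * t) *
      Real.exp (-(1 / (4 * t)) * s ^ 2) := by
  rw [h3, if_pos ⟨ht, hz⟩, mul_assoc (3 / _), ← Real.exp_add]
  congr 2; ring

theorem integrable_h3_space (t z : ℝ) : Integrable fun s => h3 t s z := by
  by_cases h : 0 < t ∧ 0 < z
  · simp_rw [h3_eq_gaussian h.1 h.2]
    exact (integrable_exp_neg_mul_sq (by have := h.1; positivity)).const_mul _
  · simp [h3, h]

/-- The integral of `h₃` over the space variable. -/
noncomputable def spaceInt (t z : ℝ) : ℝ := ∫ w : ℝ, h3 t w z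

/-- The integral of `h₃` over the time variable. -/
noncomputable def timeInt (s z : ℝ) : ℝ := ∫ w : ℝ, h3 w s z

/-- `h3 t · z` is `3 exp(-3zt)` times the heat kernel at time `t`, which has mass one. -/
theorem spaceInt_eq {t z : ℝ} (ht : 0 < t) (hz : 0 < z) :
    spaceInt t z = 3 * Real.exp (-3 * z * t) := by
  have h1 : Real.sqrt (Real.pi / (1 / (4 * t))) = 2 * Real.sqrt (Real.pi * t) := by
    rw [show Real.pi / (1 / (4 * t)) = 2 ^ 2 * (Real.pi * t) by field_simp; ring,
      Real.sqrt_mul (by norm_num), Real.sqrt_sq (by norm_num)]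
  have : 0 < Real.sqrt (Real.pi * t) := Real.sqrt_pos.2 (by positivity)
  unfold spaceInt
  simp_rw [h3_eq_gaussian ht hz]
  rw [integral_const_mul, integral_gaussian, h1]
  field_simp

theorem spaceInt_of_nonpos {t : ℝ} (ht : t ≤ 0) (z : ℝ) : spaceInt t z = 0 := by
  simp [spaceInt, h3_of_nonpos ht]

theorem spaceInt_nonneg (t z : ℝ) : 0 ≤ spaceInt t z := integral_nonneg fun _ => h3_nonneg _ _ _

theorem timeInt_nonneg (t z : ℝ) : 0 ≤ timeInt t z := integral_nonneg fun _ => h3_nonneg _ _ _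

theorem spaceInt_pos {t z : ℝ} (ht : 0 < t) (hz : 0 < z) : 0 < spaceInt t z := by
  rw [spaceInt_eq ht hz]; positivity

theorem spaceInt_le (t z : ℝ) : spaceInt t z ≤ 3 := by
  by_cases ht : 0 < t
  · by_cases hz : 0 < z
    · rw [spaceInt_eq ht hz]
      have : Real.exp (-3 * z * t) ≤ 1 := Real.exp_le_one_iff.2 (by nlinarith [mul_pos hz ht])
      linarith
    · simp [spaceInt, h3_of_height_nonpos (not_lt.1 hz)]
  · rw [spaceInt_of_nonpos (not_lt.1 ht)]; norm_num

@[fun_prop]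
theorem Measurable.spaceInt_comp {X : Type*} [MeasurableSpace X] {f k : X → ℝ} (hf : Measurable f)
    (hk : Measurable k) : Measurable fun a => spaceInt (f a) (k a) := by
  have h : Measurable fun q : X × ℝ => h3 (f q.1) q.2 (k q.1) := by fun_prop
  exact h.stronglyMeasurable.integral_prod_right'.measurable

@[fun_prop]
theorem Measurable.timeInt_comp {X : Type*} [MeasurableSpace X] {f k : X → ℝ} (hf : Measurable f)
    (hk : Measurable k) : Measurable fun a => timeInt (f a) (k a) := by
  have h : Measurable fun q : X × ℝ => h3 q.2 (f q.1) (k q.1) := by fun_prop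
  exact h.stronglyMeasurable.integral_prod_right'.measurable

theorem lintegral_h3_space (t z : ℝ) : ∫⁻ s, ‖h3 t s z‖ₑ = ‖spaceInt t z‖ₑ := by
  rw [Real.enorm_eq_ofReal (spaceInt_nonneg t z), spaceInt,
    ofReal_integral_eq_lintegral_ofReal (integrable_h3_space t z)
      (ae_of_all _ fun _ => h3_nonneg _ _ _)]
  exact lintegral_congr fun s => Real.enorm_eq_ofReal (h3_nonneg _ _ _)

theorem lintegral_spaceInt {z : ℝ} (hz : 0 < z) :
    ∫⁻ t, ‖spaceInt t z‖ₑ = ENNReal.ofReal (1 / z) := by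
  have h1 : ∀ t, ‖spaceInt t z‖ₑ =
      (Set.Ioi 0).indicator (fun t => ENNReal.ofReal (3 * Real.exp (-3 * z * t))) t := by
    intro t
    rw [Real.enorm_eq_ofReal (spaceInt_nonneg t z), Set.indicator_apply]
    split_ifs with ht
    · rw [spaceInt_eq ht hz]
    · rw [spaceInt_of_nonpos (not_lt.1 ht), ENNReal.ofReal_zero]
  have h2 : IntegrableOn (fun t => 3 * Real.exp (-3 * z * t)) (Set.Ioi 0) :=
    (integrableOn_exp_mul_Ioi (by linarith) 0).const_mul 3
  rw [lintegral_congr h1, lintegral_indicator measurableSet_Ioi,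
    ← ofReal_integral_eq_lintegral_ofReal h2 (ae_of_all _ fun t => by positivity),
    integral_const_mul, integral_exp_mul_Ioi (by linarith)]
  congr 1
  simp
  field_simp

/-- An integrable bound of `h₃` that is uniform in space and height. -/
theorem h3_le (t s z : ℝ) :
    h3 t s z ≤ (Set.Ioi 0).indicator (fun t => 3 / (2 * Real.sqrt Real.pi) *
      (t ^ (1 / 2 - 1 : ℝ) * Real.exp (-(3 * z * t)))) t := by
  rw [Set.indicator_apply]
  split_ifs with ht
  · have ht : 0 < t := ht
    unfold h3
    split_ifs with h
    · rw [show (1 / 2 - 1 : ℝ) = -(1 / 2) by norm_num, Real.rpow_neg ht.le, ← Real.sqrt_eq_rpow,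
        Real.sqrt_mul Real.pi_pos.le]
      have h1 : 0 < Real.sqrt Real.pi := Real.sqrt_pos.2 Real.pi_pos
      have h2 : 0 < Real.sqrt t := Real.sqrt_pos.2 ht
      have h3 : Real.exp (-3 * z * t - s ^ 2 / (4 * t)) ≤ Real.exp (-(3 * z * t)) := by
        gcongr
        have : 0 ≤ s ^ 2 / (4 * t) := by positivity
        linarith
      calc _ ≤ 3 / (2 * (Real.sqrt Real.pi * Real.sqrt t)) * Real.exp (-(3 * z * t)) := by gcongr
        _ = _ := by field_simp
    · positivity
  · rw [h3_of_nonpos (not_lt.1 ht)]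

theorem integrable_rpow_mul_exp {z : ℝ} (hz : 0 < z) :
    Integrable ((Set.Ioi (0 : ℝ)).indicator (fun t => 3 / (2 * Real.sqrt Real.pi) *
      (t ^ (1 / 2 - 1 : ℝ) * Real.exp (-(3 * z * t))))) := by
  rw [integrable_indicator_iff measurableSet_Ioi]
  refine Integrable.const_mul ?_ _
  have h0 : (0 : ℝ) < 3 * z := by positivity
  have := integrableOn_rpow_mul_exp_neg_mul_rpow (p := 1) (s := 1 / 2 - 1) (b := 3 * z)
    (by norm_num) one_pos h0
  simpa [IntegrableOn] using this

theorem integrable_h3_time {z : ℝ} (hz : 0 < z) (s : ℝ) : Integrable fun t => h3 t s z := by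
  refine (integrable_rpow_mul_exp hz).mono' (by fun_prop) (ae_of_all _ fun t => ?_)
  rw [Real.norm_of_nonneg (h3_nonneg _ _ _)]
  exact h3_le t s z

/-- Dropping the Gaussian factor leaves a Gamma integral at `1/2`, whose value is `(√3 / 2)
z^(-1/2)`. -/
theorem timeInt_le {z : ℝ} (hz : 0 < z) (s : ℝ) : timeInt s z ≤ z ^ (-(1 / 2) : ℝ) := by
  refine (integral_mono (integrable_h3_time hz s) (integrable_rpow_mul_exp hz)
    fun t => h3_le t s z).trans ?_
  rw [integral_indicator measurableSet_Ioi, integral_const_mul,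
    Real.integral_rpow_mul_exp_neg_mul_Ioi (by norm_num) (by positivity),
    Real.Gamma_one_half_eq, one_div, Real.inv_rpow (by positivity), Real.mul_rpow (by norm_num) hz.le,
    Real.rpow_neg hz.le, ← Real.sqrt_eq_rpow,
    ← Real.sqrt_eq_rpow]
  have h1 : 0 < Real.sqrt Real.pi := Real.sqrt_pos.2 Real.pi_pos
  have h2 : 0 < Real.sqrt z := Real.sqrt_pos.2 hz
  have h3 : 0 < Real.sqrt 3 := Real.sqrt_pos.2 (by norm_num)
  have h4 : Real.sqrt 3 * Real.sqrt 3 = 3 := Real.mul_self_sqrt (by norm_num)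
  have h5 : Real.sqrt 3 ≤ 2 := by nlinarith
  rw [mul_inv]
  calc _ = (Real.sqrt 3 * Real.sqrt 3) / 2 * ((Real.sqrt 3)⁻¹ * (Real.sqrt z)⁻¹) := by
        rw [h4]; field_simp
    _ = Real.sqrt 3 / 2 * (Real.sqrt z)⁻¹ := by field_simp
    _ ≤ 1 * (Real.sqrt z)⁻¹ := by gcongr; linarith
    _ = _ := one_mul _

theorem timeInt_pos {z : ℝ} (hz : 0 < z) (s : ℝ) : 0 < timeInt s z := by
  refine (integral_pos_iff_support_of_nonneg (fun t => h3_nonneg t s z)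
    (integrable_h3_time hz s)).2 ?_
  refine lt_of_lt_of_le ?_ (measure_mono (s := Set.Ioi 0) fun t ht => (h3_pos ht hz s).ne')
  simp

theorem timeInt_lt {z : ℝ} (hz : 0 < z) {s s' : ℝ} (h : |s'| < |s|) :
    timeInt s z < timeInt s' z := by
  have hi := (integrable_h3_time hz s').sub (integrable_h3_time hz s)
  have hpos : 0 < ∫ t, (h3 t s' z - h3 t s z) := by
    refine (integral_pos_iff_support_of_nonneg (fun t => ?_) hi).2 ?_
    · by_cases ht : 0 < t
      · exact sub_nonneg.2 (h3_lt_h3 ht hz h).le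
      · simp [h3_of_nonpos (not_lt.1 ht)]
    · refine lt_of_lt_of_le ?_ (measure_mono (s := Set.Ioi 0)
        fun t ht => (sub_pos.2 (h3_lt_h3 ht hz h)).ne')
      simp
  rw [integral_sub (integrable_h3_time hz s') (integrable_h3_time hz s)] at hpos
  exact sub_pos.1 hpos

theorem lintegral_h3_time {z : ℝ} (hz : 0 < z) (s : ℝ) : ∫⁻ t, ‖h3 t s z‖ₑ = ‖timeInt s z‖ₑ := by
  rw [Real.enorm_eq_ofReal (timeInt_nonneg s z), timeInt,
    ofReal_integral_eq_lintegral_ofReal (integrable_h3_time hz s)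
      (ae_of_all _ fun _ => h3_nonneg _ _ _)]
  exact lintegral_congr fun s => Real.enorm_eq_ofReal (h3_nonneg _ _ _)

/-- By Tonelli the total mass of `h3` may be computed by integrating over space first. -/
theorem lintegral_timeInt {z : ℝ} (hz : 0 < z) :
    ∫⁻ s, ‖timeInt s z‖ₑ = ENNReal.ofReal (1 / z) := by
  simp_rw [← lintegral_h3_time hz]
  rw [lintegral_lintegral_swap, ← lintegral_spaceInt hz]
  · simp_rw [lintegral_h3_space]
  · exact Measurable.aemeasurable (by unfold Function.uncurry; fun_prop)

/-- A locally integrable bound of `h₃` as a function of time. -/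
noncomputable def timeBound (t : ℝ) : ℝ :=
  (Set.Ioc 0 1).indicator (fun t => 3 / (2 * Real.sqrt Real.pi) * t ^ (-(1 / 2) : ℝ)) t + 3

theorem h3_le_timeBound (t s z : ℝ) : h3 t s z ≤ timeBound t := by
  have h1 : 0 < Real.sqrt Real.pi := Real.sqrt_pos.2 Real.pi_pos
  have h2 : 1 ≤ Real.sqrt Real.pi := Real.one_le_sqrt.2 (by linarith [Real.pi_gt_three])
  have hc : 3 / (2 * Real.sqrt Real.pi) ≤ 3 := by
    rw [div_le_iff₀ (by positivity)]; nlinarith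
  have hi : 0 ≤ (Set.Ioc 0 1).indicator
      (fun t => 3 / (2 * Real.sqrt Real.pi) * t ^ (-(1 / 2) : ℝ)) t := by
    refine Set.indicator_nonneg (fun t ht => ?_) t
    have := ht.1
    positivity
  by_cases h : 0 < t ∧ 0 < z
  · have h7 := h3_le t s z
    rw [Set.indicator_of_mem (Set.mem_Ioi.2 h.1), show (1 / 2 - 1 : ℝ) = -(1 / 2) by norm_num] at h7
    have h4 : Real.exp (-(3 * z * t)) ≤ 1 :=
      Real.exp_le_one_iff.2 (by nlinarith [mul_pos h.2 h.1])
    have h0 : 0 ≤ t ^ (-(1 / 2) : ℝ) := Real.rpow_nonneg h.1.le _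
    have h5 : h3 t s z ≤ 3 / (2 * Real.sqrt Real.pi) * t ^ (-(1 / 2) : ℝ) :=
      h7.trans (mul_le_mul_of_nonneg_left (mul_le_of_le_one_right h0 h4) (by positivity))
    by_cases ht : t ≤ 1
    · rw [timeBound, Set.indicator_of_mem (Set.mem_Ioc.2 ⟨h.1, ht⟩)]
      linarith
    · have h6 : t ^ (-(1 / 2) : ℝ) ≤ 1 :=
        Real.rpow_le_one_of_one_le_of_nonpos (not_le.1 ht).le (by norm_num)
      rw [timeBound]
      have : 3 / (2 * Real.sqrt Real.pi) * t ^ (-(1 / 2) : ℝ) ≤ 3 * 1 :=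
        mul_le_mul hc h6 h0 (by norm_num)
      linarith
  · rw [h3, if_neg h, timeBound]
    linarith

theorem integrable_timeBound_aux : Integrable ((Set.Ioc (0 : ℝ) 1).indicator
    (fun t => 3 / (2 * Real.sqrt Real.pi) * t ^ (-(1 / 2) : ℝ))) := by
  rw [integrable_indicator_iff measurableSet_Ioc]
  refine Integrable.const_mul ?_ _
  exact (intervalIntegrable_iff_integrableOn_Ioc_of_le zero_le_one).1
    (intervalIntegral.intervalIntegrable_rpow' (by norm_num))

theorem intervalIntegrable_h3_time (s z u a b : ℝ) :
    IntervalIntegrable (fun t => h3 (t - u) s z) volume a b := by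
  have h : IntervalIntegrable (fun t => timeBound (t - u)) volume a b := by
    have := (integrable_timeBound_aux.comp_sub_right u).intervalIntegrable (a := a) (b := b)
    exact this.add intervalIntegrable_const
  refine h.mono_fun' (Measurable.aestronglyMeasurable (by fun_prop)) (ae_of_all _ fun t => ?_)
  dsimp only
  rw [Real.norm_of_nonneg (h3_nonneg _ _ _)]
  exact h3_le_timeBound _ _ _

/-- The singularity `t^(-1/2)` is integrable and `timeBound` does not involve the height. Uniformity
as `z → 0` gives the exponent `a = 0` in the regime where `h3` is integrated over time only. -/
theorem exists_lintegral_h3_time_le {x : ℝ} (hx : 0 ≤ x) : ∃ K : ℝ, 0 ≤ K ∧ ∀ u s z,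
    ∫⁻ t in Set.Ioc 0 x, ‖h3 (t - u) s z‖ₑ ≤ ENNReal.ofReal K := by
  set k := (Set.Ioc (0 : ℝ) 1).indicator
    (fun t => 3 / (2 * Real.sqrt Real.pi) * t ^ (-(1 / 2) : ℝ)) with hk
  refine ⟨(∫⁻ t, ‖k t‖ₑ).toReal + 3 * x, by positivity, fun u s z => ?_⟩
  have hfin : ∫⁻ t, ‖k t‖ₑ ≠ ⊤ := integrable_timeBound_aux.2.ne
  have hmeas : Measurable k := by
    rw [hk]
    exact (by fun_prop : Measurable fun t : ℝ =>
      3 / (2 * Real.sqrt Real.pi) * t ^ (-(1 / 2) : ℝ)).indicator measurableSet_Ioc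
  rw [ENNReal.ofReal_add ENNReal.toReal_nonneg (by positivity), ENNReal.ofReal_toReal hfin]
  calc ∫⁻ t in Set.Ioc 0 x, ‖h3 (t - u) s z‖ₑ
      ≤ ∫⁻ t in Set.Ioc 0 x, (‖k (t - u)‖ₑ + ENNReal.ofReal 3) := by
        refine lintegral_mono fun t => ?_
        have h1 : ‖h3 (t - u) s z‖ₑ ≤ ‖k (t - u) + 3‖ₑ := by
          rw [enorm_le_iff_norm_le, Real.norm_of_nonneg (h3_nonneg _ _ _)]
          exact (h3_le_timeBound _ s z).trans (le_abs_self _)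
        refine h1.trans ((enorm_add_le _ _).trans (le_of_eq ?_))
        rw [Real.enorm_eq_ofReal (by norm_num : (0 : ℝ) ≤ 3)]
    _ = (∫⁻ t in Set.Ioc 0 x, ‖k (t - u)‖ₑ) + ENNReal.ofReal 3 * ENNReal.ofReal x := by
        rw [lintegral_add_right _ measurable_const]
        simp
    _ ≤ _ := by
        rw [ENNReal.ofReal_mul (by norm_num)]
        refine add_le_add_left ?_ _
        refine (setLIntegral_le_lintegral _ _).trans (le_of_eq ?_)
        exact lintegral_sub_right_eq_self (fun t => ‖k t‖ₑ) u

end Kernel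

/-! ### Membership in `L^α` -/

section Membership

theorem lintegral_triple {g : ℝ × ℝ × ℝ → ENNReal} (hg : Measurable g) :
    ∫⁻ p, g p = ∫⁻ z, ∫⁻ u, ∫⁻ v, g (u, v, z) := by
  rw [Measure.volume_eq_prod, lintegral_prod _ hg.aemeasurable]
  have h1 : ∀ u, ∫⁻ q : ℝ × ℝ, g (u, q) = ∫⁻ z, ∫⁻ v, g (u, v, z) := fun u => by
    rw [Measure.volume_eq_prod, lintegral_prod_symm _ (by fun_prop)]
  simp_rw [h1]
  rw [lintegral_lintegral_swap]
  refine Measurable.aemeasurable ?_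
  unfold Function.uncurry
  have : Measurable fun q : (ℝ × ℝ) × ℝ => g (q.1.1, q.2, q.1.2) := by fun_prop
  exact this.lintegral_prod_right'

/-- The density of the control measure. -/
noncomputable def density3 (φ₁ β : ℝ) (p : ℝ × ℝ × ℝ) : ENNReal :=
  if 0 < p.2.2 then ENNReal.ofReal (φ₁ * p.2.2 ^ β) else 0

theorem measurable_density3 (φ₁ β : ℝ) : Measurable (density3 φ₁ β) :=
  Measurable.ite (measurableSet_lt measurable_const measurable_snd.snd) (by fun_prop)
    measurable_const

theorem control3_eq (φ₁ β : ℝ) : control3 φ₁ β = volume.withDensity (density3 φ₁ β) := rfl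

theorem lintegral_control3 (φ₁ β : ℝ) {g : ℝ × ℝ × ℝ → ENNReal} (hg : Measurable g) :
    ∫⁻ p, g p ∂(control3 φ₁ β) = ∫⁻ p, density3 φ₁ β p * g p := by
  rw [control3_eq, lintegral_withDensity_eq_lintegral_mul _ (measurable_density3 φ₁ β) hg]
  rfl

/-- Interpolation between supremum and plane integral: `|f|^α ≤ (sup |f|)^(α-1) |f|`, with the bound
`z^(-a)` used for `z ≤ 1` and `z^(-b)` for `z > 1`. After the plane integral contributes `1/z` and
the density `z^β`, two power integrals in `z` remain; `ha` and `hb` are their convergence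
conditions. -/
theorem memLp_control3 {φ₁ α β a b C : ℝ} (hφ : 0 < φ₁) (hα : 1 < α) (hC : 0 ≤ C)
    (ha : -1 < β - 1 - a * (α - 1)) (hb : β - 1 - b * (α - 1) < -1) {f : ℝ × ℝ × ℝ → ℝ}
    (hf : Measurable f)
    (hfa : ∀ u v z, 0 < z → ‖f (u, v, z)‖ₑ ≤ ENNReal.ofReal (C * z ^ (-a)))
    (hfb : ∀ u v z, 0 < z → ‖f (u, v, z)‖ₑ ≤ ENNReal.ofReal (C * z ^ (-b)))
    (hf1 : ∀ z, 0 < z → ∫⁻ u, ∫⁻ v, ‖f (u, v, z)‖ₑ ≤ ENNReal.ofReal (C * (1 / z))) :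
    MemLp f (ENNReal.ofReal α) (control3 φ₁ β) := by
  have hα0 : 0 < α := by linarith
  refine ⟨hf.aestronglyMeasurable, ?_⟩
  rw [eLpNorm_lt_top_iff_lintegral_rpow_enorm_lt_top (by simpa using hα0) ENNReal.ofReal_ne_top,
    ENNReal.toReal_ofReal hα0.le, lintegral_control3 _ _ (by fun_prop)]
  set e : ℝ → ℝ := fun z => if z ≤ 1 then a else b with he
  have hme : Measurable e := Measurable.ite measurableSet_Iic measurable_const measurable_const
  set W : ℝ → ENNReal := fun z => if 0 < z then
    ENNReal.ofReal (φ₁ * z ^ β) * ENNReal.ofReal (C * z ^ (-e z)) ^ (α - 1) else 0 with hW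
  have hmW : Measurable W := Measurable.ite measurableSet_Ioi (by fun_prop) measurable_const
  have h1 : ∀ p : ℝ × ℝ × ℝ, density3 φ₁ β p * ‖f p‖ₑ ^ α ≤ W p.2.2 * ‖f p‖ₑ := by
    rintro ⟨u, v, z⟩
    simp only [density3, hW]
    split_ifs with hz
    · rw [mul_assoc]
      refine mul_le_mul_right ?_ _
      calc ‖f (u, v, z)‖ₑ ^ α = ‖f (u, v, z)‖ₑ ^ (α - 1) * ‖f (u, v, z)‖ₑ := by
            conv_rhs => rw [← ENNReal.rpow_one ‖f (u, v, z)‖ₑ, ← ENNReal.rpow_mul]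
            rw [one_mul, ← ENNReal.rpow_add_of_nonneg _ _ (by linarith) zero_le_one]
            congr 1; ring
        _ ≤ _ := by
            refine mul_le_mul_left (ENNReal.rpow_le_rpow ?_ (by linarith)) _
            simp only [he]
            split_ifs
            · exact hfa u v z hz
            · exact hfb u v z hz
    · simp
  have hint : ∀ c : ℝ → ℝ, ∀ s : Set ℝ, IntegrableOn c s → ∀ K : ℝ,
      ∫⁻ z in s, ENNReal.ofReal (K * c z) < ⊤ := by
    intro c s hc K
    have := (hc.const_mul K).2
    refine lt_of_le_of_lt (lintegral_mono fun z => ?_) this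
    exact Real.ofReal_le_enorm _
  have i1 : IntegrableOn (fun z : ℝ => z ^ (β - 1 - a * (α - 1))) (Set.Ioc 0 1) :=
    (intervalIntegrable_iff_integrableOn_Ioc_of_le zero_le_one).1
      (intervalIntegral.intervalIntegrable_rpow' ha)
  have i2 : IntegrableOn (fun z : ℝ => z ^ (β - 1 - b * (α - 1))) (Set.Ioi 1) :=
    integrableOn_Ioi_rpow_of_lt hb one_pos
  set K := φ₁ * C ^ (α - 1) * C with hK
  have hcomb : ∀ z, 0 < z → W z * ENNReal.ofReal (C * (1 / z)) =
      ENNReal.ofReal (K * z ^ (β - 1 - e z * (α - 1))) := by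
    intro z hz
    simp only [hW]
    rw [if_pos hz, ENNReal.ofReal_rpow_of_nonneg (by positivity) (by linarith),
      ← ENNReal.ofReal_mul (by positivity), ← ENNReal.ofReal_mul (by positivity),
      Real.mul_rpow hC (by positivity), ← Real.rpow_mul hz.le,
      show β - 1 - e z * (α - 1) = β + -e z * (α - 1) + (-1) by ring, Real.rpow_add hz,
      Real.rpow_add hz, Real.rpow_neg_one, hK]
    congr 1; ring
  calc ∫⁻ p, density3 φ₁ β p * ‖f p‖ₑ ^ α ≤ ∫⁻ p : ℝ × ℝ × ℝ, W p.2.2 * ‖f p‖ₑ := lintegral_mono h1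
    _ = ∫⁻ z, W z * ∫⁻ u, ∫⁻ v, ‖f (u, v, z)‖ₑ := by
        rw [lintegral_triple (by fun_prop)]
        refine lintegral_congr fun z => ?_
        have hm : Measurable fun u => ∫⁻ v, ‖f (u, v, z)‖ₑ := by
          have : Measurable fun q : ℝ × ℝ => ‖f (q.1, q.2, z)‖ₑ := by fun_prop
          exact this.lintegral_prod_right'
        rw [← lintegral_const_mul _ hm]
        refine lintegral_congr fun u => ?_
        dsimp only
        rw [lintegral_const_mul _ (by fun_prop)]
    _ ≤ ∫⁻ z, ((Set.Ioc 0 1).indicator (fun z => ENNReal.ofReal (K * z ^ (β - 1 - a * (α - 1)))) z +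
          (Set.Ioi 1).indicator (fun z => ENNReal.ofReal (K * z ^ (β - 1 - b * (α - 1)))) z) := by
        refine lintegral_mono fun z => ?_
        by_cases hz : 0 < z
        · refine (mul_le_mul_right (hf1 z hz) _).trans ?_
          rw [hcomb z hz]
          simp only [he]
          split_ifs with hz1
          · rw [Set.indicator_of_mem (Set.mem_Ioc.2 ⟨hz, hz1⟩)]
            exact le_self_add
          · rw [Set.indicator_of_mem (Set.mem_Ioi.2 (not_le.1 hz1))]
            exact le_add_self
        · simp [hW, hz]
    _ = (∫⁻ z in Set.Ioc 0 1, ENNReal.ofReal (K * z ^ (β - 1 - a * (α - 1)))) +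
          ∫⁻ z in Set.Ioi 1, ENNReal.ofReal (K * z ^ (β - 1 - b * (α - 1))) := by
        rw [lintegral_add_left (Measurable.indicator (by fun_prop) measurableSet_Ioc),
          lintegral_indicator measurableSet_Ioc, lintegral_indicator measurableSet_Ioi]
    _ < ⊤ := ENNReal.add_lt_top.2 ⟨hint _ _ i1 K, hint _ _ i2 K⟩

theorem lintegral_lintegral_comp_sub {k : ℝ → ENNReal}
    (hk : Measurable k) (I : Set ℝ) :
    ∫⁻ u, ∫⁻ t in I, k (t - u) = volume I * ∫⁻ t, k t := by
  rw [lintegral_lintegral_swap (by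
    unfold Function.uncurry
    exact Measurable.aemeasurable (by fun_prop))]
  rw [lintegral_congr fun t => lintegral_sub_left_eq_self k t, lintegral_const, Measure.restrict_apply_univ, mul_comm]

theorem enorm_intervalIntegral_le {f : ℝ → ℝ} {a b : ℝ} (h : a ≤ b) :
    ‖∫ t in a..b, f t‖ₑ ≤ ∫⁻ t in Set.Ioc a b, ‖f t‖ₑ := by
  rw [intervalIntegral.integral_of_le h]
  exact enorm_integral_le_lintegral_enorm _

theorem measurable_intervalIntegral {X : Type*} [MeasurableSpace X] {f : X → ℝ → ℝ}
    (hf : Measurable fun q : X × ℝ => f q.1 q.2) (a b : ℝ) :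
    Measurable fun x => ∫ t in a..b, f x t := by
  have h : ∀ c d : ℝ, Measurable fun x => ∫ t in Set.Ioc c d, f x t := fun c d =>
    (hf.stronglyMeasurable.integral_prod_right' (ν := volume.restrict (Set.Ioc c d))).measurable
  exact (h a b).sub (h b a)

/-! ### The regimes of the integrand and their integrability -/

variable {α β γ : ℝ}

theorem F3_eq_half (hγ : γ = 1 / 2) (x y : ℝ) (p : ℝ × ℝ × ℝ) : F3 α β γ x y p =
    ∫ t in (0 : ℝ)..x, ∫ s in (0 : ℝ)..y, h3 (t - p.1) (s - p.2.1) p.2.2 := by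
  simp only [F3]
  rw [if_pos hγ]

theorem F3_eq_gt (hγ : 1 / 2 < γ) (x y : ℝ) (p : ℝ × ℝ × ℝ) : F3 α β γ x y p =
    (Set.Ioo 0 y).indicator 1 p.2.1 * ∫ t in (0 : ℝ)..x, spaceInt (t - p.1) p.2.2 := by
  simp only [F3]
  rw [if_neg hγ.ne', if_pos hγ]
  simp [Set.indicator_apply, spaceInt]

theorem F3_eq_lt_gt (hγ : γ < 1 / 2) (hβ : (α - 1) / 2 < β) (x y : ℝ) (p : ℝ × ℝ × ℝ) :
    F3 α β γ x y p =
    (Set.Ioo 0 x).indicator 1 p.1 * ∫ s in (0 : ℝ)..y, timeInt (p.2.1 - s) p.2.2 := by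
  simp only [F3]
  rw [if_neg hγ.ne, if_neg hγ.le.not_gt, if_pos hβ]
  simp [Set.indicator_apply, timeInt]

theorem F3_eq_lt_lt (hγ : γ < 1 / 2) (hβ : β < (α - 1) / 2) (x y : ℝ) (p : ℝ × ℝ × ℝ) :
    F3 α β γ x y p = y * ∫ t in (0 : ℝ)..x, h3 (t - p.1) p.2.1 p.2.2 := by
  simp only [F3]
  rw [if_neg hγ.ne, if_neg hγ.le.not_gt, if_neg hβ.le.not_gt]

theorem measurable_F3 (x y : ℝ) : Measurable (F3 α β γ x y) := by
  unfold F3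
  dsimp only
  split_ifs
  · refine measurable_intervalIntegral (f := fun (p : ℝ × ℝ × ℝ) t =>
      ∫ s in (0 : ℝ)..y, h3 (t - p.1) (s - p.2.1) p.2.2) ?_ _ _
    exact measurable_intervalIntegral (f := fun (q : (ℝ × ℝ × ℝ) × ℝ) s =>
      h3 (q.2 - q.1.1) (s - q.1.2.1) q.1.2.2) (by fun_prop) _ _
  · refine Measurable.mul (Measurable.ite ?_ measurable_const measurable_const)
      (measurable_intervalIntegral (f := fun (p : ℝ × ℝ × ℝ) t => spaceInt (t - p.1) p.2.2)
        (by fun_prop) _ _)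
    exact (measurableSet_lt measurable_const measurable_snd.fst).inter
      (measurableSet_lt measurable_snd.fst measurable_const)
  · refine Measurable.mul (Measurable.ite ?_ measurable_const measurable_const)
      (measurable_intervalIntegral (f := fun (p : ℝ × ℝ × ℝ) s => timeInt (p.2.1 - s) p.2.2)
        (by fun_prop) _ _)
    exact (measurableSet_lt measurable_const measurable_fst).inter
      (measurableSet_lt measurable_fst measurable_const)
  · exact (measurable_intervalIntegral (f := fun (p : ℝ × ℝ × ℝ) t => h3 (t - p.1) p.2.1 p.2.2)
      (by fun_prop) _ _).const_mul _

theorem lintegral_spaceInt_sub_le (u : ℝ) {z : ℝ} (hz : 0 < z) (x : ℝ) :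
    ∫⁻ t in Set.Ioc 0 x, ‖spaceInt (t - u) z‖ₑ ≤ ENNReal.ofReal (1 / z) := by
  refine (setLIntegral_le_lintegral _ _).trans (le_of_eq ?_)
  rw [lintegral_sub_right_eq_self (fun t => ‖spaceInt t z‖ₑ) u, lintegral_spaceInt hz]

theorem lintegral_spaceInt_sub_le' (u z x : ℝ) :
    ∫⁻ t in Set.Ioc 0 x, ‖spaceInt (t - u) z‖ₑ ≤ ENNReal.ofReal (3 * x) := by
  calc _ ≤ ∫⁻ _ in Set.Ioc 0 x, ENNReal.ofReal 3 := by
        refine lintegral_mono fun t => ?_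
        rw [Real.enorm_eq_ofReal (spaceInt_nonneg _ _)]
        exact ENNReal.ofReal_le_ofReal (spaceInt_le _ _)
    _ = _ := by
        rw [lintegral_const, Measure.restrict_apply_univ, Real.volume_Ioc, sub_zero,
          ENNReal.ofReal_mul (by norm_num)]

theorem enorm_indicator_mul_le (s : Set ℝ) (v c : ℝ) : ‖s.indicator 1 v * c‖ₑ ≤ ‖c‖ₑ := by
  by_cases h : v ∈ s <;> simp [h]

theorem lintegral_enorm_indicator_mul (s : Set ℝ) (hs : MeasurableSet s) (c : ℝ) :
    ∫⁻ v, ‖s.indicator 1 v * c‖ₑ = volume s * ‖c‖ₑ := by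
  have : ∀ v, ‖s.indicator 1 v * c‖ₑ = s.indicator (fun _ => ‖c‖ₑ) v := by
    intro v
    by_cases h : v ∈ s <;> simp [h]
  rw [lintegral_congr this, lintegral_indicator hs, setLIntegral_const, mul_comm]

/-- If the space integral of `f` is bounded by a time integral of `spaceInt`, then the plane
integral of `f` is bounded by a multiple of `1 / z`. -/
theorem lintegral_plane_le {f : ℝ → ℝ → ENNReal} {x y z : ℝ} (hx : 0 ≤ x) (hy : 0 ≤ y)
    (hz : 0 < z) (h : ∀ u, ∫⁻ v, f u v ≤
      ENNReal.ofReal y * ∫⁻ t in Set.Ioc 0 x, ‖spaceInt (t - u) z‖ₑ) :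
    ∫⁻ u, ∫⁻ v, f u v ≤ ENNReal.ofReal (x * y * (1 / z)) := by
  refine (lintegral_mono h).trans (le_of_eq ?_)
  have hm : Measurable fun u => ∫⁻ t in Set.Ioc 0 x, ‖spaceInt (t - u) z‖ₑ := by
    have : Measurable fun q : ℝ × ℝ => ‖spaceInt (q.2 - q.1) z‖ₑ := by fun_prop
    exact this.lintegral_prod_right'
  rw [lintegral_const_mul _ hm,
    lintegral_lintegral_comp_sub (k := fun t => ‖spaceInt t z‖ₑ) (by fun_prop),
    lintegral_spaceInt hz, Real.volume_Ioc, sub_zero, mul_comm x y, mul_assoc,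
    ENNReal.ofReal_mul hy, ENNReal.ofReal_mul hx]

/-- The supremum exponents `(a, b)` are `(0, 1)` for `γ ≥ 1/2`, `(1/2, 1)` for `γ < 1/2` and `β >
(α-1)/2`, and `(0, 1/2)` for `γ < 1/2` and `β < (α-1)/2`. The value `0` comes from a bound uniform
in `z`, `1/2` from `timeInt_le`, and `1` from integrating over both time and space. The constants
`C` are sums of nonnegative terms, large enough for the three bounds at once. -/
theorem memLp_F3 {φ₁ : ℝ} (hφ : 0 < φ₁) (hα : 1 < α) (hβ₀ : 0 < β) (hβ₁ : β < α - 1)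
    (hexc : ¬ (γ < 1 / 2 ∧ β = (α - 1) / 2)) {x y : ℝ} (hx : 0 ≤ x) (hy : 0 ≤ y) :
    MemLp (F3 α β γ x y) (ENNReal.ofReal α) (control3 φ₁ β) := by
  have hxy : 0 ≤ x * y := by positivity
  rcases lt_trichotomy γ (1 / 2) with hγ | hγ | hγ
  · rcases lt_trichotomy β ((α - 1) / 2) with hβ | hβ | hβ
    · obtain ⟨K, hK0, hK⟩ := exists_lintegral_h3_time_le hx
      have hle : ∀ u v z, ‖F3 α β γ x y (u, v, z)‖ₑ ≤
          ENNReal.ofReal y * ∫⁻ t in Set.Ioc 0 x, ‖h3 (t - u) v z‖ₑ := by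
        intro u v z
        rw [F3_eq_lt_lt hγ hβ, enorm_mul, Real.enorm_eq_ofReal hy]
        exact mul_le_mul_right (enorm_intervalIntegral_le hx) _
      refine memLp_control3 (a := 0) (b := 1 / 2) (C := y * K + y + x * y) hφ hα (by positivity)
        (by linarith) (by linarith) (measurable_F3 x y) ?_ ?_ ?_
      · intro u v z hz
        refine (hle u v z).trans ((mul_le_mul_right (hK u v z) _).trans ?_)
        rw [← ENNReal.ofReal_mul hy]
        refine ENNReal.ofReal_le_ofReal ?_
        rw [neg_zero, Real.rpow_zero, mul_one]
        linarith
      · intro u v z hz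
        refine (hle u v z).trans ?_
        have h1 : ∫⁻ t in Set.Ioc 0 x, ‖h3 (t - u) v z‖ₑ ≤ ENNReal.ofReal (z ^ (-(1 / 2) : ℝ)) := by
          refine (setLIntegral_le_lintegral _ _).trans ?_
          rw [lintegral_sub_right_eq_self (fun t => ‖h3 t v z‖ₑ) u, lintegral_h3_time hz,
            Real.enorm_eq_ofReal (timeInt_nonneg _ _)]
          exact ENNReal.ofReal_le_ofReal (timeInt_le hz v)
        refine (mul_le_mul_right h1 _).trans ?_
        rw [← ENNReal.ofReal_mul hy]
        refine ENNReal.ofReal_le_ofReal (mul_le_mul_of_nonneg_right ?_ (by positivity))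
        nlinarith [mul_nonneg hy hK0]
      · intro z hz
        refine (lintegral_plane_le hx hy hz fun u => ?_).trans (ENNReal.ofReal_le_ofReal ?_)
        · refine (lintegral_mono fun v => hle u v z).trans (le_of_eq ?_)
          have hm : Measurable fun v => ∫⁻ t in Set.Ioc 0 x, ‖h3 (t - u) v z‖ₑ := by
            have : Measurable fun q : ℝ × ℝ => ‖h3 (q.2 - u) q.1 z‖ₑ := by fun_prop
            exact this.lintegral_prod_right'
          rw [lintegral_const_mul _ hm, lintegral_lintegral_swap (by
            unfold Function.uncurry
            exact Measurable.aemeasurable (by fun_prop))]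
          simp_rw [lintegral_h3_space]
        · refine mul_le_mul_of_nonneg_right ?_ (by positivity)
          nlinarith [mul_nonneg hy hK0]
    · exact (hexc ⟨hγ, hβ⟩).elim
    · have hle : ∀ u v z, ‖F3 α β γ x y (u, v, z)‖ₑ ≤ ∫⁻ s in Set.Ioc 0 y, ‖timeInt (v - s) z‖ₑ := by
        intro u v z
        rw [F3_eq_lt_gt hγ hβ]
        exact (enorm_indicator_mul_le _ _ _).trans (enorm_intervalIntegral_le hy)
      refine memLp_control3 (a := 1 / 2) (b := 1) (C := y + 1 + x * y) hφ hα (by positivity)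
        (by linarith) (by linarith) (measurable_F3 x y) ?_ ?_ ?_
      · intro u v z hz
        refine (hle u v z).trans ?_
        calc _ ≤ ∫⁻ _ in Set.Ioc 0 y, ENNReal.ofReal (z ^ (-(1 / 2) : ℝ)) := by
              refine lintegral_mono fun t => ?_
              rw [Real.enorm_eq_ofReal (timeInt_nonneg _ _)]
              exact ENNReal.ofReal_le_ofReal (timeInt_le hz _)
          _ = ENNReal.ofReal (y * z ^ (-(1 / 2) : ℝ)) := by
              rw [lintegral_const, Measure.restrict_apply_univ, Real.volume_Ioc, sub_zero,
                ENNReal.ofReal_mul hy, mul_comm]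
          _ ≤ _ := by
              refine ENNReal.ofReal_le_ofReal (mul_le_mul_of_nonneg_right ?_ (by positivity))
              linarith
      · intro u v z hz
        refine (hle u v z).trans ((setLIntegral_le_lintegral _ _).trans ?_)
        rw [lintegral_sub_left_eq_self (fun t => ‖timeInt t z‖ₑ) v, lintegral_timeInt hz,
          Real.rpow_neg_one, ← one_div]
        refine ENNReal.ofReal_le_ofReal (le_mul_of_one_le_left (by positivity) (by linarith))
      · intro z hz
        have h1 : ∀ u, ∫⁻ v, ‖F3 α β γ x y (u, v, z)‖ₑ ≤
            (Set.Ioo 0 x).indicator (fun _ => ENNReal.ofReal (y * (1 / z))) u := by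
          intro u
          by_cases hu : u ∈ Set.Ioo 0 x
          · rw [Set.indicator_of_mem hu]
            refine (lintegral_mono fun v => hle u v z).trans (le_of_eq ?_)
            rw [lintegral_lintegral_swap (by
              unfold Function.uncurry
              exact Measurable.aemeasurable (by fun_prop))]
            rw [lintegral_congr fun s =>
              (lintegral_sub_right_eq_self (fun t => ‖timeInt t z‖ₑ) s).trans (lintegral_timeInt hz),
              lintegral_const, Measure.restrict_apply_univ, Real.volume_Ioc, sub_zero,
              ENNReal.ofReal_mul hy, mul_comm]
          · simp [F3_eq_lt_gt hγ hβ, hu]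
        refine (lintegral_mono h1).trans ?_
        rw [lintegral_indicator measurableSet_Ioo, setLIntegral_const, Real.volume_Ioo, sub_zero,
          ← ENNReal.ofReal_mul (by positivity)]
        refine ENNReal.ofReal_le_ofReal ?_
        have : 0 < 1 / z := by positivity
        nlinarith
  · have hsp : ∀ u v z, ‖F3 α β γ x y (u, v, z)‖ₑ ≤
        ∫⁻ t in Set.Ioc 0 x, ∫⁻ s in Set.Ioc 0 y, ‖h3 (t - u) (s - v) z‖ₑ := by
      intro u v z
      rw [F3_eq_half hγ]
      exact (enorm_intervalIntegral_le hx).trans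
        (lintegral_mono fun t => enorm_intervalIntegral_le hy)
    have hle : ∀ u v z, ‖F3 α β γ x y (u, v, z)‖ₑ ≤
        ∫⁻ t in Set.Ioc 0 x, ‖spaceInt (t - u) z‖ₑ := by
      intro u v z
      refine (hsp u v z).trans (lintegral_mono fun t => ?_)
      refine (setLIntegral_le_lintegral _ _).trans (le_of_eq ?_)
      rw [lintegral_sub_right_eq_self (fun s => ‖h3 (t - u) s z‖ₑ) v, lintegral_h3_space]
    refine memLp_control3 (a := 0) (b := 1) (C := 3 * x + 1 + x * y) hφ hα (by positivity)
        (by linarith) (by linarith) (measurable_F3 x y) ?_ ?_ ?_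
    · intro u v z hz
      refine (hle u v z).trans ((lintegral_spaceInt_sub_le' u z x).trans
        (ENNReal.ofReal_le_ofReal ?_))
      rw [neg_zero, Real.rpow_zero, mul_one]
      linarith
    · intro u v z hz
      refine (hle u v z).trans ((lintegral_spaceInt_sub_le u hz x).trans
        (ENNReal.ofReal_le_ofReal ?_))
      rw [Real.rpow_neg_one, ← one_div]
      exact le_mul_of_one_le_left (by positivity) (by linarith)
    · intro z hz
      refine (lintegral_plane_le hx hy hz fun u => ?_).trans (ENNReal.ofReal_le_ofReal
        (mul_le_mul_of_nonneg_right (by linarith) (by positivity)))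
      refine (lintegral_mono fun v => hsp u v z).trans (le_of_eq ?_)
      have hm : Measurable fun q : ℝ × ℝ => ∫⁻ s in Set.Ioc 0 y, ‖h3 (q.2 - u) (s - q.1) z‖ₑ := by
        have : Measurable fun q : (ℝ × ℝ) × ℝ => ‖h3 (q.1.2 - u) (q.2 - q.1.1) z‖ₑ := by fun_prop
        exact this.lintegral_prod_right'
      rw [lintegral_lintegral_swap hm.aemeasurable, ← lintegral_const_mul _ (by fun_prop)]
      refine lintegral_congr fun t => ?_
      rw [lintegral_lintegral_comp_sub (k := fun s => ‖h3 (t - u) s z‖ₑ) (by fun_prop),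
        lintegral_h3_space, Real.volume_Ioc, sub_zero]
  · have hle : ∀ u v z, ‖F3 α β γ x y (u, v, z)‖ₑ ≤
        ∫⁻ t in Set.Ioc 0 x, ‖spaceInt (t - u) z‖ₑ := by
      intro u v z
      rw [F3_eq_gt hγ]
      exact (enorm_indicator_mul_le _ _ _).trans (enorm_intervalIntegral_le hx)
    refine memLp_control3 (a := 0) (b := 1) (C := 3 * x + 1 + x * y) hφ hα (by positivity)
        (by linarith) (by linarith) (measurable_F3 x y) ?_ ?_ ?_
    · intro u v z hz
      refine (hle u v z).trans ((lintegral_spaceInt_sub_le' u z x).trans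
        (ENNReal.ofReal_le_ofReal ?_))
      rw [neg_zero, Real.rpow_zero, mul_one]
      linarith
    · intro u v z hz
      refine (hle u v z).trans ((lintegral_spaceInt_sub_le u hz x).trans
        (ENNReal.ofReal_le_ofReal ?_))
      rw [Real.rpow_neg_one, ← one_div]
      exact le_mul_of_one_le_left (by positivity) (by linarith)
    · intro z hz
      refine (lintegral_plane_le hx hy hz fun u => ?_).trans (ENNReal.ofReal_le_ofReal
        (mul_le_mul_of_nonneg_right (by linarith) (by positivity)))
      simp_rw [F3_eq_gt hγ]
      rw [lintegral_enorm_indicator_mul _ measurableSet_Ioo, Real.volume_Ioo, sub_zero]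
      exact mul_le_mul_right (enorm_intervalIntegral_le hx) _

end Membership

/-! ### Rectangular increments of the integrand -/

section Increments

variable {α β γ : ℝ}

/-- The rectangular increment of `F3` over `(u, x] × (v, y]`, up to a null set. -/
noncomputable def incKer (α β γ u v x y : ℝ) (p : ℝ × ℝ × ℝ) : ℝ :=
  if γ = 1 / 2 then ∫ t in u..x, ∫ s in v..y, h3 (t - p.1) (s - p.2.1) p.2.2
  else if 1 / 2 < γ then
    (Set.Ioo v y).indicator 1 p.2.1 * ∫ t in u..x, spaceInt (t - p.1) p.2.2
  else if (α - 1) / 2 < β then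
    (Set.Ioo u x).indicator 1 p.1 * ∫ s in v..y, timeInt (p.2.1 - s) p.2.2
  else (y - v) * ∫ t in u..x, h3 (t - p.1) p.2.1 p.2.2

theorem incKer_eq_half (hγ : γ = 1 / 2) (u v x y : ℝ) (p : ℝ × ℝ × ℝ) : incKer α β γ u v x y p =
    ∫ t in u..x, ∫ s in v..y, h3 (t - p.1) (s - p.2.1) p.2.2 := if_pos hγ

theorem incKer_eq_gt (hγ : 1 / 2 < γ) (u v x y : ℝ) (p : ℝ × ℝ × ℝ) : incKer α β γ u v x y p =
    (Set.Ioo v y).indicator 1 p.2.1 * ∫ t in u..x, spaceInt (t - p.1) p.2.2 := by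
  rw [incKer, if_neg hγ.ne', if_pos hγ]

theorem incKer_eq_lt_gt (hγ : γ < 1 / 2) (hβ : (α - 1) / 2 < β) (u v x y : ℝ) (p : ℝ × ℝ × ℝ) :
    incKer α β γ u v x y p =
    (Set.Ioo u x).indicator 1 p.1 * ∫ s in v..y, timeInt (p.2.1 - s) p.2.2 := by
  rw [incKer, if_neg hγ.ne, if_neg hγ.le.not_gt, if_pos hβ]

theorem incKer_eq_lt_lt (hγ : γ < 1 / 2) (hβ : β < (α - 1) / 2) (u v x y : ℝ) (p : ℝ × ℝ × ℝ) :
    incKer α β γ u v x y p = (y - v) * ∫ t in u..x, h3 (t - p.1) p.2.1 p.2.2 := by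
  rw [incKer, if_neg hγ.ne, if_neg hγ.le.not_gt, if_neg hβ.le.not_gt]

theorem F3_eq_incKer (x y : ℝ) : F3 α β γ x y = incKer α β γ 0 0 x y := by
  ext p
  simp only [F3, incKer, sub_zero]
  split_ifs <;> simp_all [spaceInt, timeInt]

theorem intervalIntegrable_h3_space (t z v a b : ℝ) :
    IntervalIntegrable (fun s => h3 t (s - v) z) volume a b :=
  ((continuous_h3 t z).comp (continuous_id.sub continuous_const)).intervalIntegrable _ _

theorem intervalIntegral_h3_nonneg {t z v a b : ℝ} (hab : a ≤ b) :
    0 ≤ ∫ s in a..b, h3 t (s - v) z :=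
  intervalIntegral.integral_nonneg hab fun _ _ => h3_nonneg _ _ _

theorem abs_intervalIntegral_h3_le (t z v a b : ℝ) :
    |∫ s in a..b, h3 t (s - v) z| ≤ 3 := by
  refine le_trans ?_ (spaceInt_le t z)
  have hi : Integrable fun s => h3 t (s - v) z := (integrable_h3_space t z).comp_sub_right v
  refine (intervalIntegral.norm_integral_le_integral_norm_uIoc
    (f := fun s => h3 t (s - v) z)).trans ?_
  rw [spaceInt, ← integral_sub_right_eq_self (fun s => h3 t s z) v]
  simp_rw [Real.norm_of_nonneg (h3_nonneg _ _ _)]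
  exact setIntegral_le_integral hi (ae_of_all _ fun _ => h3_nonneg _ _ _)

theorem intervalIntegrable_of_abs_le {f : ℝ → ℝ} (hf : Measurable f) {C : ℝ} (h : ∀ t, |f t| ≤ C)
    (a b : ℝ) : IntervalIntegrable f volume a b :=
  (intervalIntegrable_const (c := C)).mono_fun' hf.aestronglyMeasurable (ae_of_all _ h)

theorem measurable_intervalIntegral_h3 (u z v a b : ℝ) :
    Measurable fun t => ∫ s in a..b, h3 (t - u) (s - v) z :=
  measurable_intervalIntegral (f := fun t s => h3 (t - u) (s - v) z) (by fun_prop) a b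

theorem intervalIntegrable_intervalIntegral_h3 (u z v a b c d : ℝ) :
    IntervalIntegrable (fun t => ∫ s in a..b, h3 (t - u) (s - v) z) volume c d :=
  intervalIntegrable_of_abs_le (measurable_intervalIntegral_h3 u z v a b)
    (fun t => abs_intervalIntegral_h3_le (t - u) z v a b) c d

theorem intervalIntegrable_spaceInt (u z a b : ℝ) :
    IntervalIntegrable (fun t => spaceInt (t - u) z) volume a b :=
  intervalIntegrable_of_abs_le (by fun_prop) (C := 3)
    (fun t => by rw [abs_of_nonneg (spaceInt_nonneg _ _)]; exact spaceInt_le _ _) a b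

theorem timeInt_of_nonpos {z : ℝ} (hz : z ≤ 0) (s : ℝ) : timeInt s z = 0 := by
  simp [timeInt, h3_of_height_nonpos hz]

theorem intervalIntegrable_timeInt (v z a b : ℝ) :
    IntervalIntegrable (fun s => timeInt (v - s) z) volume a b := by
  by_cases hz : 0 < z
  · refine intervalIntegrable_of_abs_le (by fun_prop) (C := z ^ (-(1 / 2) : ℝ))
      (fun t => ?_) a b
    rw [abs_of_nonneg (timeInt_nonneg _ _)]; exact timeInt_le hz _
  · simp [timeInt_of_nonpos (not_lt.1 hz)]

theorem incKer_nonneg {u v x y : ℝ} (hux : u ≤ x) (hvy : v ≤ y) (p : ℝ × ℝ × ℝ) :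
    0 ≤ incKer α β γ u v x y p := by
  have h1 : ∀ (s : Set ℝ) (t : ℝ), 0 ≤ s.indicator (1 : ℝ → ℝ) t := fun s t =>
    Set.indicator_nonneg (fun _ _ => zero_le_one) t
  unfold incKer
  split_ifs
  · exact intervalIntegral.integral_nonneg hux fun t _ => intervalIntegral_h3_nonneg hvy
  · exact mul_nonneg (h1 _ _)
      (intervalIntegral.integral_nonneg hux fun t _ => spaceInt_nonneg _ _)
  · exact mul_nonneg (h1 _ _)
      (intervalIntegral.integral_nonneg hvy fun t _ => timeInt_nonneg _ _)
  · exact mul_nonneg (sub_nonneg.2 hvy)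
      (intervalIntegral.integral_nonneg hux fun t _ => h3_nonneg _ _ _)

/-- Open intervals lose the common endpoint `b`, which is why `F3` is additive over rectangles only
off a null set. -/
theorem indicator_Ioo_sub {a b c : ℝ} (hab : a ≤ b) (hbc : b ≤ c) {t : ℝ} (ht : t ≠ b) :
    (Set.Ioo a c).indicator (1 : ℝ → ℝ) t - (Set.Ioo a b).indicator 1 t =
      (Set.Ioo b c).indicator 1 t := by
  simp only [Set.indicator_apply, Set.mem_Ioo, Pi.one_apply]
  rcases lt_or_gt_of_ne ht with h | h
  · have h1 : ¬ (b < t) := not_lt.2 h.le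
    have h2 : t < c := h.trans_le hbc
    simp [h, h1, h2]
  · have h1 : ¬ (t < b) := not_lt.2 h.le
    have h2 : a < t := hab.trans_lt h
    simp [h, h1, h2]

theorem ae_control3_of_ae_volume {φ₁ : ℝ} {Q : ℝ × ℝ × ℝ → Prop} (h : ∀ᵐ p, Q p) :
    ∀ᵐ p ∂(control3 φ₁ β), Q p :=
  (withDensity_absolutelyContinuous _ _).ae_le h

theorem ae_fst_ne (c : ℝ) : ∀ᵐ p : ℝ × ℝ × ℝ, p.1 ≠ c := by
  have h : ∀ᵐ t : ℝ, t ≠ c := by simp [ae_iff, measure_singleton]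
  exact Measure.quasiMeasurePreserving_fst.ae h

theorem ae_snd_fst_ne (c : ℝ) : ∀ᵐ p : ℝ × ℝ × ℝ, p.2.1 ≠ c := by
  have h : ∀ᵐ t : ℝ, t ≠ c := by simp [ae_iff, measure_singleton]
  exact (Measure.quasiMeasurePreserving_fst.comp Measure.quasiMeasurePreserving_snd).ae h

/-- Interval integrals and, off the planes where the first coordinate is `u` or the second is `v`,
indicators are additive; the four corner terms combine into one kernel. -/
theorem F3_incr_ae_eq (φ₁ : ℝ) (hexc : ¬ (γ < 1 / 2 ∧ β = (α - 1) / 2)) {u v x y : ℝ} (hu : 0 ≤ u)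
    (hv : 0 ≤ v) (hux : u ≤ x) (hvy : v ≤ y) :
    (fun p => F3 α β γ x y p - F3 α β γ u y p - F3 α β γ x v p + F3 α β γ u v p)
      =ᵐ[control3 φ₁ β] incKer α β γ u v x y := by
  filter_upwards [ae_control3_of_ae_volume (ae_fst_ne u), ae_control3_of_ae_volume
    (ae_snd_fst_ne v)] with p hp1 hp2
  rcases lt_trichotomy γ (1 / 2) with hγ | hγ | hγ
  · rcases lt_trichotomy β ((α - 1) / 2) with hβ | hβ | hβ
    · simp only [F3_eq_lt_lt hγ hβ, incKer_eq_lt_lt hγ hβ]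
      rw [← intervalIntegral.integral_interval_sub_left
        (intervalIntegrable_h3_time p.2.1 p.2.2 p.1 0 x)
        (intervalIntegrable_h3_time p.2.1 p.2.2 p.1 0 u)]
      ring
    · exact (hexc ⟨hγ, hβ⟩).elim
    · simp only [F3_eq_lt_gt hγ hβ, incKer_eq_lt_gt hγ hβ]
      rw [← intervalIntegral.integral_interval_sub_left
        (intervalIntegrable_timeInt p.2.1 p.2.2 0 y)
        (intervalIntegrable_timeInt p.2.1 p.2.2 0 v), ← indicator_Ioo_sub hu hux hp1]
      ring
  · simp only [F3_eq_half hγ, incKer_eq_half hγ]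
    have h1 : ∀ t, ∫ s in v..y, h3 (t - p.1) (s - p.2.1) p.2.2 =
        (∫ s in (0 : ℝ)..y, h3 (t - p.1) (s - p.2.1) p.2.2) -
        ∫ s in (0 : ℝ)..v, h3 (t - p.1) (s - p.2.1) p.2.2 := fun t =>
      (intervalIntegral.integral_interval_sub_left (intervalIntegrable_h3_space _ _ _ _ _)
        (intervalIntegrable_h3_space _ _ _ _ _)).symm
    have hi := intervalIntegrable_intervalIntegral_h3 p.1 p.2.2 p.2.1 0
    simp_rw [h1]
    rw [intervalIntegral.integral_sub (hi y u x) (hi v u x),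
      ← intervalIntegral.integral_interval_sub_left (hi y 0 x) (hi y 0 u),
      ← intervalIntegral.integral_interval_sub_left (hi v 0 x) (hi v 0 u)]
    ring
  · simp only [F3_eq_gt hγ, incKer_eq_gt hγ]
    rw [← intervalIntegral.integral_interval_sub_left
      (intervalIntegrable_spaceInt p.1 p.2.2 0 x)
      (intervalIntegrable_spaceInt p.1 p.2.2 0 u), ← indicator_Ioo_sub hv hvy hp2]
    ring

/-- The translation of the plane that corresponds to a translation of rectangles by `(u, v)`. -/
noncomputable def planeShift (α β γ u v : ℝ) : ℝ × ℝ × ℝ :=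
  (u, if γ < 1 / 2 ∧ β < (α - 1) / 2 then 0 else v, 0)

/-- A change of variables in the interval integrals moves the shift onto the point. For `γ < 1/2`
and `β < (α-1)/2` the kernel sees `v` and `y` only through `y - v`, so the second coordinate of the
point must stay fixed. -/
theorem incKer_shift (hexc : ¬ (γ < 1 / 2 ∧ β = (α - 1) / 2)) (u v x y a b : ℝ) (p : ℝ × ℝ × ℝ) :
    incKer α β γ (u + a) (v + b) (x + a) (y + b) (p + planeShift α β γ a b) =
      incKer α β γ u v x y p := by
  have hind : ∀ c d e t : ℝ, (Set.Ioo (c + e) (d + e)).indicator (1 : ℝ → ℝ) (t + e) =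
      (Set.Ioo c d).indicator 1 t := by
    intro c d e t
    simp [Set.indicator_apply]
  rcases lt_trichotomy γ (1 / 2) with hγ | hγ | hγ
  · rcases lt_trichotomy β ((α - 1) / 2) with hβ | hβ | hβ
    · simp only [incKer_eq_lt_lt hγ hβ, planeShift, hγ, hβ, and_self, if_true, Prod.fst_add,
        Prod.snd_add, add_zero]
      rw [← intervalIntegral.integral_comp_add_right]
      simp only [add_sub_add_right_eq_sub]
    · exact (hexc ⟨hγ, hβ⟩).elim
    · simp only [incKer_eq_lt_gt hγ hβ, planeShift, hβ.le.not_gt, and_false, if_false, Prod.fst_add,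
        Prod.snd_add, add_zero]
      rw [← intervalIntegral.integral_comp_add_right]
      simp only [add_sub_add_right_eq_sub, hind]
  · have hs : planeShift α β γ a b = (a, b, 0) := by simp [planeShift, hγ]
    simp only [incKer_eq_half hγ, hs, Prod.fst_add, Prod.snd_add, add_zero]
    rw [← intervalIntegral.integral_comp_add_right]
    refine intervalIntegral.integral_congr fun t _ => ?_
    rw [← intervalIntegral.integral_comp_add_right]
    simp only [add_sub_add_right_eq_sub]
  · simp only [incKer_eq_gt hγ, planeShift, hγ.le.not_gt, false_and, if_false, Prod.fst_add,
        Prod.snd_add, add_zero]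
    rw [← intervalIntegral.integral_comp_add_right]
    simp only [add_sub_add_right_eq_sub, hind]

/-- Lebesgue measure is translation invariant, and the shift leaves the height, hence the density,
unchanged. -/
theorem lintegral_control3_add (φ₁ : ℝ) {g : ℝ × ℝ × ℝ → ENNReal} (hg : Measurable g) (a b : ℝ) :
    ∫⁻ p, g (p + planeShift α β γ a b) ∂(control3 φ₁ β) = ∫⁻ p, g p ∂(control3 φ₁ β) := by
  have : (volume : Measure (ℝ × ℝ × ℝ)).IsAddLeftInvariant :=
    (Measure.prod.instIsAddLeftInvariant : ((volume : Measure ℝ).prod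
      ((volume : Measure ℝ).prod (volume : Measure ℝ))).IsAddLeftInvariant)
  rw [lintegral_control3 _ _ (by fun_prop), lintegral_control3 _ _ hg,
    ← lintegral_add_left_eq_self (fun p => density3 φ₁ β p * g p) (planeShift α β γ a b)]
  refine lintegral_congr fun p => ?_
  simp [density3, planeShift, add_comm]

theorem lpn_comp_planeShift (φ₁ : ℝ) (hα : 0 < α) {f : ℝ × ℝ × ℝ → ℝ} (hf : Measurable f)
    (a b : ℝ) : lpn (control3 φ₁ β) α (fun p => f (p + planeShift α β γ a b)) =
      lpn (control3 φ₁ β) α f := by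
  rw [← Real.rpow_left_inj (lpn_nonneg _) (lpn_nonneg _) hα.ne', lpn_rpow hα, lpn_rpow hα,
    lintegral_control3_add φ₁ (g := fun p => ‖f p‖ₑ ^ α) (by fun_prop)]

theorem measurable_incKer (u v x y : ℝ) : Measurable (incKer α β γ u v x y) := by
  unfold incKer
  split_ifs
  · refine measurable_intervalIntegral (f := fun (p : ℝ × ℝ × ℝ) t =>
      ∫ s in v..y, h3 (t - p.1) (s - p.2.1) p.2.2) ?_ _ _
    exact measurable_intervalIntegral (f := fun (q : (ℝ × ℝ × ℝ) × ℝ) s =>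
      h3 (q.2 - q.1.1) (s - q.1.2.1) q.1.2.2) (by fun_prop) _ _
  · exact ((measurable_one.indicator measurableSet_Ioo).comp measurable_snd.fst).mul
      (measurable_intervalIntegral (f := fun (p : ℝ × ℝ × ℝ) t => spaceInt (t - p.1) p.2.2)
        (by fun_prop) _ _)
  · exact ((measurable_one.indicator measurableSet_Ioo).comp measurable_fst).mul
      (measurable_intervalIntegral (f := fun (p : ℝ × ℝ × ℝ) s => timeInt (p.2.1 - s) p.2.2)
        (by fun_prop) _ _)
  · exact (measurable_intervalIntegral (f := fun (p : ℝ × ℝ × ℝ) t => h3 (t - p.1) p.2.1 p.2.2)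
      (by fun_prop) _ _).const_mul _

/-! ### Scaling -/

/-- Parabolic scaling: `z t` and `s² / t` are unchanged, and only the prefactor `t^(-1/2)`
contributes `r⁻¹`. -/
theorem h3_scale {r : ℝ} (hr : 0 < r) (t s z : ℝ) :
    h3 (r ^ 2 * t) (r * s) (r⁻¹ ^ 2 * z) = r⁻¹ * h3 t s z := by
  unfold h3
  have h1 : 0 < r ^ 2 * t ∧ 0 < r⁻¹ ^ 2 * z ↔ 0 < t ∧ 0 < z := by
    rw [mul_pos_iff_of_pos_left (by positivity), mul_pos_iff_of_pos_left (by positivity)]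
  simp only [h1]
  split_ifs with h
  · have h2 : Real.sqrt (Real.pi * (r ^ 2 * t)) = r * Real.sqrt (Real.pi * t) := by
      rw [show Real.pi * (r ^ 2 * t) = r ^ 2 * (Real.pi * t) by ring, Real.sqrt_mul (by positivity),
        Real.sqrt_sq hr.le]
    have h3 : -3 * (r⁻¹ ^ 2 * z) * (r ^ 2 * t) - (r * s) ^ 2 / (4 * (r ^ 2 * t)) =
        -3 * z * t - s ^ 2 / (4 * t) := by
      have := h.1.ne'
      field_simp
    have := h.1
    rw [h2, h3]
    field_simp
  · simp

theorem spaceInt_scale {r : ℝ} (hr : 0 < r) (t z : ℝ) :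
    spaceInt (r ^ 2 * t) (r⁻¹ ^ 2 * z) = spaceInt t z := by
  have h := Measure.integral_comp_mul_left (fun w => h3 (r ^ 2 * t) w (r⁻¹ ^ 2 * z)) r
  simp only [h3_scale hr] at h
  rw [integral_const_mul, abs_of_pos (inv_pos.2 hr), smul_eq_mul] at h
  exact (mul_left_cancel₀ (inv_pos.2 hr).ne' h).symm

theorem timeInt_scale {r : ℝ} (hr : 0 < r) (s z : ℝ) :
    timeInt (r * s) (r⁻¹ ^ 2 * z) = r * timeInt s z := by
  have h := Measure.integral_comp_mul_left (fun w => h3 w (r * s) (r⁻¹ ^ 2 * z)) (r ^ 2)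
  simp only [h3_scale hr] at h
  rw [integral_const_mul, abs_of_pos (by positivity), smul_eq_mul] at h
  change r⁻¹ * timeInt s z = (r ^ 2)⁻¹ * timeInt (r * s) (r⁻¹ ^ 2 * z) at h
  generalize timeInt (r * s) (r⁻¹ ^ 2 * z) = q at h ⊢
  field_simp at h
  exact h.symm

theorem indicator_Ioo_scale {r : ℝ} (hr : 0 < r) (c t : ℝ) :
    (Set.Ioo 0 (r * c)).indicator (1 : ℝ → ℝ) (r * t) = (Set.Ioo 0 c).indicator 1 t := by
  simp [Set.indicator_apply, hr]

/-- The integrand is homogeneous under diagonal scalings of the space. -/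
theorem exists_F3_scale (hα : 0 < α) (hexc : ¬ (γ < 1 / 2 ∧ β = (α - 1) / 2)) :
    ∃ b c κ : ℝ, H3 α β γ * α = κ * α + 1 + b + c * (1 + β) ∧
      ∀ r : ℝ, 0 < r → ∀ x y u v z : ℝ,
        F3 α β γ (r * x) (r ^ γ * y) (r * u, r ^ b * v, r ^ c * z) =
          r ^ κ * F3 α β γ x y (u, v, z) := by
  have hsq : ∀ r : ℝ, 0 < r → (r ^ (1 / 2 : ℝ)) ^ 2 = r := fun r hr => by
    rw [← Real.rpow_natCast, ← Real.rpow_mul hr.le]; norm_num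
  have hsqi : ∀ r : ℝ, 0 < r → (r ^ (1 / 2 : ℝ))⁻¹ ^ 2 = r ^ (-1 : ℝ) := fun r hr => by
    rw [inv_pow, hsq r hr, Real.rpow_neg_one]
  rcases lt_trichotomy γ (1 / 2) with hγ | hγ | hγ
  · rcases lt_trichotomy β ((α - 1) / 2) with hβ | hβ | hβ
    -- Parabolic scaling with ratio `r^(1/2)`: `y` contributes `r^γ`, the time integral `r`, and
    -- `h3` contributes `r^(-1/2)`.
    · refine ⟨1 / 2, -1, γ + 1 / 2, ?_, fun r hr x y u v z => ?_⟩
      · rw [H3, if_neg hγ.not_ge, if_neg hβ.le.not_gt, div_mul_cancel₀ _ hα.ne']; ring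
      · have hρ : 0 < r ^ (1 / 2 : ℝ) := Real.rpow_pos_of_pos hr _
        simp only [F3_eq_lt_lt hγ hβ]
        rw [show ∫ t in (0 : ℝ)..r * x, h3 (t - r * u) (r ^ (1 / 2 : ℝ) * v) (r ^ (-1 : ℝ) * z) =
          r * ∫ t in (0 : ℝ)..x, h3 (r * t - r * u) (r ^ (1 / 2 : ℝ) * v) (r ^ (-1 : ℝ) * z) by
          rw [intervalIntegral.mul_integral_comp_mul_left (f := fun t => h3 (t - r * u) _ _),
            mul_zero]]
        have h1 : ∀ t, h3 (r * t - r * u) (r ^ (1 / 2 : ℝ) * v) (r ^ (-1 : ℝ) * z) =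
            (r ^ (1 / 2 : ℝ))⁻¹ * h3 (t - u) v z := fun t => by
          rw [← h3_scale hρ, hsq r hr, hsqi r hr, mul_sub]
        simp_rw [h1]
        rw [intervalIntegral.integral_const_mul, Real.rpow_add hr]
        nth_rw 2 [← hsq r hr]
        field_simp
    · exact (hexc ⟨hγ, hβ⟩).elim
    -- Here the space variable dictates the ratio `r^γ`; the space integral and `timeInt` contribute
    -- `r^γ` each, and `u` is scaled separately by the indicator.
    · refine ⟨γ, -2 * γ, 2 * γ, ?_, fun r hr x y u v z => ?_⟩
      · rw [H3, if_neg hγ.not_ge, if_pos hβ, div_mul_cancel₀ _ hα.ne']; ring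
      · have hρ : 0 < r ^ γ := Real.rpow_pos_of_pos hr _
        have e1 : r ^ (2 * γ) = r ^ γ * r ^ γ := by rw [← Real.rpow_add hr]; congr 1; ring
        have e2 : r ^ (-2 * γ) = (r ^ γ)⁻¹ ^ 2 := by
          rw [← Real.rpow_neg hr.le, sq, ← Real.rpow_add hr]; congr 1; ring
        simp only [F3_eq_lt_gt hγ hβ]
        rw [show ∫ s in (0 : ℝ)..r ^ γ * y, timeInt (r ^ γ * v - s) (r ^ (-2 * γ) * z) =
          r ^ γ * ∫ s in (0 : ℝ)..y, timeInt (r ^ γ * v - r ^ γ * s) (r ^ (-2 * γ) * z) by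
          rw [intervalIntegral.mul_integral_comp_mul_left (f := fun s => timeInt (r ^ γ * v - s) _),
            mul_zero]]
        have h1 : ∀ s, timeInt (r ^ γ * v - r ^ γ * s) (r ^ (-2 * γ) * z) =
            r ^ γ * timeInt (v - s) z := fun s => by
          rw [← timeInt_scale hρ, e2, mul_sub]
        simp_rw [h1]
        rw [intervalIntegral.integral_const_mul, indicator_Ioo_scale hr, e1]
        ring
  -- With ratio `r^(1/2)` the factor `r^(1/2)` of the space integral cancels that of `h3`, so only
  -- the factor `r` of the time integral is left.
  · refine ⟨γ, -1, 1, ?_, fun r hr x y u v z => ?_⟩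
    · rw [H3, if_pos hγ.ge, div_mul_cancel₀ _ hα.ne']; ring
    · have hρ : 0 < r ^ (1 / 2 : ℝ) := Real.rpow_pos_of_pos hr _
      simp only [F3_eq_half hγ]
      rw [hγ]
      rw [show ∫ t in (0 : ℝ)..r * x, ∫ s in (0 : ℝ)..r ^ (1 / 2 : ℝ) * y,
          h3 (t - r * u) (s - r ^ (1 / 2 : ℝ) * v) (r ^ (-1 : ℝ) * z) =
        r * ∫ t in (0 : ℝ)..x, ∫ s in (0 : ℝ)..r ^ (1 / 2 : ℝ) * y,
          h3 (r * t - r * u) (s - r ^ (1 / 2 : ℝ) * v) (r ^ (-1 : ℝ) * z) by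
        rw [intervalIntegral.mul_integral_comp_mul_left (f := fun t =>
            ∫ s in (0 : ℝ)..r ^ (1 / 2 : ℝ) * y, h3 (t - r * u) (s - _) _), mul_zero]]
      have h1 : ∀ t, ∫ s in (0 : ℝ)..r ^ (1 / 2 : ℝ) * y,
          h3 (r * t - r * u) (s - r ^ (1 / 2 : ℝ) * v) (r ^ (-1 : ℝ) * z) =
          ∫ s in (0 : ℝ)..y, h3 (t - u) (s - v) z := fun t => by
        have h2 := intervalIntegral.mul_integral_comp_mul_left (a := 0) (b := y)
          (c := r ^ (1 / 2 : ℝ)) (f := fun s =>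
            h3 (r * t - r * u) (s - r ^ (1 / 2 : ℝ) * v) (r ^ (-1 : ℝ) * z))
        rw [mul_zero] at h2
        rw [← h2]
        have h3 : ∀ s, h3 (r * t - r * u) (r ^ (1 / 2 : ℝ) * s - r ^ (1 / 2 : ℝ) * v)
            (r ^ (-1 : ℝ) * z) = (r ^ (1 / 2 : ℝ))⁻¹ * h3 (t - u) (s - v) z := fun s => by
          rw [← h3_scale hρ, hsq r hr, hsqi r hr, mul_sub, mul_sub]
        simp_rw [h3]
        rw [intervalIntegral.integral_const_mul, mul_inv_cancel_left₀ hρ.ne']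
      simp_rw [h1]
      rw [Real.rpow_one]
  -- `spaceInt` is invariant under the parabolic scaling with ratio `r^(1/2)`. The coordinate `v`
  -- enters only through the indicator, so it may scale like `y`, by `r^γ`.
  · refine ⟨γ, -1, 1, ?_, fun r hr x y u v z => ?_⟩
    · rw [H3, if_pos hγ.le, div_mul_cancel₀ _ hα.ne']; ring
    · have hρ : 0 < r ^ (1 / 2 : ℝ) := Real.rpow_pos_of_pos hr _
      simp only [F3_eq_gt hγ]
      rw [show ∫ t in (0 : ℝ)..r * x, spaceInt (t - r * u) (r ^ (-1 : ℝ) * z) =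
        r * ∫ t in (0 : ℝ)..x, spaceInt (r * t - r * u) (r ^ (-1 : ℝ) * z) by
        rw [intervalIntegral.mul_integral_comp_mul_left (f := fun t => spaceInt (t - r * u) _),
          mul_zero]]
      have h1 : ∀ t, spaceInt (r * t - r * u) (r ^ (-1 : ℝ) * z) = spaceInt (t - u) z := fun t => by
        rw [← spaceInt_scale hρ (t - u) z, hsq r hr, hsqi r hr, mul_sub]
      simp_rw [h1]
      rw [indicator_Ioo_scale (Real.rpow_pos_of_pos hr _), Real.rpow_one]
      ring

theorem lintegral_comp_mul {a : ℝ} (ha : 0 < a) {g : ℝ → ENNReal} (hg : Measurable g) :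
    ∫⁻ x, g (a * x) = ENNReal.ofReal a⁻¹ * ∫⁻ x, g x := by
  rw [← lintegral_map hg (measurable_const_mul a), Real.map_volume_mul_left ha.ne',
    lintegral_smul_measure, abs_of_pos (inv_pos.2 ha), smul_eq_mul]

/-- The Jacobian `a b c` and the factor `c^β` of the density combine to `a b c^(1+β)`. -/
theorem lintegral_control3_mul (φ₁ : ℝ) {g : ℝ × ℝ × ℝ → ENNReal} (hg : Measurable g) {a b c : ℝ}
    (ha : 0 < a) (hb : 0 < b) (hc : 0 < c) :
    ∫⁻ p, g p ∂(control3 φ₁ β) = ENNReal.ofReal (a * b * c ^ (1 + β)) *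
      ∫⁻ p, g (a * p.1, b * p.2.1, c * p.2.2) ∂(control3 φ₁ β) := by
  have hd := measurable_density3 φ₁ β
  have h0 : ∫⁻ p : ℝ × ℝ × ℝ, density3 φ₁ β (a * p.1, b * p.2.1, c * p.2.2) *
      g (a * p.1, b * p.2.1, c * p.2.2) =
      ENNReal.ofReal (a⁻¹ * b⁻¹ * c⁻¹) * ∫⁻ p, density3 φ₁ β p * g p := by
    rw [lintegral_triple (by fun_prop), lintegral_triple (by fun_prop)]
    have hm1 : Measurable fun q : ℝ × ℝ => ∫⁻ v, density3 φ₁ β (q.1, v, q.2) * g (q.1, v, q.2) := by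
      have : Measurable fun q : (ℝ × ℝ) × ℝ =>
        density3 φ₁ β (q.1.1, q.2, q.1.2) * g (q.1.1, q.2, q.1.2) := by fun_prop
      exact this.lintegral_prod_right'
    have hm2 : Measurable fun z => ∫⁻ u, ∫⁻ v, density3 φ₁ β (u, v, z) * g (u, v, z) := by
      have : Measurable fun q : ℝ × ℝ =>
        ∫⁻ v, density3 φ₁ β (q.2, v, q.1) * g (q.2, v, q.1) := hm1.comp measurable_swap
      exact this.lintegral_prod_right'
    have h1 : ∀ u z, ∫⁻ v, density3 φ₁ β (a * u, b * v, c * z) * g (a * u, b * v, c * z) =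
        ENNReal.ofReal b⁻¹ * ∫⁻ v, density3 φ₁ β (a * u, v, c * z) * g (a * u, v, c * z) :=
      fun u z => lintegral_comp_mul hb
        (g := fun v => density3 φ₁ β (a * u, v, c * z) * g (a * u, v, c * z)) (by fun_prop)
    have h2 : ∀ z, ∫⁻ u, ∫⁻ v, density3 φ₁ β (a * u, b * v, c * z) * g (a * u, b * v, c * z) =
        ENNReal.ofReal b⁻¹ * (ENNReal.ofReal a⁻¹ *
          ∫⁻ u, ∫⁻ v, density3 φ₁ β (u, v, c * z) * g (u, v, c * z)) := fun z => by
      rw [lintegral_congr fun u => h1 u z, lintegral_const_mul, lintegral_comp_mul ha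
        (g := fun u => ∫⁻ v, density3 φ₁ β (u, v, c * z) * g (u, v, c * z))]
      · exact hm1.comp (by fun_prop : Measurable fun u : ℝ => (u, c * z))
      · exact hm1.comp (by fun_prop : Measurable fun u : ℝ => (a * u, c * z))
    have hm3 := hm2.comp (measurable_const_mul c)
    simp only [Function.comp_def] at hm3
    rw [lintegral_congr h2, lintegral_const_mul _ (hm3.const_mul _),
      lintegral_const_mul _ hm3, lintegral_comp_mul hc hm2,
      ENNReal.ofReal_mul (by positivity), ENNReal.ofReal_mul (by positivity)]
    ring
  have h1 : ∀ p : ℝ × ℝ × ℝ, density3 φ₁ β (a * p.1, b * p.2.1, c * p.2.2) =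
      ENNReal.ofReal (c ^ β) * density3 φ₁ β p := by
    intro p
    simp only [density3, mul_pos_iff_of_pos_left hc]
    split_ifs with hz
    · rw [← ENNReal.ofReal_mul (by positivity), Real.mul_rpow hc.le hz.le]
      congr 1; ring
    · simp
  simp_rw [h1, mul_assoc] at h0
  rw [lintegral_const_mul _ (by fun_prop)] at h0
  rw [lintegral_control3 _ _ hg, lintegral_control3 _ _ (by fun_prop)]
  have h2 : ENNReal.ofReal (a * b * c ^ (1 + β)) =
      ENNReal.ofReal (a * b * c) * ENNReal.ofReal (c ^ β) := by
    rw [← ENNReal.ofReal_mul (by positivity), Real.rpow_add hc, Real.rpow_one]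
    congr 1; ring
  rw [h2, mul_assoc, h0, ← mul_assoc, ← ENNReal.ofReal_mul (by positivity),
    show a * b * c * (a⁻¹ * (b⁻¹ * c⁻¹)) = 1 by field_simp, ENNReal.ofReal_one, one_mul]

theorem lpn_scale (φ₁ : ℝ) (hα : 0 < α) {f g : ℝ × ℝ × ℝ → ℝ} (hf : Measurable f)
    {r b c κ H : ℝ} (hr : 0 < r) (hH : H * α = κ * α + 1 + b + c * (1 + β))
    (h : ∀ u v z, f (r * u, r ^ b * v, r ^ c * z) = r ^ κ * g (u, v, z)) :
    lpn (control3 φ₁ β) α f = r ^ H * lpn (control3 φ₁ β) α g := by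
  have hb : 0 < r ^ b := Real.rpow_pos_of_pos hr _
  have hc : 0 < r ^ c := Real.rpow_pos_of_pos hr _
  have hκ : 0 < r ^ κ := Real.rpow_pos_of_pos hr _
  have hHp : 0 < r ^ H := Real.rpow_pos_of_pos hr _
  rw [← Real.rpow_left_inj (lpn_nonneg _) (mul_nonneg hHp.le (lpn_nonneg _)) hα.ne',
    Real.mul_rpow hHp.le (lpn_nonneg _), lpn_rpow hα,
    lintegral_control3_mul φ₁ (g := fun p => ‖f p‖ₑ ^ α) (by fun_prop) hr hb hc]
  have h1 : (fun p : ℝ × ℝ × ℝ => f (r * p.1, r ^ b * p.2.1, r ^ c * p.2.2)) =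
      fun p => r ^ κ * g p := by
    ext ⟨u, v, z⟩; exact h u v z
  have h2 := lpn_rpow (μ := control3 φ₁ β) hα fun p : ℝ × ℝ × ℝ =>
    f (r * p.1, r ^ b * p.2.1, r ^ c * p.2.2)
  rw [ENNReal.toReal_mul, ← h2, h1, lpn_const_mul, abs_of_pos hκ,
    Real.mul_rpow hκ.le (lpn_nonneg _), ENNReal.toReal_ofReal (by positivity), ← mul_assoc,
    ← Real.rpow_mul hr.le, ← Real.rpow_mul hr.le, ← Real.rpow_mul hr.le, hH]
  congr 1
  nth_rw 1 [← Real.rpow_one r]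
  rw [← Real.rpow_add hr, ← Real.rpow_add hr, ← Real.rpow_add hr]
  congr 1; ring

end Increments

/-! ### The field: existence, stationarity and scaling -/

section Field

variable {Ω : Type*} [MeasurableSpace Ω] {P : Measure Ω} [IsProbabilityMeasure P]
  {φ₁ α β γ : ℝ} {M : Set (ℝ × ℝ × ℝ) → Ω → ℝ} {V : ℝ → ℝ → Ω → ℝ}

theorem IsField3.exists (hφ : 0 < φ₁) (hα : 1 < α) (hβ₀ : 0 < β) (hβ₁ : β < α - 1)
    (hexc : ¬ (γ < 1 / 2 ∧ β = (α - 1) / 2))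
    (hM : IsStableRandomMeasure P (control3 φ₁ β) α M) : ∃ V, IsField3 P φ₁ α β γ M V := by
  classical
  have h : ∀ x y : ℝ, ∃ X : Ω → ℝ, 0 ≤ x → 0 ≤ y →
      IsStableIntegral P (control3 φ₁ β) α M (F3 α β γ x y) X := by
    intro x y
    by_cases hxy : 0 ≤ x ∧ 0 ≤ y
    · obtain ⟨X, hX⟩ := IsStableIntegral.exists hα.le hM
        (memLp_F3 hφ hα hβ₀ hβ₁ hexc hxy.1 hxy.2)
      exact ⟨X, fun _ _ => hX⟩
    · exact ⟨0, fun hx hy => (hxy ⟨hx, hy⟩).elim⟩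
  choose V hV using h
  exact ⟨V, hV⟩

/-- Rectangular increments of the field are integrals of the rectangular increments of `F3`. -/
theorem IsField3.isStableIntegral_incr (hα : 1 ≤ α) (hexc : ¬ (γ < 1 / 2 ∧ β = (α - 1) / 2))
    (hM : IsStableRandomMeasure P (control3 φ₁ β) α M) (hV : IsField3 P φ₁ α β γ M V)
    {u v x y : ℝ} (hu : 0 ≤ u) (hv : 0 ≤ v) (hux : u ≤ x) (hvy : v ≤ y) :
    IsStableIntegral P (control3 φ₁ β) α M (incKer α β γ u v x y) (incr V u v x y) := by
  have hx := hu.trans hux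
  have hy := hv.trans hvy
  have h := ((((hV x y hx hy).linear hα hM (hV u y hu hy) 1 (-1)).linear hα hM
    (hV x v hx hv) 1 (-1)).linear hα hM (hV u v hu hv) 1 1)
  have e : (fun ω => 1 * (1 * (1 * V x y ω + -1 * V u y ω) + -1 * V x v ω) + 1 * V u v ω) =
      incr V u v x y := by
    ext ω; simp only [RF.incr]; ring
  rw [e] at h
  refine h.congr ?_ h.1 ae_eq_rfl
  filter_upwards [F3_incr_ae_eq φ₁ hexc hu hv hux hvy] with p hp
  rw [← hp]; ring

theorem IsField3.isStableIntegral_rectIncr (hα : 1 ≤ α) (hexc : ¬ (γ < 1 / 2 ∧ β = (α - 1) / 2))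
    (hM : IsStableRandomMeasure P (control3 φ₁ β) α M) (hV : IsField3 P φ₁ α β γ M V) (K : Rect) :
    IsStableIntegral P (control3 φ₁ β) α M (incKer α β γ K.u K.v K.x K.y) (rectIncr V K) :=
  hV.isStableIntegral_incr hα hexc hM K.u_nonneg K.v_nonneg K.u_lt_x.le K.v_lt_y.le

theorem IsField3.hasStableFdd (hα : 1 ≤ α) (hM : IsStableRandomMeasure P (control3 φ₁ β) α M)
    (hV : IsField3 P φ₁ α β γ M V) : HasStableFdd P α V := fun _ t ht =>
  IsStableIntegral.isStableLaw hα hM fun i => hV (t i).1 (t i).2 (ht i).1 (ht i).2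

theorem F3_left_zero (y : ℝ) : F3 α β γ 0 y = 0 := by
  ext p
  simp only [F3_eq_incKer, incKer]
  split_ifs <;> simp

theorem F3_right_zero (x : ℝ) : F3 α β γ x 0 = 0 := by
  ext p
  simp only [F3_eq_incKer, incKer]
  split_ifs <;> simp

theorem IsStableIntegral.ae_eq_zero {S : Type*} [MeasurableSpace S] {μ : Measure S}
    {M : Set S → Ω → ℝ} (hα : 1 ≤ α) (hM : IsStableRandomMeasure P μ α M) {X : Ω → ℝ}
    (hX : IsStableIntegral P μ α M 0 X) : X =ᵐ[P] 0 := by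
  have h := hX.hasStableScale hα hM
  simp only [lpn, eLpNorm_zero, ENNReal.toReal_zero] at h
  exact h.ae_eq_zero (by linarith)

theorem IsField3.zero (hα : 1 ≤ α) (hM : IsStableRandomMeasure P (control3 φ₁ β) α M)
    (hV : IsField3 P φ₁ α β γ M V) {x y : ℝ} (hx : 0 ≤ x) (hy : 0 ≤ y) :
    V x 0 =ᵐ[P] 0 ∧ V 0 y =ᵐ[P] 0 := by
  have h1 := hV x 0 hx le_rfl
  have h2 := hV 0 y le_rfl hy
  rw [F3_right_zero] at h1
  rw [F3_left_zero] at h2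
  exact ⟨h1.ae_eq_zero hα hM, h2.ae_eq_zero hα hM⟩

theorem IsField3.stationary (hα : 1 ≤ α) (hexc : ¬ (γ < 1 / 2 ∧ β = (α - 1) / 2))
    (hM : IsStableRandomMeasure P (control3 φ₁ β) α M) (hV : IsField3 P φ₁ α β γ M V) :
    HasStationaryRectIncrements P V := by
  intro u v hu hv n t ht
  refine IsStableIntegral.identDistrib hα hM
    (fun i => hV.isStableIntegral_incr hα hexc hM hu hv (ht i).1 (ht i).2)
    (fun i => hV.isStableIntegral_incr hα hexc hM le_rfl le_rfl (sub_nonneg.2 (ht i).1) (sub_nonneg.2 (ht i).2))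
    fun a => ?_
  -- All kernels are translated by the same vector, independent of `i`, so every linear combination
  -- keeps its norm.
  rw [← lpn_comp_planeShift φ₁ (by linarith) (Finset.measurable_sum _ fun i _ =>
    (measurable_incKer u v (t i).1 (t i).2).const_mul (a i)) u v]
  congr 1
  ext p
  refine Finset.sum_congr rfl fun i _ => ?_
  have := incKer_shift hexc 0 0 ((t i).1 - u) ((t i).2 - v) u v p
  rw [zero_add, zero_add, sub_add_cancel, sub_add_cancel] at this
  rw [this]

theorem H3_pos (hα : 1 < α) (hβ₁ : β < α - 1) (hγ : 0 < γ) : 0 < H3 α β γ := by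
  unfold H3
  split_ifs with h1 h2
  · exact div_pos (by linarith) (by linarith)
  · refine div_pos ?_ (by linarith)
    have : 0 < γ * (α - β) := mul_pos hγ (by linarith)
    linarith
  · refine div_pos ?_ (by linarith)
    have : 0 < α * γ := mul_pos (by linarith) hγ
    linarith

theorem IsField3.operatorScaling (hα : 1 < α) (hβ₁ : β < α - 1) (hγ : 0 < γ)
    (hexc : ¬ (γ < 1 / 2 ∧ β = (α - 1) / 2))
    (hM : IsStableRandomMeasure P (control3 φ₁ β) α M) (hV : IsField3 P φ₁ α β γ M V) :
    IsOperatorScaling P γ (H3 α β γ) V := by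
  have hα0 : 0 < α := by linarith
  refine ⟨hγ, H3_pos hα hβ₁ hγ, fun r hr n t ht => ?_⟩
  have hrγ : 0 < r ^ γ := Real.rpow_pos_of_pos hr _
  have hrH : 0 < r ^ H3 α β γ := Real.rpow_pos_of_pos hr _
  have hY : ∀ i, IsStableIntegral P (control3 φ₁ β) α M
      (fun p => r ^ H3 α β γ * F3 α β γ (t i).1 (t i).2 p)
      (fun ω => r ^ H3 α β γ * V (t i).1 (t i).2 ω) := by
    intro i
    have h := hV _ _ (ht i).1 (ht i).2
    simpa using h.linear hα.le hM h (r ^ H3 α β γ) 0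
  refine IsStableIntegral.identDistrib hα.le hM
    (fun i => hV _ _ (mul_nonneg hr.le (ht i).1) (mul_nonneg hrγ.le (ht i).2)) hY fun a => ?_
  obtain ⟨b, c, κ, hH, hscale⟩ := exists_F3_scale (γ := γ) hα0 hexc
  rw [lpn_scale (g := fun p => ∑ i, a i * F3 α β γ (t i).1 (t i).2 p) φ₁ hα0
    (Finset.measurable_sum _ fun i _ => (measurable_F3 _ _).const_mul (a i)) hr hH]
  · rw [← abs_of_pos hrH, ← lpn_const_mul, abs_of_pos hrH]
    congr 1
    ext p
    rw [Finset.mul_sum]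
    exact Finset.sum_congr rfl fun i _ => by ring
  · intro u v z
    rw [Finset.mul_sum]
    exact Finset.sum_congr rfl fun i _ => by rw [hscale r hr]; ring

end Field

/-! ### Dependence of rectangular increments -/

section Dependence

variable {φ₁ α β γ : ℝ}

theorem intervalIntegral_lt_of_lt_on {f g : ℝ → ℝ} {a b : ℝ} (hf : IntervalIntegrable f volume a b)
    (hg : IntervalIntegrable g volume a b) (h : ∀ t ∈ Set.Ioo a b, f t < g t) (hab : a < b) :
    ∫ t in a..b, f t < ∫ t in a..b, g t := by
  have := intervalIntegral.intervalIntegral_pos_of_pos_on (hg.sub hf)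
    (fun t ht => sub_pos.2 (h t ht)) hab
  rwa [intervalIntegral.integral_sub hg hf, sub_pos] at this

/-- Only times after `u` contribute, and `(max a u, b)` is a nonempty interval of such times. -/
theorem intervalIntegral_sub_pos {k : ℝ → ℝ} {a b u : ℝ} (hab : a < b) (hu : u < b)
    (hk : ∀ t, 0 < t → 0 < k t) (hk0 : ∀ t, 0 ≤ k t)
    (hi : ∀ c d, IntervalIntegrable (fun t => k (t - u)) volume c d) :
    0 < ∫ t in a..b, k (t - u) := by
  have hm : max a u < b := max_lt hab hu
  rw [← intervalIntegral.integral_add_adjacent_intervals (hi a (max a u)) (hi (max a u) b)]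
  refine add_pos_of_nonneg_of_pos
    (intervalIntegral.integral_nonneg (le_max_left _ _) fun t _ => hk0 _) ?_
  exact intervalIntegral.intervalIntegral_pos_of_pos_on (hi _ _)
    (fun t ht => hk _ (sub_pos.2 ((le_max_right _ _).trans_lt ht.1))) hm

theorem intervalIntegral_sub_eq_zero {k : ℝ → ℝ} {a b u : ℝ} (hab : a ≤ b) (hu : b ≤ u)
    (hk : ∀ t, t ≤ 0 → k t = 0) : ∫ t in a..b, k (t - u) = 0 := by
  rw [intervalIntegral.integral_congr (g := fun _ => 0), intervalIntegral.integral_zero]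
  intro t ht
  rw [Set.uIcc_of_le hab] at ht
  exact hk _ (by linarith [ht.2])

theorem intervalIntegral_h3_pos {t z a b : ℝ} (ht : 0 < t) (hz : 0 < z) (v : ℝ) (hab : a < b) :
    0 < ∫ s in a..b, h3 t (s - v) z :=
  intervalIntegral.intervalIntegral_pos_of_pos_on (intervalIntegrable_h3_space t z v a b)
    (fun _ _ => h3_pos ht hz _) hab

theorem incKer_half_pos (hγ : γ = 1 / 2) {u v x y : ℝ} (hux : u < x) (hvy : v < y)
    {a b z : ℝ} (ha : a < x) (hz : 0 < z) : 0 < incKer α β γ u v x y (a, b, z) := by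
  rw [incKer_eq_half hγ]
  exact intervalIntegral_sub_pos (k := fun t => ∫ s in v..y, h3 t (s - b) z) hux ha
    (fun t ht => intervalIntegral_h3_pos ht hz b hvy) (fun t => intervalIntegral_h3_nonneg hvy.le)
    fun c d => intervalIntegrable_intervalIntegral_h3 a z b v y c d

/-- In these regimes `h3` is integrated forward in time from `a`, so a rectangle feels every point
with `a < x`, however far in the past. This unlimited memory is the source of dependence. -/
theorem incKer_pos (h : 1 / 2 ≤ γ ∨ β < (α - 1) / 2) {u v x y : ℝ} (hux : u < x) (hvy : v < y)
    {a b z : ℝ} (ha : a < x) (hb : b ∈ Set.Ioo v y) (hz : 0 < z) :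
    0 < incKer α β γ u v x y (a, b, z) := by
  rcases lt_trichotomy γ (1 / 2) with hγ | hγ | hγ
  · rw [incKer_eq_lt_lt hγ (h.resolve_left hγ.not_ge)]
    exact mul_pos (sub_pos.2 hvy) (intervalIntegral_sub_pos (k := fun t => h3 t b z) hux ha
      (fun t ht => h3_pos ht hz _) (fun t => h3_nonneg _ _ _)
      fun c d => intervalIntegrable_h3_time _ _ _ _ _)
  · exact incKer_half_pos hγ hux hvy ha hz
  · rw [incKer_eq_gt hγ, Set.indicator_of_mem hb, Pi.one_apply, one_mul]
    exact intervalIntegral_sub_pos (k := fun t => spaceInt t z) hux ha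
      (fun t ht => spaceInt_pos ht hz) (fun t => spaceInt_nonneg _ _)
      fun c d => intervalIntegrable_spaceInt _ _ _ _

theorem incKer_eq_zero (h : 1 / 2 ≤ γ ∨ β < (α - 1) / 2) {u v x y : ℝ} (hux : u ≤ x)
    {a : ℝ} (ha : x ≤ a) (b z : ℝ) : incKer α β γ u v x y (a, b, z) = 0 := by
  rcases lt_trichotomy γ (1 / 2) with hγ | hγ | hγ
  · rw [incKer_eq_lt_lt hγ (h.resolve_left hγ.not_ge)]
    rw [intervalIntegral_sub_eq_zero (k := fun t => h3 t b z) hux ha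
      fun t ht => h3_of_nonpos ht _ _, mul_zero]
  · rw [incKer_eq_half hγ]
    exact intervalIntegral_sub_eq_zero (k := fun t => ∫ s in v..y, h3 t (s - b) z) hux ha
      fun t ht => by simp [h3_of_nonpos ht]
  · rw [incKer_eq_gt hγ]
    rw [intervalIntegral_sub_eq_zero (k := fun t => spaceInt t z) hux ha
      fun t ht => spaceInt_of_nonpos ht _, mul_zero]

theorem incKer_lt_gt_pos (hγ : γ < 1 / 2) (hβ : (α - 1) / 2 < β) {u v x y : ℝ} (hvy : v < y)
    {a b z : ℝ} (ha : a ∈ Set.Ioo u x) (hz : 0 < z) : 0 < incKer α β γ u v x y (a, b, z) := by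
  rw [incKer_eq_lt_gt hγ hβ, Set.indicator_of_mem ha, Pi.one_apply, one_mul]
  exact intervalIntegral.intervalIntegral_pos_of_pos_on (intervalIntegrable_timeInt b z v y)
    (fun s _ => timeInt_pos hz _) hvy

/-- The increment kernel increases when the rectangle moves up towards the point. -/
theorem incKer_half_lt (hγ : γ = 1 / 2) {a b z : ℝ} (ha : a < 0) (hb : 2 < b) (hz : 0 < z) :
    incKer α β γ 0 0 1 1 (a, b, z) < incKer α β γ 0 1 1 2 (a, b, z) := by
  rw [incKer_eq_half hγ, incKer_eq_half hγ]
  refine intervalIntegral_lt_of_lt_on (intervalIntegrable_intervalIntegral_h3 a z b 0 1 0 1)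
    (intervalIntegrable_intervalIntegral_h3 a z b 1 2 0 1) (fun t ht => ?_) one_pos
  -- Raising the rectangle by one amounts to lowering the point by one. Since `b > 2` and `s < 1`,
  -- this brings the point closer, and `h3` strictly decreases with distance.
  have h1 : ∫ s in (1 : ℝ)..2, h3 (t - a) (s - b) z = ∫ s in (0 : ℝ)..1, h3 (t - a) (s - (b - 1)) z := by
    have h2 := intervalIntegral.integral_comp_add_right (a := 0) (b := 1)
      (fun s => h3 (t - a) (s - b) z) 1
    rw [zero_add, one_add_one_eq_two] at h2
    rw [← h2]
    refine intervalIntegral.integral_congr fun s _ => ?_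
    congr 1; ring
  dsimp only
  rw [h1]
  refine intervalIntegral_lt_of_lt_on (intervalIntegrable_h3_space _ _ _ _ _)
    (intervalIntegrable_h3_space _ _ _ _ _) (fun s hs => ?_) one_pos
  refine h3_lt_h3 (by linarith [ht.1]) hz ?_
  rw [abs_of_neg (by linarith [hs.2]), abs_of_neg (by linarith [hs.2])]
  linarith

theorem incKer_lt_gt_lt (hγ : γ < 1 / 2) (hβ : (α - 1) / 2 < β) {a b z : ℝ}
    (ha : a ∈ Set.Ioo (0 : ℝ) 1) (hb : 2 < b) (hz : 0 < z) :
    incKer α β γ 0 0 1 1 (a, b, z) < incKer α β γ 0 1 1 2 (a, b, z) := by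
  rw [incKer_eq_lt_gt hγ hβ, incKer_eq_lt_gt hγ hβ, Set.indicator_of_mem ha, Pi.one_apply, one_mul,
    one_mul]
  have h1 : ∫ s in (1 : ℝ)..2, timeInt (b - s) z = ∫ s in (0 : ℝ)..1, timeInt (b - 1 - s) z := by
    have h2 := intervalIntegral.integral_comp_add_right (a := 0) (b := 1)
      (fun s => timeInt (b - s) z) 1
    rw [zero_add, one_add_one_eq_two] at h2
    rw [← h2]
    refine intervalIntegral.integral_congr fun s _ => ?_
    congr 1; ring
  dsimp only
  rw [h1]
  refine intervalIntegral_lt_of_lt_on (intervalIntegrable_timeInt _ _ _ _)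
    (intervalIntegrable_timeInt _ _ _ _) (fun s hs => ?_) one_pos
  refine timeInt_lt hz ?_
  rw [abs_of_pos (by linarith [hs.2]), abs_of_pos (by linarith [hs.2])]
  linarith

/-- A property that holds almost everywhere holds at some point of each box. -/
theorem exists_of_ae_control3 (hφ : 0 < φ₁) {Q : ℝ × ℝ × ℝ → Prop}
    (h : ∀ᵐ p ∂(control3 φ₁ β), Q p) {a b c d : ℝ} (hab : a < b) (hcd : c < d) :
    ∃ u ∈ Set.Ioo a b, ∃ v ∈ Set.Ioo c d, ∃ z, 0 < z ∧ Q (u, v, z) := by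
  rw [control3_eq, ae_withDensity_iff (measurable_density3 φ₁ β)] at h
  by_contra! hc
  have hsub : Set.Ioo a b ×ˢ (Set.Ioo c d ×ˢ Set.Ioo (0 : ℝ) 1) ⊆
      {p | ¬ (density3 φ₁ β p ≠ 0 → Q p)} := by
    rintro ⟨u, v, z⟩ ⟨hu, hv, hz⟩
    simp only [Set.mem_ofPred_eq, Classical.not_imp]
    refine ⟨?_, hc u hu v hv z hz.1⟩
    have hz0 : 0 < z := hz.1
    have : 0 < φ₁ * z ^ β := by positivity
    simp [density3, hz0, this]
  have h0 := measure_mono_null hsub (ae_iff.1 h)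
  rw [Measure.volume_eq_prod, Measure.prod_prod, Measure.volume_eq_prod, Measure.prod_prod,
    Real.volume_Ioo, Real.volume_Ioo, Real.volume_Ioo] at h0
  simp at h0
  rcases h0 with h0 | h0 <;> linarith

/-! ### Dependence, independence and invariance of the increments of the field -/

variable {Ω : Type*} [MeasurableSpace Ω] {P : Measure Ω} [IsProbabilityMeasure P]
  {M : Set (ℝ × ℝ × ℝ) → Ω → ℝ} {V : ℝ → ℝ → Ω → ℝ}

theorem IsField3.not_indepFun (hφ : 0 < φ₁) (hα : 1 < α)
    (hexc : ¬ (γ < 1 / 2 ∧ β = (α - 1) / 2)) (hM : IsStableRandomMeasure P (control3 φ₁ β) α M)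
    (hV : IsField3 P φ₁ α β γ M V) {K K' : Rect} {a b c d : ℝ} (hab : a < b) (hcd : c < d)
    (h : ∀ s ∈ Set.Ioo a b, ∀ t ∈ Set.Ioo c d, ∀ z, 0 < z →
      0 < incKer α β γ K.u K.v K.x K.y (s, t, z) ∧ 0 < incKer α β γ K'.u K'.v K'.x K'.y (s, t, z)) :
    ¬ IndepFun (rectIncr V K) (rectIncr V K') P := by
  intro hi
  obtain ⟨s, hs, t, ht, z, hz, h0⟩ := exists_of_ae_control3 hφ
    ((hV.isStableIntegral_rectIncr hα.le hexc hM K).disjoint_of_indepFun hα hM (hV.isStableIntegral_rectIncr hα.le hexc hM K')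
    (incKer_nonneg K.u_lt_x.le K.v_lt_y.le) (incKer_nonneg K'.u_lt_x.le K'.v_lt_y.le) hi) hab hcd
  obtain ⟨h1, h2⟩ := h s hs t ht z hz
  exact h0.elim h1.ne' h2.ne'

theorem IsField3.not_ae_eq (hφ : 0 < φ₁) (hα : 1 < α)
    (hexc : ¬ (γ < 1 / 2 ∧ β = (α - 1) / 2)) (hM : IsStableRandomMeasure P (control3 φ₁ β) α M)
    (hV : IsField3 P φ₁ α β γ M V) {K K' : Rect} {a b c d : ℝ} (hab : a < b) (hcd : c < d)
    (h : ∀ s ∈ Set.Ioo a b, ∀ t ∈ Set.Ioo c d, ∀ z, 0 < z →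
      incKer α β γ K.u K.v K.x K.y (s, t, z) < incKer α β γ K'.u K'.v K'.x K'.y (s, t, z)) :
    ¬ rectIncr V K =ᵐ[P] rectIncr V K' := by
  intro hi
  obtain ⟨s, hs, t, ht, z, hz, h0⟩ := exists_of_ae_control3 hφ
    (((hV.isStableIntegral_rectIncr hα.le hexc hM K).ae_eq_iff hα.le hM (hV.isStableIntegral_rectIncr hα.le hexc hM K')).1 hi) hab hcd
  exact (h s hs t ht z hz).ne h0

/-- The unit square with lower left corner `(u, v)`. -/
def unitSquare (u v : ℝ) (hu : 0 ≤ u) (hv : 0 ≤ v) : Rect :=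
  ⟨u, v, u + 1, v + 1, hu, hv, by linarith, by linarith⟩

/-- For `a ≠ 0` push the second square along the first axis by `T = 1 + 2|b|/|a|`. On both squares
`b q` stays within `±|b|`, so the level `a + |b|` (or `a - |b|` when `a < 0`) separates them. For `a
= 0`, stacking the squares is enough. -/
theorem exists_separates_unitSquare {a b : ℝ} (h : a ≠ 0 ∨ b ≠ 0) :
    ∃ (c u v : ℝ) (hu : 0 ≤ u) (hv : 0 ≤ v),
      (⟨a, b, c, h⟩ : PlaneLine).Separates (unitSquare 0 0 le_rfl le_rfl) (unitSquare u v hu hv) := by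
  have hb : ∀ t : ℝ, 0 < t → t ≤ 1 → -|b| ≤ b * t ∧ b * t ≤ |b| := fun t h0 h1 => by
    rw [← abs_le, abs_mul, abs_of_pos h0]
    exact mul_le_of_le_one_right (abs_nonneg b) h1
  rcases lt_trichotomy a 0 with ha | ha | ha
  · have hT : 0 ≤ 1 + 2 * |b| / -a := by
      have : 0 ≤ 2 * |b| / -a := div_nonneg (by positivity) (by linarith)
      linarith
    have hT' : a * (1 + 2 * |b| / -a) = a - 2 * |b| := by
      have := ha.ne
      field_simp
      ring
    refine ⟨a - |b|, 1 + 2 * |b| / -a, 0, hT, le_rfl, Or.inr ⟨?_, ?_⟩⟩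
    · rintro ⟨p, q⟩ ⟨hp, hq⟩
      simp only [unitSquare, zero_add, Set.mem_Ioc] at hp hq ⊢
      have := (hb q hq.1 hq.2).2
      nlinarith [hp.1]
    · rintro ⟨p, q⟩ ⟨hp, hq⟩
      simp only [unitSquare, zero_add, Set.mem_Ioc] at hp hq ⊢
      have := (hb q hq.1 hq.2).1
      nlinarith [hp.2]
  · have hb0 : b ≠ 0 := h.resolve_left (not_not.2 ha)
    rcases lt_or_gt_of_ne hb0 with hb' | hb'
    · refine ⟨b, 0, 1, le_rfl, zero_le_one, Or.inr ⟨?_, ?_⟩⟩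
      · rintro ⟨p, q⟩ ⟨hp, hq⟩
        simp only [unitSquare, Set.mem_Ioc] at hp hq ⊢
        rw [ha]; nlinarith [hq.1]
      · rintro ⟨p, q⟩ ⟨hp, hq⟩
        simp only [unitSquare, Set.mem_Ioc] at hp hq ⊢
        rw [ha]; nlinarith [hq.2]
    · refine ⟨b, 0, 1, le_rfl, zero_le_one, Or.inl ⟨?_, ?_⟩⟩
      · rintro ⟨p, q⟩ ⟨hp, hq⟩
        simp only [unitSquare, Set.mem_Ioc] at hp hq ⊢
        rw [ha]; nlinarith [hq.2]
      · rintro ⟨p, q⟩ ⟨hp, hq⟩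
        simp only [unitSquare, Set.mem_Ioc] at hp hq ⊢
        rw [ha]; nlinarith [hq.1]
  · have hT : 0 ≤ 1 + 2 * |b| / a := by positivity
    have hT' : a * (1 + 2 * |b| / a) = a + 2 * |b| := by field_simp
    refine ⟨a + |b|, 1 + 2 * |b| / a, 0, hT, le_rfl, Or.inl ⟨?_, ?_⟩⟩
    · rintro ⟨p, q⟩ ⟨hp, hq⟩
      simp only [unitSquare, zero_add, Set.mem_Ioc] at hp hq ⊢
      have := (hb q hq.1 hq.2).2
      nlinarith [hp.2]
    · rintro ⟨p, q⟩ ⟨hp, hq⟩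
      simp only [unitSquare, zero_add, Set.mem_Ioc] at hp hq ⊢
      have := (hb q hq.1 hq.2).1
      nlinarith [hp.1]

/-- If the direction is not vertical, then the increments are not invariant. -/
theorem IsField3.not_invariant_of_ne (hφ : 0 < φ₁) (hα : 1 < α)
    (hexc : ¬ (γ < 1 / 2 ∧ β = (α - 1) / 2)) (hM : IsStableRandomMeasure P (control3 φ₁ β) α M)
    (hV : IsField3 P φ₁ α β γ M V) (h : 1 / 2 ≤ γ ∨ β < (α - 1) / 2) {l : PlaneLine}
    (hl : (0, 0) ∈ l.carrier) (hb : l.b ≠ 0) : ¬ InvariantRectIncrements P V l := by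
  intro hi
  have hc : l.c = 0 := by simpa [PlaneLine.carrier] using hl.symm
  -- The vector `(1, s)` spans the line. Starting at height `|s|` keeps the shifted square in the
  -- quadrant even if `s < 0`.
  set s := -l.a / l.b with hs
  have h0 : 0 ≤ |s| + s := by linarith [neg_abs_le s]
  have hp : ((1 : ℝ), s) ∈ l.carrier := by
    simp only [PlaneLine.carrier, Set.mem_ofPred_eq, hc, hs]
    field_simp
    ring
  refine hV.not_ae_eq hφ hα hexc hM (K := unitSquare 0 |s| le_rfl (abs_nonneg s))
    (K' := unitSquare 1 (|s| + s) zero_le_one h0) (a := 1) (b := 2) (c := |s| + s)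
    (d := |s| + s + 1) (by norm_num) (by linarith) ?_ (hi _ _ _ hp ?_)
  -- For `1 < a < 2` the point is later than the first square, whose kernel vanishes, but earlier
  -- than the right edge of the shifted one.
  · intro a ha b hb z hz
    simp only [unitSquare]
    rw [incKer_eq_zero h (by norm_num) (by linarith [ha.1])]
    exact incKer_pos h (by norm_num) (by linarith) (by linarith [ha.2]) hb hz
  · refine ⟨?_, ?_, ?_, ?_⟩ <;> simp only [unitSquare] <;> ring

theorem IsField3.dependent (hφ : 0 < φ₁) (hα : 1 < α) (hγ : γ = 1 / 2)
    (hM : IsStableRandomMeasure P (control3 φ₁ β) α M)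
    (hV : IsField3 P φ₁ α β γ M V) : HasDependentRectIncrements P V := by
  have hexc : ¬ (γ < 1 / 2 ∧ β = (α - 1) / 2) := fun h => h.1.ne hγ
  intro l hl
  refine ⟨fun hi => ?_, ?_⟩
  -- `(-l.b, l.a)` are the coefficients of a line orthogonal to `l`. For `γ = 1/2` any two separated
  -- squares will do, since both kernels are positive for all negative times.
  · obtain ⟨c, u, v, hu, hv, hsep⟩ := exists_separates_unitSquare (a := -l.b) (b := l.a)
      (by simpa [or_comm] using l.nondeg)
    refine hV.not_indepFun hφ hα hexc hM (a := -1) (b := 0) (c := 0) (d := 1) (by norm_num)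
      one_pos ?_ (hi ⟨-l.b, l.a, c, by simpa [or_comm] using l.nondeg⟩ (by
        simp only [PlaneLine.Perp]; ring) _ _ hsep)
    intro s hs t _ z hz
    simp only [unitSquare]
    exact ⟨incKer_half_pos hγ (by norm_num) (by norm_num) (by linarith [hs.2]) hz,
      incKer_half_pos hγ (by linarith) (by linarith) (by linarith [hs.2]) hz⟩
  · by_cases hb : l.b = 0
    · intro hi
      have hp : ((0 : ℝ), (1 : ℝ)) ∈ l.carrier := by
        have hc : l.c = 0 := by simpa [PlaneLine.carrier] using hl.symm
        simp [PlaneLine.carrier, hc, hb]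
      refine hV.not_ae_eq hφ hα hexc hM (K := unitSquare 0 0 le_rfl le_rfl)
        (K' := unitSquare 0 1 le_rfl zero_le_one) (a := -1) (b := 0) (c := 2)
        (d := 3) (by norm_num) (by norm_num) ?_ (hi _ _ _ hp ?_)
      · intro a ha b hb z hz
        simp only [unitSquare]
        norm_num only
        exact incKer_half_lt hγ ha.2 hb.1 hz
      · refine ⟨?_, ?_, ?_, ?_⟩ <;> simp only [unitSquare] <;> ring
    · exact hV.not_invariant_of_ne hφ hα hexc hM (Or.inl hγ.ge) hl hb

/-- The direction of the first coordinate axis. -/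
def horizontal : PlaneLine := ⟨0, 1, 0, Or.inr one_ne_zero⟩

/-- The direction of the second coordinate axis. -/
def vertical : PlaneLine := ⟨1, 0, 0, Or.inl one_ne_zero⟩

theorem IsField3.dependent_horizontal (hφ : 0 < φ₁) (hα : 1 < α)
    (hexc : ¬ (γ < 1 / 2 ∧ β = (α - 1) / 2)) (h : 1 / 2 ≤ γ ∨ β < (α - 1) / 2)
    (hM : IsStableRandomMeasure P (control3 φ₁ β) α M) (hV : IsField3 P φ₁ α β γ M V) :
    DependentRectIncrementsIn P V horizontal := by
  refine ⟨fun hi => ?_, hV.not_invariant_of_ne hφ hα hexc hM h (by simp [PlaneLine.carrier,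
    horizontal]) one_ne_zero⟩
  refine hV.not_indepFun hφ hα hexc hM (K := unitSquare 0 0 le_rfl le_rfl)
    (K' := unitSquare 1 0 zero_le_one le_rfl) (a := -1) (b := 0) (c := 0) (d := 1) (by norm_num)
    one_pos ?_ (hi ⟨1, 0, 1, Or.inl one_ne_zero⟩ (by simp [PlaneLine.Perp, horizontal]) _ _
      (Or.inl ⟨?_, ?_⟩))
  · intro s hs t ht z hz
    have ht' : t ∈ Set.Ioo (0 : ℝ) (0 + 1) := by simpa using ht
    simp only [unitSquare]
    exact ⟨incKer_pos h (by norm_num) (by norm_num) (by linarith [hs.2]) ht' hz,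
      incKer_pos h (by norm_num) (by norm_num) (by linarith [hs.2]) ht' hz⟩
  · rintro ⟨p, q⟩ ⟨hp, hq⟩
    simp only [unitSquare, Set.mem_Ioc] at hp ⊢
    linarith [hp.2]
  · rintro ⟨p, q⟩ ⟨hp, hq⟩
    simp only [unitSquare, Set.mem_Ioc] at hp ⊢
    linarith [hp.1]

theorem IsField3.dependent_vertical (hφ : 0 < φ₁) (hα : 1 < α) (hγ : γ < 1 / 2)
    (hβ : (α - 1) / 2 < β)
    (hM : IsStableRandomMeasure P (control3 φ₁ β) α M) (hV : IsField3 P φ₁ α β γ M V) :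
    DependentRectIncrementsIn P V vertical := by
  have hexc : ¬ (γ < 1 / 2 ∧ β = (α - 1) / 2) := fun h => hβ.ne' h.2
  refine ⟨fun hi => ?_, fun hi => ?_⟩
  · refine hV.not_indepFun hφ hα hexc hM (K := unitSquare 0 0 le_rfl le_rfl)
      (K' := unitSquare 0 1 le_rfl zero_le_one) (a := 0) (b := 1) (c := 0) (d := 1) one_pos
      one_pos ?_ (hi ⟨0, 1, 1, Or.inr one_ne_zero⟩ (by simp [PlaneLine.Perp, vertical]) _ _
        (Or.inl ⟨?_, ?_⟩))
    · intro s hs t ht z hz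
      have hs' : s ∈ Set.Ioo (0 : ℝ) (0 + 1) := by simpa using hs
      simp only [unitSquare]
      exact ⟨incKer_lt_gt_pos hγ hβ (by norm_num) hs' hz,
        incKer_lt_gt_pos hγ hβ (by norm_num) hs' hz⟩
    · rintro ⟨p, q⟩ ⟨hp, hq⟩
      simp only [unitSquare, Set.mem_Ioc] at hq ⊢
      linarith [hq.2]
    · rintro ⟨p, q⟩ ⟨hp, hq⟩
      simp only [unitSquare, Set.mem_Ioc] at hq ⊢
      linarith [hq.1]
  · refine hV.not_ae_eq hφ hα hexc hM (K := unitSquare 0 0 le_rfl le_rfl)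
      (K' := unitSquare 0 1 le_rfl zero_le_one) (a := 0) (b := 1) (c := 2)
      (d := 3) (by norm_num) (by norm_num) ?_
      (hi _ _ (0, 1) (by simp [PlaneLine.carrier, vertical]) ?_)
    · intro a ha b hb z hz
      simp only [unitSquare]
      norm_num only
      exact incKer_lt_gt_lt hγ hβ ha hb.1 hz
    · refine ⟨?_, ?_, ?_, ?_⟩ <;> simp only [unitSquare] <;> ring

/-- Two separated rectangles can meet a common parallel of the line only if it is the line itself;
so kernels carried by the projections of the rectangles overlap on a null set at most. -/
theorem PlaneLine.Separates.eq_of_mem {l : PlaneLine} {K K' : Rect} (h : l.Separates K K')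
    {p q : ℝ × ℝ} (hp : p ∈ K.toSet) (hq : q ∈ K'.toSet)
    (hpq : l.a * p.1 + l.b * p.2 = l.a * q.1 + l.b * q.2) : l.a * p.1 + l.b * p.2 = l.c := by
  rcases h with h | h
  · exact le_antisymm (h.1 p hp) (hpq ▸ h.2 q hq)
  · exact le_antisymm (hpq ▸ h.1 q hq) (h.2 p hp)

theorem IsField3.indep_vertical (hα : 1 < α) (hγ : 1 / 2 < γ)
    (hM : IsStableRandomMeasure P (control3 φ₁ β) α M) (hV : IsField3 P φ₁ α β γ M V) :
    IndepRectIncrements P V vertical := by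
  have hexc : ¬ (γ < 1 / 2 ∧ β = (α - 1) / 2) := fun h => h.1.not_gt hγ
  intro l hl K K' hsep
  have ha : l.a = 0 := by simpa [PlaneLine.Perp, vertical] using hl
  have hb : l.b ≠ 0 := l.nondeg.resolve_left (not_not.2 ha)
  refine (hV.isStableIntegral_rectIncr hα.le hexc hM K).indepFun hα.le hM (hV.isStableIntegral_rectIncr hα.le hexc hM K') ?_
  -- The separating line is horizontal, at height `l.c / l.b`. Off this level the two indicators
  -- cannot both be nonzero.
  filter_upwards [ae_control3_of_ae_volume (ae_snd_fst_ne (l.c / l.b))] with p hp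
  rw [incKer_eq_gt hγ, incKer_eq_gt hγ]
  by_contra! hc
  have h1 := Set.mem_of_indicator_ne_zero (left_ne_zero_of_mul hc.1)
  have h2 := Set.mem_of_indicator_ne_zero (left_ne_zero_of_mul hc.2)
  have := hsep.eq_of_mem (p := (K.x, p.2.1)) (q := (K'.x, p.2.1))
    ⟨⟨K.u_lt_x, le_rfl⟩, h1.1, h1.2.le⟩ ⟨⟨K'.u_lt_x, le_rfl⟩, h2.1, h2.2.le⟩ (by simp [ha])
  refine hp ?_
  rw [eq_div_iff hb]
  simp only [ha, zero_mul, zero_add] at this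
  linarith

theorem IsField3.indep_horizontal (hα : 1 < α) (hγ : γ < 1 / 2) (hβ : (α - 1) / 2 < β)
    (hM : IsStableRandomMeasure P (control3 φ₁ β) α M) (hV : IsField3 P φ₁ α β γ M V) :
    IndepRectIncrements P V horizontal := by
  have hexc : ¬ (γ < 1 / 2 ∧ β = (α - 1) / 2) := fun h => hβ.ne' h.2
  intro l hl K K' hsep
  have hb : l.b = 0 := by simpa [PlaneLine.Perp, horizontal] using hl
  have ha : l.a ≠ 0 := l.nondeg.resolve_right (not_not.2 hb)
  refine (hV.isStableIntegral_rectIncr hα.le hexc hM K).indepFun hα.le hM (hV.isStableIntegral_rectIncr hα.le hexc hM K') ?_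
  filter_upwards [ae_control3_of_ae_volume (ae_fst_ne (l.c / l.a))] with p hp
  rw [incKer_eq_lt_gt hγ hβ, incKer_eq_lt_gt hγ hβ]
  by_contra! hc
  have h1 := Set.mem_of_indicator_ne_zero (left_ne_zero_of_mul hc.1)
  have h2 := Set.mem_of_indicator_ne_zero (left_ne_zero_of_mul hc.2)
  have := hsep.eq_of_mem (p := (p.1, K.y)) (q := (p.1, K'.y))
    ⟨⟨h1.1, h1.2.le⟩, K.v_lt_y, le_rfl⟩ ⟨⟨h2.1, h2.2.le⟩, K'.v_lt_y, le_rfl⟩ (by simp [hb])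
  refine hp ?_
  rw [eq_div_iff ha]
  simp only [hb, zero_mul, add_zero] at this
  linarith

theorem IsField3.invariant_vertical (hα : 1 < α) (hγ : γ < 1 / 2) (hβ : β < (α - 1) / 2)
    (hM : IsStableRandomMeasure P (control3 φ₁ β) α M) (hV : IsField3 P φ₁ α β γ M V) :
    InvariantRectIncrements P V vertical := by
  have hexc : ¬ (γ < 1 / 2 ∧ β = (α - 1) / 2) := fun h => hβ.ne h.2
  intro K K' p hp hK
  have hp1 : p.1 = 0 := by simpa [PlaneLine.carrier, vertical] using hp
  obtain ⟨h1, h2, h3, h4⟩ := hK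
  refine ((hV.isStableIntegral_rectIncr hα.le hexc hM K).ae_eq_iff hα.le hM (hV.isStableIntegral_rectIncr hα.le hexc hM K')).2
    (ae_of_all _ fun q => ?_)
  -- A vertical shift preserves `y - v` and the time interval, so the kernels coincide everywhere.
  rw [incKer_eq_lt_lt hγ hβ, incKer_eq_lt_lt hγ hβ, h1, h2, h3, h4, hp1, add_zero, add_zero,
    add_sub_add_right_eq_sub]

theorem IsField3.semiDependent (hφ : 0 < φ₁) (hα : 1 < α) (hγ : γ ≠ 1 / 2)
    (hexc : ¬ (γ < 1 / 2 ∧ β = (α - 1) / 2))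
    (hM : IsStableRandomMeasure P (control3 φ₁ β) α M) (hV : IsField3 P φ₁ α β γ M V) :
    HasSemiDependentRectIncrements P V := by
  have hh : ((0 : ℝ), (0 : ℝ)) ∈ horizontal.carrier := by simp [PlaneLine.carrier, horizontal]
  have hv : ((0 : ℝ), (0 : ℝ)) ∈ vertical.carrier := by simp [PlaneLine.carrier, vertical]
  rcases lt_or_gt_of_ne hγ with hγ | hγ
  · rcases lt_trichotomy β ((α - 1) / 2) with hβ | hβ | hβ
    · exact ⟨_, _, hh, hv, hV.dependent_horizontal hφ hα hexc (Or.inr hβ) hM,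
        Or.inr (hV.invariant_vertical hα hγ hβ hM)⟩
    · exact (hexc ⟨hγ, hβ⟩).elim
    · exact ⟨_, _, hv, hh, hV.dependent_vertical hφ hα hγ hβ hM,
        Or.inl (hV.indep_horizontal hα hγ hβ hM)⟩
  · exact ⟨_, _, hh, hv, hV.dependent_horizontal hφ hα hexc (Or.inl hγ.le) hM,
      Or.inl (hV.indep_vertical hα hγ hM)⟩

end Dependence

end RF

theorem mainTheorem8 {Ω : Type*} [MeasurableSpace Ω] (P : Measure Ω) [IsProbabilityMeasure P]
    (φ₁ α β γ : ℝ) (hφ : 0 < φ₁) (hα₁ : 1 < α) (hα₂ : α ≤ 2) (hβ₀ : 0 < β) (hβ₁ : β < α - 1)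
    (hγ : 0 < γ) (hexc : ¬ (γ < 1 / 2 ∧ β = (α - 1) / 2))
    (M : Set (ℝ × ℝ × ℝ) → Ω → ℝ)
    (hM : RF.IsStableRandomMeasure P (RF.control3 φ₁ β) α M) :
    (∃ V : ℝ → ℝ → Ω → ℝ, RF.IsField3 P φ₁ α β γ M V) ∧
    (∀ V V' : ℝ → ℝ → Ω → ℝ, RF.IsField3 P φ₁ α β γ M V → RF.IsField3 P φ₁ α β γ M V' →
      ∀ x y : ℝ, 0 ≤ x → 0 ≤ y → V x y =ᵐ[P] V' x y) ∧
    ∀ V : ℝ → ℝ → Ω → ℝ, RF.IsField3 P φ₁ α β γ M V →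
      RF.HasStableFdd P α V ∧
      (∀ x y : ℝ, 0 ≤ x → 0 ≤ y → V x 0 =ᵐ[P] 0 ∧ V 0 y =ᵐ[P] 0) ∧
      RF.HasStationaryRectIncrements P V ∧
      RF.IsOperatorScaling P γ (RF.H3 α β γ) V ∧
      (γ = 1 / 2 → RF.HasDependentRectIncrements P V) ∧
      (γ ≠ 1 / 2 → RF.HasSemiDependentRectIncrements P V) := by
  refine ⟨RF.IsField3.exists hφ hα₁ hβ₀ hβ₁ hexc hM, fun V V' hV hV' x y hx hy =>
    (hV x y hx hy).ae_unique (hV' x y hx hy), fun V hV => ?_⟩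
  exact ⟨hV.hasStableFdd hα₁.le hM, fun x y hx hy => hV.zero hα₁.le hM hx hy,
    hV.stationary hα₁.le hexc hM, hV.operatorScaling hα₁ hβ₁ hγ hexc hM,
    fun h => hV.dependent hφ hα₁ h hM, fun h => hV.semiDependent hφ hα₁ h hexc hM⟩
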